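/- All graphs are finite and simple. A graph is maximal planar if it is planar and joining any two of its non-adjacent vertices by an edge makes it non-planar. For a graph $G$ and a set $X$ of vertices of $G$, let $c(G-X)$ denote the number of components of $G-X$; the set $X$ is separating if $c(G-X)\ge 2$. The toughness of $G$ is the minimum of $|X|/c(G-X)$ over all separating sets $X$ of $G$ (and it is $\infty$ if $G$ is complete), and $G$ is $t$-tough if its toughness is at least $t$. For every $i\in\{1,2,3\}$ and every integer $n\ge 0$ there exists a maximal planar graph $F_{i,n}$ on $f_i(n)$ vertices whose longest cycle has exactly $c_i(n)$ vertices, where (i) $f_1(n)=1+101(1+30+\dots+30^n)$ and $c_1(n)=1+93(1+22+\dots+22^n)$, and $F_{1,n}$ is $\tfrac54$-tough; (ii) $f_2(n)=1+14(1+6+\dots+6^n)$ and $c_2(n)=1+13(1+5+\dots+5^n)$, and $F_{2,n}$ is $\tfrac87$-tough; (iii) $f_3(n)=4+5(1+3+\dots+3^n)$ and $c_3(n)=3\cdot 2^{n+3}-9n-15$, and the toughness of $F_{3,n}$ is greater than $1$. -/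

import Mathlib

open scoped ENNReal

namespace SimpleGraph

/-- A rotation system (combinatorial embedding in a closed oriented surface) of a graph:
for every vertex a cyclic order of the darts (oriented edges) that leave it. -/
structure RotationSystem {V : Type*} (G : SimpleGraph V) where
  /-- the dart that follows a given dart in the cyclic order around its initial vertex -/
  next : Equiv.Perm G.Dart
  fst_next : ∀ d : G.Dart, (next d).fst = d.fst
  sameCycle_next : ∀ d e : G.Dart, d.fst = e.fst → next.SameCycle d e

/-- Face tracing: traverse a dart, then turn to the next dart around its terminal vertex. -/
def RotationSystem.facePerm {V : Type*} {G : SimpleGraph V} (R : G.RotationSystem) :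
    Equiv.Perm G.Dart :=
  (Function.Involutive.toPerm Dart.symm Dart.symm_involutive).trans R.next

/-- The facial walks of a rotation system: the cycles of the face tracing permutation. -/
def RotationSystem.Face {V : Type*} {G : SimpleGraph V} (R : G.RotationSystem) : Type _ :=
  Quotient (Equiv.Perm.SameCycle.setoid R.facePerm)

/-- A finite graph is planar if it has a combinatorial embedding all of whose components lie in
spheres, that is, one with `V - E + F = 2 C`, where `C` counts the components and `F` the faces,
summed over the spheres that carry the components. An isolated vertex has no dart, hence no facial
walk, and its sphere has exactly one face. (Every component contributes `2 - 2 g ≤ 2` to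
`V - E + F`, where `g` is the genus of its surface, so that equality says that every `g` is `0`.) -/
def IsPlanar {V : Type*} [Finite V] (G : SimpleGraph V) : Prop :=
  ∃ R : G.RotationSystem,
    Nat.card V + (Nat.card R.Face + Nat.card {v : V // ∀ w, ¬ G.Adj v w}) =
      Nat.card G.edgeSet + 2 * Nat.card G.ConnectedComponent

/-- A planar graph is maximal planar if it is not a proper subgraph of a planar graph
with the same vertices. -/
def IsMaximalPlanar {V : Type*} [Finite V] (G : SimpleGraph V) : Prop :=
  G.IsPlanar ∧ ∀ H : SimpleGraph V, G < H → ¬ H.IsPlanar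

/-- The graph `G - X`. -/
abbrev deleteVerts {V : Type*} (G : SimpleGraph V) (X : Finset V) :
    SimpleGraph {v : V | v ∉ X} :=
  G.induce {v : V | v ∉ X}

/-- `X` is separating if `G - X` is disconnected (it has at least two components). -/
def IsSeparatingSet {V : Type*} (G : SimpleGraph V) (X : Finset V) : Prop :=
  ¬ (G.deleteVerts X).Preconnected

/-- The toughness of a finite graph: the minimum of `|X| / c(G - X)` over all separating sets `X`,
where `c` is the number of components. It is infinite if there is no separating set, that is, if
the graph is complete. -/
noncomputable def toughness {V : Type*} [Finite V] (G : SimpleGraph V) : ℝ≥0∞ :=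
  ⨅ (X : Finset V) (_ : G.IsSeparatingSet X),
    (X.card : ℝ≥0∞) / (Nat.card (G.deleteVerts X).ConnectedComponent : ℝ≥0∞)

/-- `G` is `t`-tough if its toughness is at least `t`. -/
def IsTough {V : Type*} [Finite V] (G : SimpleGraph V) (t : ℝ≥0∞) : Prop :=
  t ≤ G.toughness

/-- `G` has a cycle, and its longest cycles have exactly `k` vertices
(a cycle has as many vertices as edges). -/
def LongestCycleHasCard {V : Type*} (G : SimpleGraph V) (k : ℕ) : Prop :=
  IsGreatest {m : ℕ | ∃ (v : V) (p : G.Walk v v), p.IsCycle ∧ p.length = m} k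

end SimpleGraph

/-! All graphs are assembled from disks, that is, triangulations of a triangle with three marked
corners, by drawing disks in faces of a host. Gluing preserves a triangulated rotation system and
the count E = 3V - 6 (`Disk.IsPlane.glue`). Euler's formula then gives planarity, and the bound E ≤
3V - 6 for connected planar graphs forbids any further edge.

Toughness β/α is proved by a weighted count. In a disk only the components of D - X without corners
are counted, and each deleted corner is left to the surroundings. With three or two deleted corners,
β times the number of components may exceed α times the number of other deleted vertices by ω₃ or
ω₂. With at most one deleted corner a nonempty count has to leave the margin γ. These parameters of
a glued disk follow from a check of the host alone (`Disk.IsToughHost.glue`). The remaining corners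
lie in one further component (`Disk.IsTough.le_of_isSeparatingSet`).

For the circumference a cycle is regarded as a cyclic permutation of the vertices. It enters and
leaves an inserted disk only through the three corners, and each corner has one predecessor and one
successor. An octahedron with disks at its three sides has all three visited by a cycle that also
goes elsewhere only if it is entered or left at least three times. In the hub ten such octahedra
share the vertex `hubP`; without using `hubP` only one entry and one exit are possible, so eight of
the ten octahedra miss a disk, and 22 of 30 disks are visited (`hubWith_isTotalBound`). In the core
six disks compete for the three vertices of a face, and one disk is missed
(`coreWith_isTotalBound`). In the third family entries are counted exactly, by a recursion for disks
that are passed once, twice or three times (`IsTour.visits_sideFace_le`).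

Cycles that attain the bounds are concatenated from paths between corners. For the first two
families the recursion draws the new disk in the central face of an octahedron (`beltWith`), which
restores the toughness parameters of a triangle with one inner vertex. -/

namespace SimpleGraph

/-! ### Face counting and the edge bound for planar graphs -/

section Faces

variable {α : Type*} [Finite α] (φ : Equiv.Perm α)

theorem three_mul_card_orbits_le (h1 : ∀ d, φ d ≠ d) (h2 : ∀ d, φ (φ d) ≠ d) :
    3 * Nat.card (Quotient (Equiv.Perm.SameCycle.setoid φ)) ≤ Nat.card α := by
  classical
  have := Fintype.ofFinite α
  have := Fintype.ofFinite (Quotient (Equiv.Perm.SameCycle.setoid φ))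
  rw [Nat.card_eq_fintype_card, Nat.card_eq_fintype_card, ← Finset.card_univ (α := α),
    Finset.card_eq_sum_card_fiberwise (s := Finset.univ) (t := Finset.univ)
      (f := fun d => (Quotient.mk (Equiv.Perm.SameCycle.setoid φ) d)) (fun _ _ => by simp),
    ← Finset.card_univ, mul_comm, ← smul_eq_mul]
  refine Finset.card_nsmul_le_sum _ _ _ fun q _ => ?_
  induction q using Quotient.inductionOn with
  | h d =>
    have hs : ({d, φ d, φ (φ d)} : Finset α) ⊆
        Finset.univ.filter (fun e => Quotient.mk (Equiv.Perm.SameCycle.setoid φ) e = ⟦d⟧) := by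
      intro e he
      simp only [Finset.mem_insert, Finset.mem_singleton] at he
      simp only [Finset.mem_filter, Finset.mem_univ, true_and]
      refine Quotient.sound (s := Equiv.Perm.SameCycle.setoid φ) ?_
      change φ.SameCycle e d
      rcases he with rfl | rfl | rfl
      · exact Equiv.Perm.SameCycle.refl _ _
      · exact ⟨-1, by simp⟩
      · exact ⟨-2, by simp [zpow_neg, pow_two, zpow_ofNat]⟩
    refine le_trans (le_of_eq ?_) (Finset.card_le_card hs)
    rw [Finset.card_eq_three.mpr]
    exact ⟨d, φ d, φ (φ d), (h1 d).symm, (h2 d).symm, (h1 (φ d)).symm, rfl⟩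

theorem three_mul_card_orbits_eq (h1 : ∀ d, φ d ≠ d) (h3 : ∀ d, φ (φ (φ d)) = d) :
    3 * Nat.card (Quotient (Equiv.Perm.SameCycle.setoid φ)) = Nat.card α := by
  classical
  refine le_antisymm (three_mul_card_orbits_le φ h1 fun d h => h1 d ?_) ?_
  · conv_rhs => rw [← h3 d, h]
  have := Fintype.ofFinite α
  have := Fintype.ofFinite (Quotient (Equiv.Perm.SameCycle.setoid φ))
  rw [Nat.card_eq_fintype_card, Nat.card_eq_fintype_card, ← Finset.card_univ (α := α),
    Finset.card_eq_sum_card_fiberwise (s := Finset.univ) (t := Finset.univ)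
      (f := fun d => (Quotient.mk (Equiv.Perm.SameCycle.setoid φ) d)) (fun _ _ => by simp),
    ← Finset.card_univ, mul_comm, ← smul_eq_mul]
  refine Finset.sum_le_card_nsmul _ _ _ fun q _ => ?_
  induction q using Quotient.inductionOn with
  | h d =>
    have hs : Finset.univ.filter (fun e => Quotient.mk (Equiv.Perm.SameCycle.setoid φ) e = ⟦d⟧) ⊆
        ({d, φ d, φ (φ d)} : Finset α) := by
      intro e he
      simp only [Finset.mem_filter, Finset.mem_univ, true_and] at he
      have he : φ.SameCycle e d := Quotient.exact he
      obtain ⟨k, hk⟩ := he.symm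
      have h30 : φ ^ (3 : ℤ) = 1 := by
        ext x; simp [zpow_ofNat, pow_succ, h3]
      have : φ ^ k = φ ^ (k % 3) := by
        conv_lhs => rw [← Int.mul_ediv_add_emod k 3, zpow_add, zpow_mul, h30]
        simp
      rw [this] at hk
      have hlt : k % 3 = 0 ∨ k % 3 = 1 ∨ k % 3 = 2 := by omega
      rcases hlt with h | h | h <;> rw [h] at hk <;>
        simp [zpow_ofNat, pow_two] at hk <;> simp [← hk]
    exact (Finset.card_le_card hs).trans Finset.card_le_three

end Faces

variable {V : Type*}

instance [Finite V] (G : SimpleGraph V) : Finite G.Dart :=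
  Finite.of_injective _ Dart.toProd_injective

theorem natCard_dart [Finite V] (G : SimpleGraph V) : Nat.card G.Dart = 2 * Nat.card G.edgeSet := by
  classical
  have := Fintype.ofFinite V
  rw [Nat.card_eq_fintype_card, G.dart_card_eq_twice_card_edges, Nat.card_eq_fintype_card,
    edgeFinset_card]

theorem natCard_isolated_eq_zero [Nontrivial V] {G : SimpleGraph V} (hG : G.Connected) :
    Nat.card {v : V // ∀ w, ¬ G.Adj v w} = 0 := by
  have : IsEmpty {v : V // ∀ w, ¬ G.Adj v w} := ⟨fun v => by
    obtain ⟨w, hw⟩ := hG.preconnected.exists_adj_of_nontrivial v.1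
    exact v.2 w hw⟩
  simp

theorem natCard_connectedComponent_eq_one {G : SimpleGraph V} (hG : G.Connected) :
    Nat.card G.ConnectedComponent = 1 := by
  have := hG.preconnected.subsingleton_connectedComponent
  have := hG.nonempty
  have : Nonempty G.ConnectedComponent := ⟨G.connectedComponentMk hG.nonempty.some⟩
  exact Nat.card_unique

namespace RotationSystem

variable {G : SimpleGraph V} (R : G.RotationSystem)

theorem facePerm_apply (d : G.Dart) : R.facePerm d = R.next d.symm := rfl

theorem facePerm_fst (d : G.Dart) : (R.facePerm d).fst = d.snd := by
  rw [facePerm_apply, R.fst_next]; rfl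

theorem facePerm_ne (d : G.Dart) : R.facePerm d ≠ d := by
  intro h
  have := R.facePerm_fst d
  rw [h] at this
  exact d.fst_ne_snd this

theorem eq_of_next_eq {d e : G.Dart} (h : R.next d = d) (he : d.fst = e.fst) : e = d := by
  obtain ⟨k, hk⟩ := R.sameCycle_next d e he
  rw [← hk]
  exact Function.IsFixedPt.perm_zpow (show Function.IsFixedPt R.next d from h) k

/-- A face of length two makes `d` and `d.symm` fixed points of the rotation. Both ends of the edge
then have degree one, so a connected graph consists of this edge only. -/
theorem facePerm_facePerm_ne [Finite V] (hG : G.Connected) (hV : 3 ≤ Nat.card V) (d : G.Dart) :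
    R.facePerm (R.facePerm d) ≠ d := by
  intro h
  have h1 := R.facePerm_fst d
  have h2 := R.facePerm_fst (R.facePerm d)
  rw [h] at h2
  have hs : R.facePerm d = d.symm := by
    ext
    · exact h1
    · exact h2.symm
  have n1 : R.next d.symm = d.symm := by rw [← facePerm_apply, hs]
  have n2 : R.next d = d := by
    rw [hs, facePerm_apply, Dart.symm_symm] at h
    exact h
  have key : ∀ v, v = d.fst ∨ v = d.snd := by
    intro v
    obtain ⟨p⟩ := hG.preconnected d.fst v
    suffices ∀ u v, G.Walk u v → (u = d.fst ∨ u = d.snd) → (v = d.fst ∨ v = d.snd) from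
      this _ _ p (Or.inl rfl)
    intro u v p
    induction p with
    | nil => exact id
    | @cons u w v huw p ih =>
      intro hu
      apply ih
      rcases hu with rfl | rfl
      · right
        have := R.eq_of_next_eq n2 (e := ⟨(d.fst, w), huw⟩) rfl
        exact congrArg (fun e => e.toProd.2) this
      · left
        have := R.eq_of_next_eq n1 (e := ⟨(d.snd, w), huw⟩) rfl
        exact congrArg (fun e => e.toProd.2) this
  classical
  have := Fintype.ofFinite V
  have hle : (Finset.univ : Finset V) ⊆ {d.fst, d.snd} := by
    intro v _
    simpa using key v
  have := (Finset.card_le_card hle).trans Finset.card_le_two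
  rw [Finset.card_univ, ← Nat.card_eq_fintype_card] at this
  omega

end RotationSystem

theorem nontrivial_of_three_le_natCard [Finite V] (hV : 3 ≤ Nat.card V) : Nontrivial V := by
  have := Fintype.ofFinite V
  rw [Nat.card_eq_fintype_card] at hV
  exact Fintype.one_lt_card_iff_nontrivial.mp (by omega)

/-- Every facial walk has length at least three, so 3F ≤ 2E, and Euler's formula gives E ≤ 3V - 6.
-/
theorem IsPlanar.natCard_edgeSet_add_six_le [Finite V] {G : SimpleGraph V} (h : G.IsPlanar)
    (hG : G.Connected) (hV : 3 ≤ Nat.card V) : Nat.card G.edgeSet + 6 ≤ 3 * Nat.card V := by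
  obtain ⟨R, hR⟩ := h
  have := nontrivial_of_three_le_natCard hV
  rw [natCard_isolated_eq_zero hG, natCard_connectedComponent_eq_one hG] at hR
  have hF := three_mul_card_orbits_le R.facePerm R.facePerm_ne (R.facePerm_facePerm_ne hG hV)
  rw [natCard_dart] at hF
  change 3 * Nat.card R.Face ≤ _ at hF
  omega

/-! ### Triangulated rotation systems are maximal planar -/

/-- `nxt` describes a rotation system of `G` all of whose faces are triangles: `nxt v u` is the
neighbour of `v` that follows `u`. -/
structure IsTriangulated (G : SimpleGraph V) (nxt : V → V → V) : Prop where
  adj_nxt : ∀ {u v}, G.Adj u v → G.Adj u (nxt u v)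
  nxt_nxt : ∀ {u v}, G.Adj u v → nxt (nxt v u) v = u
  exists_iterate : ∀ {u v w}, G.Adj u v → G.Adj u w → ∃ k : ℕ, (nxt u)^[k] v = w
  connected : G.Connected

namespace IsTriangulated

variable {G : SimpleGraph V} {nxt : V → V → V} (h : G.IsTriangulated nxt)
include h

theorem nxt_eq {v w : V} (hvw : G.Adj v w) : nxt v (nxt w v) = w := by
  have h1 := h.nxt_nxt hvw
  have h2 := h.nxt_nxt (h.adj_nxt hvw.symm)
  rwa [h1] at h2

/-- The rotation system of a triangulated graph. -/
def rotation : G.RotationSystem where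
  next :=
    { toFun := fun d => ⟨(d.fst, nxt d.fst d.snd), h.adj_nxt d.adj⟩
      -- The neighbour that precedes v around u is the third vertex `nxt v u` of the triangle on the
      -- other side of the edge uv.
      invFun := fun d => ⟨(d.fst, nxt d.snd d.fst), by
        have := h.adj_nxt (h.adj_nxt d.adj.symm).symm
        rw [h.nxt_nxt d.adj] at this
        exact this.symm⟩
      left_inv := fun d => by
        ext
        · rfl
        · exact h.nxt_nxt d.adj.symm
      right_inv := fun d => by
        ext
        · rfl
        · exact h.nxt_eq d.adj }
  fst_next := fun d => rfl
  sameCycle_next := fun d e hde => by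
    have he := e.adj
    rw [← hde] at he
    obtain ⟨k, hk⟩ := h.exists_iterate d.adj he
    refine ⟨k, ?_⟩
    rw [zpow_natCast]
    have : ∀ (k : ℕ) (f : Equiv.Perm G.Dart), (∀ d, (f d).toProd = (d.fst, nxt d.fst d.snd)) →
        ∀ d, ((f ^ k) d).toProd = (d.fst, (nxt d.fst)^[k] d.snd) := by
      intro k f hf
      induction k with
      | zero => intro d; rfl
      | succ k ih =>
        intro d
        rw [pow_succ', Equiv.Perm.mul_apply, hf, ih, Function.iterate_succ_apply']
    refine Dart.ext _ _ ?_
    rw [this k _ (fun d => rfl), hk, hde]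

theorem facePerm_toProd (d : G.Dart) :
    (h.rotation.facePerm d).toProd = (d.snd, nxt d.snd d.fst) := rfl

/-- The count of darts says E = 3V - 6. Together with 3F = 2E this is Euler's formula for the
sphere, and a proper supergraph has too many edges to be planar. -/
theorem isMaximalPlanar [Finite V] (hV : 3 ≤ Nat.card V)
    (hcard : Nat.card G.Dart + 12 = 6 * Nat.card V) : G.IsMaximalPlanar := by
  have := nontrivial_of_three_le_natCard hV
  have hE := natCard_dart G
  refine ⟨⟨h.rotation, ?_⟩, fun H hlt hp => ?_⟩
  · rw [natCard_isolated_eq_zero h.connected, natCard_connectedComponent_eq_one h.connected]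
    have hF := three_mul_card_orbits_eq h.rotation.facePerm h.rotation.facePerm_ne (fun d => by
      refine Dart.ext _ _ ?_
      simp only [facePerm_toProd]
      rw [h.nxt_nxt d.adj, h.nxt_eq d.adj])
    change 3 * Nat.card h.rotation.Face = _ at hF
    omega
  · have h1 := hp.natCard_edgeSet_add_six_le (h.connected.mono hlt.le) hV
    have h2 : Nat.card G.edgeSet < Nat.card H.edgeSet := by
      rw [Nat.card_coe_set_eq, Nat.card_coe_set_eq]
      exact Set.ncard_lt_ncard (edgeSet_strict_mono hlt) (Set.toFinite _)
    omega

end IsTriangulated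

/-! ### Gluing disks into the faces of a host -/

/-- A graph drawn in a triangle with corners `Sum.inl i`, with a rotation `nxt`. -/
structure Disk (W : Type) where
  graph : SimpleGraph (Fin 3 ⊕ W)
  nxt : Fin 3 ⊕ W → Fin 3 ⊕ W → Fin 3 ⊕ W

theorem fin_three_add_one_add_one (i : Fin 3) : i + 1 + 1 = i + 2 := by revert i; decide

theorem fin_three_add_two_add_one (i : Fin 3) : i + 2 + 1 = i := by revert i; decide

theorem fin_three_add_two_add_two (i : Fin 3) : i + 2 + 2 = i + 1 := by revert i; decide

namespace Disk

variable {N S : Type} {W : S → Type}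

/-- The vertices of the host among those of the glued graph. -/
def incl {N : Type} (P : Type) : Fin 3 ⊕ N → Fin 3 ⊕ (N ⊕ P) := Sum.map id Sum.inl

theorem incl_injective (P : Type) : Function.Injective (incl (N := N) P) :=
  Sum.map_injective.mpr ⟨Function.injective_id, Sum.inl_injective⟩

@[simp] theorem incl_inj {P : Type} {x y : Fin 3 ⊕ N} : incl P x = incl P y ↔ x = y :=
  (incl_injective P).eq_iff

/-- The vertices of the `s`-th inserted disk among those of the glued graph. -/
def emb (f : S → Fin 3 ↪ Fin 3 ⊕ N) (s : S) : Fin 3 ⊕ W s → Fin 3 ⊕ (N ⊕ Σ s, W s) :=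
  Sum.elim (fun i => incl _ (f s i)) (fun w => Sum.inr (Sum.inr ⟨s, w⟩))

section

variable (f : S → Fin 3 ↪ Fin 3 ⊕ N)

@[simp] theorem emb_inl (s : S) (i : Fin 3) :
    emb (W := W) f s (Sum.inl i) = incl _ (f s i) := rfl

@[simp] theorem emb_inr (s : S) (w : W s) :
    emb f s (Sum.inr w) = Sum.inr (Sum.inr ⟨s, w⟩) := rfl

theorem incl_ne (x : Fin 3 ⊕ N) (p : Σ s, W s) : incl _ x ≠ Sum.inr (Sum.inr p) := by
  rcases x with x | x <;> simp [incl]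

theorem emb_injective (s : S) : Function.Injective (emb (W := W) f s) := by
  rintro (i | w) (j | w') h
  · simpa using h
  · exact absurd h (incl_ne _ _)
  · exact absurd h.symm (incl_ne _ _)
  · simpa using h

theorem emb_eq_incl {s : S} {x : Fin 3 ⊕ W s} {y : Fin 3 ⊕ N} (h : emb f s x = incl _ y) :
    ∃ i, x = Sum.inl i ∧ f s i = y := by
  rcases x with i | w
  · exact ⟨i, rfl, by simpa using h⟩
  · exact absurd h.symm (incl_ne _ _)

theorem emb_eq_inr {s s' : S} {x : Fin 3 ⊕ W s} {w : W s'}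
    (h : emb f s x = Sum.inr (Sum.inr ⟨s', w⟩)) : ∃ e : s = s', x = Sum.inr (e ▸ w) := by
  rcases x with i | w'
  · exact absurd h (incl_ne _ _)
  · simp only [emb_inr, Sum.inr.injEq, Sigma.mk.injEq] at h
    obtain ⟨rfl, h⟩ := h
    exact ⟨rfl, by rw [eq_of_heq h]⟩

theorem vertex_cases (v : Fin 3 ⊕ (N ⊕ Σ s, W s)) :
    (∃ x, v = incl _ x) ∨ ∃ s w, v = emb f s (Sum.inr w) := by
  rcases v with i | n | ⟨s, w⟩
  · exact Or.inl ⟨Sum.inl i, rfl⟩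
  · exact Or.inl ⟨Sum.inr n, rfl⟩
  · exact Or.inr ⟨s, w, rfl⟩

end

/-- Adjacency in the graph obtained by drawing disks in triangles of a host. -/
inductive GlueAdj (M : Disk N) (f : S → Fin 3 ↪ Fin 3 ⊕ N) (D : ∀ s, Disk (W s)) :
    Fin 3 ⊕ (N ⊕ Σ s, W s) → Fin 3 ⊕ (N ⊕ Σ s, W s) → Prop
  | base {x y} : M.graph.Adj x y → GlueAdj M f D (incl _ x) (incl _ y)
  | disk {s x y} : (D s).graph.Adj x y → GlueAdj M f D (emb f s x) (emb f s y)

/-- The rotation of the graph obtained by drawing disks in triangles of a host. -/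
inductive GlueNext (M : Disk N) (f : S → Fin 3 ↪ Fin 3 ⊕ N) (D : ∀ s, Disk (W s)) :
    Fin 3 ⊕ (N ⊕ Σ s, W s) → Fin 3 ⊕ (N ⊕ Σ s, W s) → Fin 3 ⊕ (N ⊕ Σ s, W s) → Prop
  | base {x y} : M.graph.Adj x y → (∀ s i, ¬ (f s i = x ∧ f s (i + 1) = y)) →
      GlueNext M f D (incl _ x) (incl _ y) (incl _ (M.nxt x y))
  | disk {s x y} : (D s).graph.Adj x y → (∀ i, ¬ (x = Sum.inl (i + 1) ∧ y = Sum.inl i)) →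
      GlueNext M f D (emb f s x) (emb f s y) (emb f s ((D s).nxt x y))

open Classical in
/-- Draw the disk `D s` in the triangle `f s` of the host `M`, for every `s`. -/
noncomputable def glue (M : Disk N) (f : S → Fin 3 ↪ Fin 3 ⊕ N) (D : ∀ s, Disk (W s)) :
    Disk (N ⊕ Σ s, W s) where
  graph :=
    { Adj := GlueAdj M f D
      symm := ⟨fun _ _ h => by
        cases h with
        | base h => exact .base h.symm
        | disk h => exact .disk h.symm⟩
      loopless := ⟨fun v h => by
        have key : ∀ u, GlueAdj M f D v u → v ≠ u := fun u h hu => by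
          cases h with
          | base h' => exact SimpleGraph.Adj.ne h' (incl_injective _ hu)
          | disk h' => exact SimpleGraph.Adj.ne h' (emb_injective f _ hu)
        exact key v h rfl⟩ }
  nxt v u := if h : ∃ w, GlueNext M f D v u w then h.choose else u

/-- The disk is a triangulation of a triangle. -/
structure IsPlane (D : Disk N) : Prop extends D.graph.IsTriangulated D.nxt where
  adj_corner : ∀ i : Fin 3, D.graph.Adj (Sum.inl i) (Sum.inl (i + 1))
  nxt_corner : ∀ i : Fin 3, D.nxt (Sum.inl (i + 1)) (Sum.inl i) = Sum.inl (i + 2)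
  card_dart : Nat.card D.graph.Dart = 6 + 6 * Nat.card N

/-- The `f s` are different faces of the disk, other than the outer one. -/
structure IsFaces (M : Disk N) (f : S → Fin 3 ↪ Fin 3 ⊕ N) : Prop where
  adj : ∀ s i, M.graph.Adj (f s i) (f s (i + 1))
  nxt : ∀ s i, M.nxt (f s i) (f s (i + 1)) = f s (i + 2)
  eq_of_eq : ∀ s s' i i', f s i = f s' i' → f s (i + 1) = f s' (i' + 1) → s = s' ∧ i = i'
  ne_outer : ∀ s i j, f s i = Sum.inl (j + 1) → f s (i + 1) ≠ Sum.inl j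

variable {M : Disk N} {f : S → Fin 3 ↪ Fin 3 ⊕ N} {D : ∀ s, Disk (W s)}

theorem glue_adj_base {x y} (h : M.graph.Adj x y) :
    (glue M f D).graph.Adj (incl _ x) (incl _ y) := GlueAdj.base h

theorem glue_adj_disk {s x y} (h : (D s).graph.Adj x y) :
    (glue M f D).graph.Adj (emb f s x) (emb f s y) := GlueAdj.disk h

section Plane

variable (hM : M.IsPlane) (hf : IsFaces M f) (hD : ∀ s, (D s).IsPlane)

include hf in
-- The two rules could only compete on the sides of an inserted face. There the angle of the host
-- that is filled by the disk is taken from the disk, and the outer angle of the disk is dropped in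
-- favour of the host, so each dart obeys one rule.
theorem GlueNext.unique {v u w w'} (h : GlueNext M f D v u w) (h' : GlueNext M f D v u w') :
    w = w' := by
  have aux : ∀ {i j : Fin 3}, i ≠ j → i = j + 1 ∨ j = i + 1 := by decide
  have key : ∀ {s : S} {x y : Fin 3 ⊕ W s} {x' y' : Fin 3 ⊕ N}, (D s).graph.Adj x y →
      (∀ i, ¬ (x = Sum.inl (i + 1) ∧ y = Sum.inl i)) → emb f s x = incl _ x' →
      emb f s y = incl _ y' → ∃ i, x = Sum.inl i ∧ y = Sum.inl (i + 1) ∧ f s i = x' ∧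
        f s (i + 1) = y' := by
    intro s x y x' y' ha hn hx hy
    obtain ⟨i, rfl, rfl⟩ := emb_eq_incl f hx
    obtain ⟨j, rfl, rfl⟩ := emb_eq_incl f hy
    rcases aux (i := i) (j := j) (fun e => ha.ne (by rw [e])) with rfl | rfl
    · exact absurd ⟨rfl, rfl⟩ (hn j)
    · exact ⟨i, rfl, rfl, rfl, rfl⟩
  cases h with
  | @base x y ha hn =>
    generalize hv : incl (Σ s, W s) x = v at h'
    generalize hu : incl (Σ s, W s) y = u at h'
    cases h' with
    | @base x' y' ha' hn' =>
      obtain rfl := incl_injective _ hv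
      obtain rfl := incl_injective _ hu
      rfl
    | @disk s x' y' ha' hn' =>
      obtain ⟨i, -, -, h1, h2⟩ := key ha' hn' hv.symm hu.symm
      exact absurd ⟨h1, h2⟩ (hn s i)
  | @disk s x y ha hn =>
    generalize hv : emb f s x = v at h'
    generalize hu : emb f s y = u at h'
    cases h' with
    | @base x' y' ha' hn' =>
      obtain ⟨i, -, -, h1, h2⟩ := key ha hn hv hu
      exact absurd ⟨h1, h2⟩ (hn' s i)
    | @disk s' x' y' ha' hn' =>
      by_cases hs : s = s'
      · subst hs
        obtain rfl := emb_injective f _ hv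
        obtain rfl := emb_injective f _ hu
        rfl
      · rcases x' with i' | w'
        · rcases y' with j' | z'
          · obtain ⟨i, -, -, h1, h2⟩ := key ha hn hv hu
            obtain ⟨k, h3, h4, -, -⟩ := key ha' hn' rfl rfl
            simp only [Sum.inl.injEq] at h3 h4
            subst h3 h4
            exact absurd (hf.eq_of_eq _ _ _ _ h1 h2).1 hs
          · exact absurd (emb_eq_inr f hu).1 hs
        · exact absurd (emb_eq_inr f hv).1 hs

include hf in
theorem GlueNext.nxt_eq {v u w} (h : GlueNext M f D v u w) : (glue M f D).nxt v u = w := by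
  have hex : ∃ w, GlueNext M f D v u w := ⟨w, h⟩
  refine (dif_pos hex).trans ?_
  exact GlueNext.unique hf hex.choose_spec h

include hM hf hD

omit hM in
theorem exists_glueNext {v u} (h : (glue M f D).graph.Adj v u) : ∃ w, GlueNext M f D v u w := by
  have base : ∀ {x y}, M.graph.Adj x y → ∃ w, GlueNext M f D (incl _ x) (incl _ y) w := by
    intro x y h
    by_cases hx : ∃ s i, f s i = x ∧ f s (i + 1) = y
    · obtain ⟨s, i, rfl, rfl⟩ := hx
      refine ⟨_, GlueNext.disk (s := s) ((hD s).adj_corner i) fun j hj => ?_⟩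
      simp only [Sum.inl.injEq] at hj
      have : ∀ i j : Fin 3, ¬ (i = j + 1 ∧ i + 1 = j) := by decide
      exact this i j hj
    · push Not at hx
      exact ⟨_, GlueNext.base h fun s i hi => hx s i hi.1 hi.2⟩
  cases h with
  | base h => exact base h
  | @disk s x y h =>
    by_cases hx : ∃ i, x = Sum.inl (i + 1) ∧ y = Sum.inl i
    · obtain ⟨i, rfl, rfl⟩ := hx
      exact base (hf.adj s i).symm
    · push Not at hx
      exact ⟨_, GlueNext.disk h fun i hi => hx i hi.1 hi.2⟩

omit hf in
theorem GlueNext.adj {v u w} (h : GlueNext M f D v u w) : (glue M f D).graph.Adj v w := by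
  cases h with
  | base h _ => exact .base (hM.adj_nxt h)
  | disk h _ => exact .disk ((hD _).adj_nxt h)

omit hD in
-- Faces of the glued graph are triangles: turning a triangle of the host or of a disk stays under
-- the same rule. Otherwise one of its angles would be the dropped one, and then so would the angle
-- one started with.
theorem GlueNext.rotate (hD : ∀ s, (D s).IsPlane) {v u w} (h : GlueNext M f D v u w) :
    GlueNext M f D w v u := by
  cases h with
  | @base x y h hn =>
    have := GlueNext.base (D := D) (f := f) (hM.adj_nxt h).symm (fun s i hi => by
      obtain ⟨h1, h2⟩ := hi
      have h3 := hf.nxt s i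
      rw [h1, h2, hM.nxt_nxt h.symm] at h3
      have := fin_three_add_one_add_one i
      exact hn s (i + 1) ⟨h2, by rw [h3, this]⟩)
    rwa [hM.nxt_nxt h.symm] at this
  | @disk s x y h hn =>
    have := GlueNext.disk (M := M) (f := f) ((hD s).adj_nxt h).symm (fun i hi => by
      obtain ⟨h1, h2⟩ := hi
      have h3 := (hD s).nxt_corner i
      rw [← h1, ← h2, (hD s).nxt_nxt h.symm] at h3
      have := fin_three_add_two_add_one i
      exact hn (i + 2) ⟨by rw [h2, this], h3⟩)
    rwa [(hD s).nxt_nxt h.symm] at this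

omit hM in
/-- Going around a corner of an inserted disk. -/
theorem exists_iterate_corner (s : S) (i : Fin 3) {y z} (hy : (D s).graph.Adj (Sum.inl i) y)
    (hz : (D s).graph.Adj (Sum.inl i) z)
    (h : y = Sum.inl (i + 1) ∨ z = Sum.inl (i + 2)) :
    ∃ k : ℕ, ((glue M f D).nxt (emb f s (Sum.inl i)))^[k] (emb f s y) = emb f s z := by
  classical
  have hex := (hD s).exists_iterate hy hz
  -- The least number of steps is taken, so that the walk around the corner does not run through the
  -- outer angle of the disk, which the glued rotation does not have.
  set g := (D s).nxt (Sum.inl i) with hg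
  set k := Nat.find hex with hk
  have hkz : g^[k] y = z := Nat.find_spec hex
  have hmin : ∀ j < k, g^[j] y ≠ z := fun j hj => Nat.find_min hex hj
  have hadj : ∀ j, (D s).graph.Adj (Sum.inl i) (g^[j] y) := by
    intro j
    induction j with
    | zero => exact hy
    | succ j ih => rw [Function.iterate_succ_apply']; exact (hD s).adj_nxt ih
  -- The outer angle starts at corner i + 2 and ends at i + 1. Meeting i + 2 too early either closes
  -- the turn at y, against minimality of k, or has already reached z.
  have hne : ∀ j < k, g^[j] y ≠ Sum.inl (i + 2) := by
    intro j hj hji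
    rcases h with rfl | rfl
    · have h3 := (hD s).nxt_corner (i + 2)
      have e1 := fin_three_add_two_add_one i
      have e2 := fin_three_add_two_add_two i
      rw [e1, e2, ← hji] at h3
      have h4 : g^[j + 1] (Sum.inl (i + 1)) = Sum.inl (i + 1) := by
        rw [Function.iterate_succ_apply']; exact h3
      refine hmin (k - (j + 1)) (by omega) ?_
      rw [← hkz]
      conv_rhs => rw [show k = (k - (j + 1)) + (j + 1) by omega, Function.iterate_add_apply, h4]
    · exact hmin j hj hji
  refine ⟨k, ?_⟩
  rw [← hkz]
  have : ∀ j ≤ k, ((glue M f D).nxt (emb f s (Sum.inl i)))^[j] (emb f s y) =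
      emb f s (g^[j] y) := by
    intro j
    induction j with
    | zero => intro _; rfl
    | succ j ih =>
      intro hj
      rw [Function.iterate_succ_apply', Function.iterate_succ_apply', ih (by omega)]
      refine GlueNext.nxt_eq hf (.disk (hadj j) fun l hl => hne j hj ?_)
      rw [hl.2]
      have := hl.1
      simp only [Sum.inl.injEq] at this ⊢
      have h3 : ∀ i l : Fin 3, i = l + 1 → l = i + 2 := by decide
      exact h3 i l this
  exact this k le_rfl

/-- One step of the host rotation becomes one step of the glued rotation, or a run through the disk
that fills the angle. -/
theorem exists_iterate_incl {x y z} (hy : M.graph.Adj x y) (hz : M.graph.Adj x z) :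
    ∃ k : ℕ, ((glue M f D).nxt (incl _ x))^[k] (incl _ y) = incl _ z := by
  have one : ∀ {y}, M.graph.Adj x y →
      ∃ k : ℕ, ((glue M f D).nxt (incl _ x))^[k] (incl _ y) = incl _ (M.nxt x y) := by
    intro y hy
    by_cases hx : ∃ s i, f s i = x ∧ f s (i + 1) = y
    · obtain ⟨s, i, rfl, rfl⟩ := hx
      rw [hf.nxt s i]
      refine exists_iterate_corner hf hD s i (y := Sum.inl (i + 1)) (z := Sum.inl (i + 2))
        ((hD s).adj_corner i) ?_ (Or.inl rfl)
      have := ((hD s).adj_corner (i + 2)).symm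
      have e1 := fin_three_add_two_add_one i
      rwa [e1] at this
    · push Not at hx
      exact ⟨1, GlueNext.nxt_eq hf (.base hy fun s i hi => hx s i hi.1 hi.2)⟩
  obtain ⟨k, rfl⟩ := hM.exists_iterate hy hz
  clear hz
  induction k with
  | zero => exact ⟨0, rfl⟩
  | succ k ih =>
    obtain ⟨l, hl⟩ := ih
    have hadj : ∀ j, M.graph.Adj x ((M.nxt x)^[j] y) := by
      intro j
      induction j with
      | zero => exact hy
      | succ j ih => rw [Function.iterate_succ_apply']; exact hM.adj_nxt ih
    obtain ⟨m, hm⟩ := one (hadj k)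
    refine ⟨m + l, ?_⟩
    rw [Function.iterate_add_apply, hl, hm, Function.iterate_succ_apply']

theorem exists_iterate_glue {u v w} (hv : (glue M f D).graph.Adj u v)
    (hw : (glue M f D).graph.Adj u w) : ∃ k : ℕ, ((glue M f D).nxt u)^[k] v = w := by
  rcases vertex_cases f u with ⟨x, rfl⟩ | ⟨s, p, rfl⟩
  · have trans : ∀ {a b c}, (∃ k : ℕ, ((glue M f D).nxt (incl _ x))^[k] a = b) →
        (∃ k : ℕ, ((glue M f D).nxt (incl _ x))^[k] b = c) →
        ∃ k : ℕ, ((glue M f D).nxt (incl _ x))^[k] a = c := by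
      rintro a b c ⟨k, rfl⟩ ⟨l, rfl⟩
      exact ⟨l + k, Function.iterate_add_apply _ _ _ _⟩
    have corner : ∀ s i, (D s).graph.Adj (Sum.inl i) (Sum.inl (i + 2)) := by
      intro s i
      have := ((hD s).adj_corner (i + 2)).symm
      have e1 := fin_three_add_two_add_one i
      rwa [e1] at this
    have hcM : ∀ s i, M.graph.Adj (f s i) (f s (i + 2)) := by
      intro s i
      have := (hf.adj s (i + 2)).symm
      have e1 := fin_three_add_two_add_one i
      rwa [e1] at this
    -- A neighbour inside an inserted disk lies between two neighbours in the host. From it the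
    -- rotation runs on to the later one, and it is reached from the earlier one.
    have hto : ∀ {v}, (glue M f D).graph.Adj (incl _ x) v → ∃ y, M.graph.Adj x y ∧
        ∃ k : ℕ, ((glue M f D).nxt (incl _ x))^[k] v = incl _ y := by
      intro v hv
      generalize hu : incl (Σ s, W s) x = u at hv
      cases hv with
      | @base x' y h =>
        obtain rfl := incl_injective _ hu
        exact ⟨y, h, 0, rfl⟩
      | @disk s x' y h =>
        obtain ⟨i, rfl, rfl⟩ := emb_eq_incl f hu.symm
        exact ⟨_, hcM s i, exists_iterate_corner hf hD s i h (corner s i) (Or.inr rfl)⟩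
    have hfro : ∀ {v}, (glue M f D).graph.Adj (incl _ x) v → ∃ y, M.graph.Adj x y ∧
        ∃ k : ℕ, ((glue M f D).nxt (incl _ x))^[k] (incl _ y) = v := by
      intro v hv
      generalize hu : incl (Σ s, W s) x = u at hv
      cases hv with
      | @base x' y h =>
        obtain rfl := incl_injective _ hu
        exact ⟨y, h, 0, rfl⟩
      | @disk s x' y h =>
        obtain ⟨i, rfl, rfl⟩ := emb_eq_incl f hu.symm
        exact ⟨_, hf.adj s i,
          exists_iterate_corner hf hD s i ((hD s).adj_corner i) h (Or.inl rfl)⟩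
    obtain ⟨y, hy, hvy⟩ := hto hv
    obtain ⟨z, hz, hzw⟩ := hfro hw
    exact trans hvy (trans (exists_iterate_incl hM hf hD hy hz) hzw)
  · have from_disk : ∀ {v}, (glue M f D).graph.Adj (emb f s (Sum.inr p)) v →
        ∃ y, (D s).graph.Adj (Sum.inr p) y ∧ v = emb f s y := by
      intro v hv
      generalize hu : emb f s (Sum.inr p) = u at hv
      cases hv with
      | @base x' y h => exact absurd hu.symm (incl_ne _ _)
      | @disk s' x' y h =>
        obtain ⟨rfl, rfl⟩ := emb_eq_inr f hu.symm
        exact ⟨y, h, rfl⟩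
    obtain ⟨y, hy, rfl⟩ := from_disk hv
    obtain ⟨z, hz, rfl⟩ := from_disk hw
    obtain ⟨k, rfl⟩ := (hD s).exists_iterate hy hz
    refine ⟨k, ?_⟩
    clear hz hw hv
    induction k generalizing y with
    | zero => rfl
    | succ k ih =>
      rw [Function.iterate_succ_apply, Function.iterate_succ_apply,
        GlueNext.nxt_eq hf (.disk hy fun i hi => by simp at hi)]
      exact ih _ ((hD s).adj_nxt hy)

omit hf in
theorem glue_connected : (glue M f D).graph.Connected := by
  have hb : ∀ x y, (glue M f D).graph.Reachable (incl _ x) (incl _ y) := fun x y =>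
    (hM.connected.preconnected x y).map (⟨incl _, fun h => .base h⟩ : M.graph →g (glue M f D).graph)
  have hd : ∀ s x y, (glue M f D).graph.Reachable (emb f s x) (emb f s y) := fun s x y =>
    ((hD s).connected.preconnected x y).map
      (⟨emb f s, fun h => .disk h⟩ : (D s).graph →g (glue M f D).graph)
  have h0 : ∀ v, (glue M f D).graph.Reachable v (incl _ (Sum.inl 0)) := by
    intro v
    rcases vertex_cases f v with ⟨x, rfl⟩ | ⟨s, p, rfl⟩
    · exact hb _ _
    · exact (hd s _ (Sum.inl 0)).trans (hb _ _)
  exact { preconnected := fun u v => (h0 u).trans (h0 v).symm, nonempty := ⟨Sum.inl 0⟩ }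

omit hM hf in
-- The three corners span six darts, which the host already contains; the other darts are the
-- contribution of the disk.
theorem card_inner_dart (s : S) [Finite (W s)] :
    Nat.card {d : (D s).graph.Dart // ¬ (d.fst.isLeft ∧ d.snd.isLeft)} = 6 * Nat.card (W s) := by
  classical
  have h1 : Nat.card (D s).graph.Dart = Nat.card {d : (D s).graph.Dart // d.fst.isLeft ∧ d.snd.isLeft}
      + Nat.card {d : (D s).graph.Dart // ¬ (d.fst.isLeft ∧ d.snd.isLeft)} := by
    rw [← Nat.card_sum]
    exact Nat.card_congr (Equiv.sumCompl _).symm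
  have h2 : Nat.card {d : (D s).graph.Dart // d.fst.isLeft ∧ d.snd.isLeft} =
      Nat.card {p : Fin 3 × Fin 3 // p.1 ≠ p.2} := by
    refine (Nat.card_congr (Equiv.ofBijective
      (fun p : {p : Fin 3 × Fin 3 // p.1 ≠ p.2} =>
        (⟨⟨(Sum.inl p.1.1, Sum.inl p.1.2), ?_⟩, rfl, rfl⟩ :
          {d : (D s).graph.Dart // d.fst.isLeft ∧ d.snd.isLeft})) ⟨?_, ?_⟩)).symm
    · have h3 : ∀ i j : Fin 3, i ≠ j → j = i + 1 ∨ i = j + 1 := by decide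
      rcases h3 _ _ p.2 with h | h
      · rw [h]; exact (hD s).adj_corner _
      · rw [h]; exact ((hD s).adj_corner _).symm
    · rintro ⟨⟨i, j⟩, h⟩ ⟨⟨i', j'⟩, h'⟩ he
      simpa using he
    · rintro ⟨⟨⟨x, y⟩, ha⟩, hx, hy⟩
      obtain ⟨i, rfl⟩ := Sum.isLeft_iff.mp hx
      obtain ⟨j, rfl⟩ := Sum.isLeft_iff.mp hy
      exact ⟨⟨(i, j), fun h => ha.ne (by rw [show i = j from h])⟩, rfl⟩
  have h3 : Nat.card {p : Fin 3 × Fin 3 // p.1 ≠ p.2} = 6 := by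
    rw [Nat.card_eq_fintype_card]; decide
  have := (hD s).card_dart
  omega

omit hM in
theorem card_glue_dart [Finite N] [Finite S] [∀ s, Finite (W s)] :
    Nat.card (glue M f D).graph.Dart = Nat.card M.graph.Dart + 6 * Nat.card (Σ s, W s) := by
  classical
  have := Fintype.ofFinite S
  have e : Nat.card (glue M f D).graph.Dart = Nat.card (M.graph.Dart ⊕
      Σ s, {d : (D s).graph.Dart // ¬ (d.fst.isLeft ∧ d.snd.isLeft)}) := by
    refine (Nat.card_congr (Equiv.ofBijective (Sum.elim
      (fun d => ⟨(incl _ d.fst, incl _ d.snd), .base d.adj⟩)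
      (fun p => ⟨(emb f p.1 p.2.1.fst, emb f p.1 p.2.1.snd), .disk p.2.1.adj⟩)) ⟨?_, ?_⟩)).symm
    · have mixed : ∀ (d : M.graph.Dart) (s : S)
          (d' : {d : (D s).graph.Dart // ¬ (d.fst.isLeft ∧ d.snd.isLeft)}),
          (incl _ d.fst, incl _ d.snd) ≠ (emb f s d'.1.fst, emb f s d'.1.snd) := by
        intro d s d' h
        simp only [Prod.mk.injEq] at h
        obtain ⟨i, hi, -⟩ := emb_eq_incl f h.1.symm
        obtain ⟨j, hj, -⟩ := emb_eq_incl f h.2.symm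
        exact d'.2 ⟨by rw [hi]; rfl, by rw [hj]; rfl⟩
      rintro (d | ⟨s, d⟩) (d' | ⟨s', d'⟩) h
      · have h := congrArg Dart.toProd h
        simp only [Sum.elim_inl, Prod.mk.injEq, incl_inj] at h
        rw [Dart.ext d d' (Prod.ext h.1 h.2)]
      · exact absurd (congrArg Dart.toProd h) (mixed d s' d')
      · exact absurd (congrArg Dart.toProd h).symm (mixed d' s d)
      · have h := congrArg Dart.toProd h
        simp only [Sum.elim_inr, Prod.mk.injEq] at h
        have hs : s = s' := by
          rcases hx : d'.1.fst with i | p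
          · rcases hy : d'.1.snd with j | p
            · exact absurd ⟨by rw [hx]; rfl, by rw [hy]; rfl⟩ d'.2
            · rw [hy] at h
              exact (emb_eq_inr f h.2).1
          · rw [hx] at h
            exact (emb_eq_inr f h.1).1
        subst hs
        have : d = d' := Subtype.ext (Dart.ext _ _
          (Prod.ext (emb_injective f s h.1) (emb_injective f s h.2)))
        rw [this]
    · rintro ⟨⟨u, v⟩, h⟩
      have h' : GlueAdj M f D u v := h
      cases h' with
      | @base x y ha => exact ⟨Sum.inl ⟨(x, y), ha⟩, rfl⟩
      | @disk s x y ha =>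
        by_cases hxy : x.isLeft ∧ y.isLeft
        · obtain ⟨i, rfl⟩ := Sum.isLeft_iff.mp hxy.1
          obtain ⟨j, rfl⟩ := Sum.isLeft_iff.mp hxy.2
          have h3 : ∀ i j : Fin 3, i ≠ j → j = i + 1 ∨ i = j + 1 := by decide
          refine ⟨Sum.inl ⟨(f s i, f s j), ?_⟩, rfl⟩
          rcases h3 i j (fun e => ha.ne (by rw [e])) with rfl | rfl
          · exact hf.adj s i
          · exact (hf.adj s j).symm
        · exact ⟨Sum.inr ⟨s, ⟨⟨(x, y), ha⟩, hxy⟩⟩, rfl⟩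
  rw [e, Nat.card_sum, Nat.card_sigma, Nat.card_sigma, Finset.mul_sum]
  congr 1
  exact Finset.sum_congr rfl fun s _ => card_inner_dart hD s

theorem IsPlane.glue [Finite N] [Finite S] [∀ s, Finite (W s)] : (glue M f D).IsPlane where
  adj_nxt h := by
    obtain ⟨w, hw⟩ := exists_glueNext hf hD h
    rw [hw.nxt_eq hf]
    exact hw.adj hM hD
  nxt_nxt h := by
    obtain ⟨w, hw⟩ := exists_glueNext hf hD h.symm
    rw [hw.nxt_eq hf]
    exact (hw.rotate hM hf hD).nxt_eq hf
  exists_iterate := exists_iterate_glue hM hf hD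
  connected := glue_connected hM hD
  adj_corner i := .base (hM.adj_corner i)
  nxt_corner i := by
    have := GlueNext.nxt_eq hf (D := D) (.base (hM.adj_corner i).symm fun s j hj =>
      hf.ne_outer s j i hj.1 hj.2)
    rw [hM.nxt_corner] at this
    exact this
  card_dart := by
    rw [card_glue_dart hf hD, hM.card_dart, Nat.card_sum]
    ring

omit hf hD in
theorem IsPlane.isMaximalPlanar [Finite N] : M.graph.IsMaximalPlanar := by
  have : Nat.card (Fin 3 ⊕ N) = 3 + Nat.card N := by rw [Nat.card_sum]; simp
  refine hM.toIsTriangulated.isMaximalPlanar (by omega) ?_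
  rw [hM.card_dart, this]
  ring

end Plane

end Disk

/-! ### Counting components: toughness of glued disks -/

variable {V V' : Type*}

/-- There is a walk from `u` to `v` that avoids `X`. -/
def ReachAvoiding (G : SimpleGraph V) (X : Finset V) : V → V → Prop :=
  Relation.ReflTransGen fun a b => G.Adj a b ∧ a ∉ X ∧ b ∉ X

namespace ReachAvoiding

variable {G : SimpleGraph V} {X : Finset V} {u v w : V}

theorem refl (u : V) : G.ReachAvoiding X u u := Relation.ReflTransGen.refl

theorem symm (h : G.ReachAvoiding X u v) : G.ReachAvoiding X v u := by
  induction h with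
  | refl => exact refl _
  | tail _ h ih => exact Relation.ReflTransGen.head ⟨h.1.symm, h.2.2, h.2.1⟩ ih

theorem trans (h : G.ReachAvoiding X u v) (h' : G.ReachAvoiding X v w) :
    G.ReachAvoiding X u w := Relation.ReflTransGen.trans h h'

theorem of_adj (h : G.Adj u v) (hu : u ∉ X) (hv : v ∉ X) : G.ReachAvoiding X u v :=
  Relation.ReflTransGen.single ⟨h, hu, hv⟩

theorem notMem (h : G.ReachAvoiding X u v) (hu : u ∉ X) : v ∉ X := by
  induction h with
  | refl => exact hu
  | tail _ h _ => exact h.2.2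

theorem map {G' : SimpleGraph V'} {X' : Finset V'} (φ : V → V')
    (hφ : ∀ a b, G.Adj a b → G'.Adj (φ a) (φ b)) (hX : ∀ a, φ a ∈ X' → a ∈ X)
    (h : G.ReachAvoiding X u v) : G'.ReachAvoiding X' (φ u) (φ v) :=
  Relation.ReflTransGen.lift φ
    (fun a b h => ⟨hφ a b h.1, fun h' => h.2.1 (hX a h'), fun h' => h.2.2 (hX b h')⟩) _ _ h

theorem reachable (h : G.ReachAvoiding X u v) (hu : u ∉ X) (hv : v ∉ X) :
    (G.deleteVerts X).Reachable ⟨u, hu⟩ ⟨v, hv⟩ := by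
  induction h with
  | refl => exact Reachable.rfl
  | tail _ h ih => exact (ih h.2.1).trans (Adj.reachable (by simpa using h.1))

end ReachAvoiding

/-- Components are replaced by representatives, which can be moved between a glued graph and its
pieces without handling quotients. -/
theorem exists_separated [Finite V] (G : SimpleGraph V) (X : Finset V) :
    ∃ I : Finset V, I.card = Nat.card (G.deleteVerts X).ConnectedComponent ∧
      (∀ u ∈ I, u ∉ X) ∧ ∀ u ∈ I, ∀ v ∈ I, G.ReachAvoiding X u v → u = v := by
  classical
  have := Fintype.ofFinite (G.deleteVerts X).ConnectedComponent
  have hrep : ∀ c : (G.deleteVerts X).ConnectedComponent,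
      ∃ v, (G.deleteVerts X).connectedComponentMk v = c := fun c => c.exists_rep
  choose r hr using hrep
  refine ⟨Finset.univ.image fun c => (r c).1, ?_, ?_, ?_⟩
  · rw [Finset.card_image_of_injective, Finset.card_univ, Nat.card_eq_fintype_card]
    intro c d h
    rw [← hr c, ← hr d, Subtype.ext h]
  · intro u hu
    obtain ⟨c, -, rfl⟩ := Finset.mem_image.mp hu
    exact (r c).2
  · intro u hu v hv h
    obtain ⟨c, -, rfl⟩ := Finset.mem_image.mp hu
    obtain ⟨d, -, rfl⟩ := Finset.mem_image.mp hv
    have h1 : (G.deleteVerts X).connectedComponentMk (r c) =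
      (G.deleteVerts X).connectedComponentMk (r d) :=
        ConnectedComponent.sound (h.reachable (r c).2 (r d).2)
    rw [hr, hr] at h1
    rw [h1]

theorem IsSeparatingSet.two_le_natCard [Finite V] {G : SimpleGraph V} {X : Finset V}
    (h : G.IsSeparatingSet X) : 2 ≤ Nat.card (G.deleteVerts X).ConnectedComponent := by
  by_contra hlt
  have : Finite (G.deleteVerts X).ConnectedComponent := inferInstance
  have hs : Subsingleton (G.deleteVerts X).ConnectedComponent :=
    Finite.card_le_one_iff_subsingleton.mp (by omega)
  exact h fun u v => ConnectedComponent.exact (Subsingleton.elim _ _)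

theorem le_toughness [Finite V] {G : SimpleGraph V} {p q : ℕ} (hq : 0 < q)
    (h : ∀ X, G.IsSeparatingSet X →
      p * Nat.card (G.deleteVerts X).ConnectedComponent ≤ q * X.card) :
    (p : ℝ≥0∞) / q ≤ G.toughness := by
  refine le_iInf₂ fun X hX => ?_
  have h2 := hX.two_le_natCard
  rw [ENNReal.div_le_iff (by exact_mod_cast hq.ne') (by simp), mul_comm, ← mul_div_assoc,
    ENNReal.le_div_iff_mul_le (Or.inl (by norm_cast; omega)) (Or.inl (by simp))]
  exact_mod_cast h X hX

namespace Disk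

variable {N S : Type} {W : S → Type}

open Classical in
/-- The number of corners among `X`. -/
noncomputable def corners {W : Type} (X : Finset (Fin 3 ⊕ W)) : ℕ :=
  (Finset.univ.filter fun i : Fin 3 => Sum.inl i ∈ X).card

/-- The vertices of `I` lie in different components of `D - X`, which contain no corner. -/
structure IsClosedOff {W : Type} (D : Disk W) (X I : Finset (Fin 3 ⊕ W)) : Prop where
  notMem : ∀ u ∈ I, u ∉ X
  eq_of_reach : ∀ u ∈ I, ∀ v ∈ I, D.graph.ReachAvoiding X u v → u = v
  not_reach : ∀ u ∈ I, ∀ i, Sum.inl i ∉ X → ¬ D.graph.ReachAvoiding X u (Sum.inl i)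

/-- A bound for the number of components without corners of `D - X`. -/
structure IsTough {W : Type} (D : Disk W) (α β ω₃ ω₂ γ : ℕ) : Prop where
  three : ∀ X I, D.IsClosedOff X I → corners X = 3 → β * I.card + 3 * α ≤ α * X.card + ω₃
  two : ∀ X I, D.IsClosedOff X I → corners X = 2 → β * I.card + 2 * α ≤ α * X.card + ω₂
  one : ∀ X I, D.IsClosedOff X I → corners X ≤ 1 → I.Nonempty → β * I.card + γ ≤ α * X.card

open Classical in
/-- The number of corners of the face `s` among `X`. -/
noncomputable def faceCorners (f : S → Fin 3 ↪ Fin 3 ⊕ N) (X : Finset (Fin 3 ⊕ N)) (s : S) : ℕ :=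
  (Finset.univ.filter fun i : Fin 3 => f s i ∈ X).card

/-- The excess that a disk contributes if `k` of its corners are deleted. -/
def excess (ω₃ ω₂ k : ℕ) : ℕ := if k = 3 then ω₃ else if k = 2 then ω₂ else 0

open Classical in
/-- The condition on a host for the glued disk to be tough. -/
structure IsToughHost [Fintype S] (M : Disk N) (f : S → Fin 3 ↪ Fin 3 ⊕ N) (α β : ℕ)
    (ω₃ ω₂ : S → ℕ) (Ω₃ Ω₂ γ : ℕ) : Prop where
  three : ∀ X I, M.IsClosedOff X I → corners X = 3 →
    β * I.card + 3 * α + ∑ s, excess (ω₃ s) (ω₂ s) (faceCorners f X s) ≤ α * X.card + Ω₃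
  two : ∀ X I, M.IsClosedOff X I → corners X = 2 →
    β * I.card + 2 * α + ∑ s, excess (ω₃ s) (ω₂ s) (faceCorners f X s) ≤ α * X.card + Ω₂
  one : ∀ X I, M.IsClosedOff X I → corners X ≤ 1 →
    β * I.card + γ + ∑ s, excess (ω₃ s) (ω₂ s) (faceCorners f X s) ≤ α * X.card ∨
      (X.card ≤ 1 ∧ I = ∅)

open Classical in
-- The weight α of each deleted corner is put on the side of the host. With a single deleted corner
-- it is covered by the margin, as α ≤ γ.
theorem IsTough.le_excess {W : Type} {D : Disk W} {α β ω₃ ω₂ γ : ℕ} (h : D.IsTough α β ω₃ ω₂ γ)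
    (hαγ : α ≤ γ) {X I} (hI : D.IsClosedOff X I) :
    β * I.card + α * corners X ≤ α * X.card + excess ω₃ ω₂ (corners X) := by
  have hle : corners X ≤ 3 := by
    refine (Finset.card_le_univ _).trans ?_
    simp
  unfold excess
  split_ifs with h3 h2
  · have := h.three X I hI h3
    rw [h3]; linarith
  · have := h.two X I hI h2
    rw [h2]; linarith
  · rcases I.eq_empty_or_nonempty with rfl | hne
    · simp only [Finset.card_empty, mul_zero, zero_add, add_zero]
      refine Nat.mul_le_mul_left _ ?_
      refine Finset.card_le_card_of_injOn Sum.inl (fun i hi => ?_) Sum.inl_injective.injOn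
      simpa using hi
    · have h1 := h.one X I hI (by omega) hne
      have : α * corners X ≤ α * 1 := Nat.mul_le_mul_left _ (by omega)
      omega

section Glue

variable [Fintype S] {M : Disk N} {f : S → Fin 3 ↪ Fin 3 ⊕ N} {D : ∀ s, Disk (W s)}

open Classical in
-- A deleted vertex of the host is counted again in each inserted disk that has it as a corner; the
-- sum of `faceCorners` corrects this.
theorem card_glue_eq (X : Finset (Fin 3 ⊕ (N ⊕ Σ s, W s))) :
    X.card + ∑ s, faceCorners f (X.preimage _ (incl_injective _).injOn) s =
      (X.preimage (incl _) (incl_injective _).injOn).card +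
        ∑ s, (X.preimage (emb f s) (emb_injective f s).injOn).card := by
  have h1 : X = (X.preimage (incl _) (incl_injective _).injOn).image (incl _) ∪
      Finset.univ.biUnion fun s => ((X.preimage (emb f s) (emb_injective f s).injOn).filter
        fun x => x.isRight).image (emb f s) := by
    ext v
    simp only [Finset.mem_union, Finset.mem_image, Finset.mem_preimage, Finset.mem_biUnion,
      Finset.mem_univ, true_and, Finset.mem_filter]
    constructor
    · intro hv
      rcases vertex_cases f v with ⟨x, rfl⟩ | ⟨s, w, rfl⟩
      · exact Or.inl ⟨x, hv, rfl⟩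
      · exact Or.inr ⟨s, Sum.inr w, ⟨hv, rfl⟩, rfl⟩
    · rintro (⟨x, hx, rfl⟩ | ⟨s, x, ⟨hx, -⟩, rfl⟩) <;> exact hx
  have h2 : ∀ s, (X.preimage (emb f s) (emb_injective f s).injOn).card =
      ((X.preimage (emb f s) (emb_injective f s).injOn).filter fun x => x.isRight).card +
        faceCorners f (X.preimage _ (incl_injective _).injOn) s := by
    intro s
    rw [← Finset.card_filter_add_card_filter_not (fun x => x.isRight = true)]
    congr 1
    refine (Finset.card_bij (fun i _ => Sum.inl i) ?_ ?_ ?_).symm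
    · intro i hi
      simpa using hi
    · intro i _ j _ h
      simpa using h
    · rintro (i | w) h
      · exact ⟨i, by simpa using h, rfl⟩
      · simp at h
  simp_rw [h2]
  rw [Finset.sum_add_distrib, ← add_assoc]
  congr 1
  conv_lhs => rw [h1]
  rw [Finset.card_union_of_disjoint, Finset.card_image_of_injective _ (incl_injective _),
    Finset.card_biUnion]
  · congr 1
    exact Finset.sum_congr rfl fun s _ => Finset.card_image_of_injective _ (emb_injective f s)
  · intro s _ s' _ hs
    rw [Function.onFun, Finset.disjoint_left]
    intro v hv hv'
    obtain ⟨x, hx, rfl⟩ := Finset.mem_image.mp hv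
    obtain ⟨x', hx', he⟩ := Finset.mem_image.mp hv'
    have hr := (Finset.mem_filter.mp hx).2
    obtain ⟨w, rfl⟩ := Sum.isRight_iff.mp hr
    exact hs (emb_eq_inr f he).1.symm
  · rw [Finset.disjoint_left]
    intro v hv hv'
    obtain ⟨x, hx, rfl⟩ := Finset.mem_image.mp hv
    obtain ⟨s, -, hs⟩ := Finset.mem_biUnion.mp hv'
    obtain ⟨x', hx', he⟩ := Finset.mem_image.mp hs
    have hr := (Finset.mem_filter.mp hx').2
    obtain ⟨w, rfl⟩ := Sum.isRight_iff.mp hr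
    exact incl_ne _ _ he.symm

open Classical in
-- A representative that reaches no remaining corner of its disk is counted in the disk. Each other
-- one is connected to some host vertex `ρ`, and different representatives have different `ρ`
-- because they lie in different components.
theorem exists_closedOff_host {X I : Finset (Fin 3 ⊕ (N ⊕ Σ s, W s))}
    (hI : (glue M f D).IsClosedOff X I) :
    ∃ (J : Finset (Fin 3 ⊕ N)) (K : ∀ s, Finset (Fin 3 ⊕ W s)),
      M.IsClosedOff (X.preimage (incl _) (incl_injective _).injOn) J ∧
      (∀ s, (D s).IsClosedOff (X.preimage (emb f s) (emb_injective f s).injOn) (K s)) ∧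
      I.card ≤ J.card + ∑ s, (K s).card := by
  set XM := X.preimage (incl _) (incl_injective _).injOn with hXM
  set Xs := fun s => X.preimage (emb f s) (emb_injective f s).injOn with hXs
  set K : ∀ s, Finset (Fin 3 ⊕ W s) := fun s =>
    (I.preimage (emb f s) (emb_injective f s).injOn).filter fun x =>
      ∀ i, Sum.inl i ∉ Xs s → ¬ (D s).graph.ReachAvoiding (Xs s) x (Sum.inl i) with hK
  set U := Finset.univ.biUnion fun s => (K s).image (emb f s) with hU
  have liftD : ∀ {s x y}, (D s).graph.ReachAvoiding (Xs s) x y →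
      (glue M f D).graph.ReachAvoiding X (emb f s x) (emb f s y) := fun h =>
    h.map _ (fun a b h => .disk h) fun a ha => by simpa [hXs] using ha
  have liftM : ∀ {x y}, M.graph.ReachAvoiding XM x y →
      (glue M f D).graph.ReachAvoiding X (incl _ x) (incl _ y) := fun h =>
    h.map _ (fun a b h => .base h) fun a ha => by simpa [hXM] using ha
  have hρ : ∀ v : (I \ U : Finset _), ∃ x, (glue M f D).graph.ReachAvoiding X v.1 (incl _ x) := by
    rintro ⟨v, hv⟩
    rw [Finset.mem_sdiff] at hv
    rcases vertex_cases f v with ⟨x, rfl⟩ | ⟨s, w, rfl⟩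
    · exact ⟨x, .refl _⟩
    · have : Sum.inr w ∉ K s := fun h =>
        hv.2 (Finset.mem_biUnion.mpr ⟨s, Finset.mem_univ _, Finset.mem_image_of_mem _ h⟩)
      simp only [hK, Finset.mem_filter, Finset.mem_preimage, hv.1, true_and] at this
      push Not at this
      obtain ⟨i, -, hi⟩ := this
      exact ⟨f s i, liftD hi⟩
  choose ρ hρ using hρ
  have hmem : ∀ v : (I \ U : Finset _), v.1 ∈ I := fun v => (Finset.mem_sdiff.mp v.2).1
  refine ⟨Finset.univ.image ρ, K, ⟨?_, ?_, ?_⟩, fun s => ⟨?_, ?_, ?_⟩, ?_⟩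
  · intro x hx
    obtain ⟨v, -, rfl⟩ := Finset.mem_image.mp hx
    have := (hρ v).notMem (hI.notMem _ (hmem v))
    simpa [hXM] using this
  · intro x hx y hy h
    obtain ⟨v, -, rfl⟩ := Finset.mem_image.mp hx
    obtain ⟨w, -, rfl⟩ := Finset.mem_image.mp hy
    have := hI.eq_of_reach _ (hmem v) _ (hmem w) (((hρ v).trans (liftM h)).trans (hρ w).symm)
    rw [Subtype.ext this]
  · intro x hx i hi h
    obtain ⟨v, -, rfl⟩ := Finset.mem_image.mp hx
    refine hI.not_reach _ (hmem v) i ?_ ((hρ v).trans (liftM h))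
    simpa [hXM, incl] using hi
  · intro x hx
    have := hI.notMem _ (Finset.mem_preimage.mp (Finset.mem_filter.mp hx).1)
    simpa [hXs] using this
  · intro x hx y hy h
    exact emb_injective f s (hI.eq_of_reach _ (Finset.mem_preimage.mp (Finset.mem_filter.mp hx).1)
      _ (Finset.mem_preimage.mp (Finset.mem_filter.mp hy).1) (liftD h))
  · intro x hx i hi
    exact (Finset.mem_filter.mp hx).2 i hi
  · have h1 : (Finset.univ.image ρ).card = (I \ U).card := by
      rw [Finset.card_image_of_injective, Finset.card_univ, Fintype.card_coe]
      intro v w h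
      exact Subtype.ext (hI.eq_of_reach _ (hmem v) _ (hmem w)
        ((hρ v).trans (h ▸ (hρ w).symm)))
    rw [h1]
    have h2 : U.card ≤ ∑ s, (K s).card :=
      Finset.card_biUnion_le.trans (Finset.sum_le_sum fun s _ => Finset.card_image_le)
    have h3 : I.card ≤ (I \ U).card + U.card := by
      rw [← Finset.card_union_of_disjoint Finset.sdiff_disjoint]
      refine Finset.card_le_card fun v hv => ?_
      by_cases hvU : v ∈ U <;> simp [hv, hvU]
    omega

open Classical in
theorem IsToughHost.glue {α β γ Ω₃ Ω₂ : ℕ} {ω₃ ω₂ : S → ℕ}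
    (hM : IsToughHost M f α β ω₃ ω₂ Ω₃ Ω₂ γ) (hαγ : α ≤ γ)
    (hD : ∀ s, (D s).IsTough α β (ω₃ s) (ω₂ s) γ) : (glue M f D).IsTough α β Ω₃ Ω₂ γ := by
  have main : ∀ X I, (Disk.glue M f D).IsClosedOff X I →
      ∃ (Y J : Finset (Fin 3 ⊕ N)), M.IsClosedOff Y J ∧ corners Y = corners X ∧
        (α * Y.card + β * I.card ≤ α * X.card + β * J.card +
          ∑ s, excess (ω₃ s) (ω₂ s) (faceCorners f Y s)) ∧
        (Y.card ≤ 1 → J = ∅ → I.Nonempty → β * I.card + γ ≤ α * X.card) := by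
    intro X I hI
    obtain ⟨J, K, hJ, hK, hle⟩ := exists_closedOff_host hI
    set Y := X.preimage (incl _) (incl_injective _).injOn with hY
    set Z := fun s => X.preimage (emb f s) (emb_injective f s).injOn with hZ
    have hcard : X.card + ∑ s, faceCorners f Y s = Y.card + ∑ s, (Z s).card := card_glue_eq X
    have hc : ∀ s, corners (Z s) = faceCorners f Y s := by
      intro s
      unfold corners faceCorners
      congr 1
      ext i
      simp [hZ, hY]
    have hs : ∀ s, β * (K s).card + α * faceCorners f Y s ≤
        α * (Z s).card + excess (ω₃ s) (ω₂ s) (faceCorners f Y s) := by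
      intro s
      have := (hD s).le_excess hαγ (hK s)
      rwa [hc s] at this
    have hmulcard : α * X.card + ∑ s, α * faceCorners f Y s =
        α * Y.card + ∑ s, α * (Z s).card := by
      rw [← Finset.mul_sum, ← Finset.mul_sum, ← mul_add, ← mul_add, hcard]
    have hmulle : β * I.card ≤ β * J.card + ∑ s, β * (K s).card := by
      rw [← Finset.mul_sum, ← mul_add]
      exact Nat.mul_le_mul_left _ hle
    refine ⟨Y, J, hJ, ?_, ?_, ?_⟩
    · unfold corners
      congr 1
      ext i
      simp [hY, incl]
    · have hsum := Finset.sum_le_sum fun s (_ : s ∈ Finset.univ) => hs s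
      rw [Finset.sum_add_distrib, Finset.sum_add_distrib] at hsum
      linarith
    -- With at most one host vertex deleted no face has any excess, and the host contributes no
    -- component. Some disk `s₀` then has one, and its own margin `γ` serves for the whole; the
    -- corner it shares with the host is paid for by `Y`.
    · intro hY1 hJ0 hne
      have hfY : ∀ s, faceCorners f Y s ≤ Y.card := by
        intro s
        refine Finset.card_le_card_of_injOn (f s) (fun i hi => ?_) (f s).injective.injOn
        simpa using hi
      have hs' : ∀ s, β * (K s).card + α * faceCorners f Y s ≤ α * (Z s).card := by
        intro s
        have h1 := hs s
        have h2 := hfY s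
        rw [excess, if_neg (by omega), if_neg (by omega)] at h1
        omega
      have hpos : 0 < ∑ s, (K s).card := by
        have := hne.card_pos
        rw [hJ0, Finset.card_empty] at hle
        omega
      obtain ⟨s₀, -, hs₀⟩ := Finset.exists_ne_zero_of_sum_ne_zero hpos.ne'
      have hs₀' := (hD s₀).one (Z s₀) (K s₀) (hK s₀) (by rw [hc]; exact (hfY s₀).trans hY1)
        (Finset.card_pos.mp (Nat.pos_of_ne_zero hs₀))
      have e1 := Finset.add_sum_erase Finset.univ (fun s => α * (Z s).card) (Finset.mem_univ s₀)
      have e2 := Finset.add_sum_erase Finset.univ (fun s => β * (K s).card) (Finset.mem_univ s₀)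
      have e3 := Finset.add_sum_erase Finset.univ (fun s => α * faceCorners f Y s)
        (Finset.mem_univ s₀)
      have hsum := Finset.sum_le_sum fun s (_ : s ∈ Finset.univ.erase s₀) => hs' s
      rw [Finset.sum_add_distrib] at hsum
      have h5 : α * faceCorners f Y s₀ ≤ α * Y.card := Nat.mul_le_mul_left _ (hfY s₀)
      rw [hJ0, Finset.card_empty] at hmulle
      linarith
  constructor
  · intro X I hI h3
    obtain ⟨Y, J, hJ, hc, h1, -⟩ := main X I hI
    have := hM.three Y J hJ (hc.trans h3)
    linarith
  · intro X I hI h2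
    obtain ⟨Y, J, hJ, hc, h1, -⟩ := main X I hI
    have := hM.two Y J hJ (hc.trans h2)
    linarith
  · intro X I hI ht hne
    obtain ⟨Y, J, hJ, hc, h1, h2⟩ := main X I hI
    rcases hM.one Y J hJ (hc.trans_le ht) with h | ⟨h, h'⟩
    · linarith
    · exact h2 h h' hne

end Glue

open Classical in
theorem IsTough.le_of_isSeparatingSet {W : Type} [Finite W] {D : Disk W} (hD : D.IsPlane)
    {α β ω₃ ω₂ γ δ : ℕ} (h : D.IsTough α β ω₃ ω₂ γ) (h₃ : ω₃ + δ ≤ 3 * α)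
    (h₂ : ω₂ + β + δ ≤ 2 * α) (h₁ : β + δ ≤ γ) {X : Finset (Fin 3 ⊕ W)}
    (hX : D.graph.IsSeparatingSet X) :
    β * Nat.card (D.graph.deleteVerts X).ConnectedComponent + δ ≤ α * X.card := by
  obtain ⟨I, hI, hIX, hsep⟩ := exists_separated D.graph X
  have h2I := hX.two_le_natCard
  rw [← hI] at h2I ⊢
  have hle : corners X ≤ 3 := by
    refine (Finset.card_le_univ _).trans ?_
    simp
  by_cases h3 : corners X = 3
  · have hall : ∀ i, Sum.inl i ∈ X := by
      intro i
      have : (Finset.univ.filter fun i : Fin 3 => Sum.inl i ∈ X) = Finset.univ :=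
        Finset.eq_univ_of_card _ h3
      have := Finset.ext_iff.mp this i
      simpa using this
    have := h.three X I ⟨hIX, hsep, fun u _ i hi => absurd (hall i) hi⟩ h3
    omega
  · have hex : ∃ i : Fin 3, Sum.inl i ∉ X := by
      by_contra hall
      push Not at hall
      apply h3
      simp [corners, hall]
    obtain ⟨i₀, hi₀⟩ := hex
    -- The corners are pairwise adjacent, so all remaining corners lie in one component. Leaving it
    -- out costs one representative and makes the rest closed off.
    set J := I.filter fun u => ¬ D.graph.ReachAvoiding X u (Sum.inl i₀) with hJ
    have hJc : D.IsClosedOff X J := by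
      refine ⟨fun u hu => hIX u (Finset.mem_filter.mp hu).1, fun u hu v hv =>
        hsep u (Finset.mem_filter.mp hu).1 v (Finset.mem_filter.mp hv).1, fun u hu j hj hr => ?_⟩
      refine (Finset.mem_filter.mp hu).2 (hr.trans ?_)
      have h3 : ∀ i j : Fin 3, i = j ∨ i = j + 1 ∨ j = i + 1 := by decide
      rcases h3 i₀ j with rfl | rfl | rfl
      · exact .refl _
      · exact .of_adj (hD.adj_corner j) hj hi₀
      · exact .of_adj (hD.adj_corner i₀).symm hj hi₀
    have hcard : I.card ≤ J.card + 1 := by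
      rw [← Finset.card_filter_add_card_filter_not (s := I)
        (fun u => ¬ D.graph.ReachAvoiding X u (Sum.inl i₀))]
      refine Nat.add_le_add_left (Finset.card_le_one.mpr fun u hu v hv => ?_) _
      simp only [Finset.mem_filter, not_not] at hu hv
      exact hsep u hu.1 v hv.1 (hu.2.trans hv.2.symm)
    have hmul : β * I.card ≤ β * J.card + β := by
      have := Nat.mul_le_mul_left β hcard
      rwa [mul_add, mul_one] at this
    by_cases h2 : corners X = 2
    · have := h.two X J hJc h2
      omega
    · have := h.one X J hJc (by omega) (Finset.card_pos.mp (by omega))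
      omega

end Disk

/-! ### The tetrahedron and the octahedron -/

theorem connected_of_center {V : Type*} {G : SimpleGraph V} (r : V)
    (h : ∀ v, v = r ∨ G.Adj v r ∨ ∃ w, G.Adj v w ∧ G.Adj w r) : G.Connected := by
  have h0 : ∀ v, G.Reachable v r := by
    intro v
    rcases h v with rfl | h | ⟨w, h1, h2⟩
    · exact .rfl
    · exact h.reachable
    · exact h1.reachable.trans h2.reachable
  exact { preconnected := fun u v => (h0 u).trans (h0 v).symm, nonempty := ⟨r⟩ }

namespace Disk

theorem IsPlane.of_finite {N : Type} {D : Disk N} (r : Fin 3 ⊕ N) (m : ℕ)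
    (h1 : ∀ u v, D.graph.Adj u v → D.graph.Adj u (D.nxt u v) ∧ D.nxt (D.nxt v u) v = u)
    (h2 : ∀ u v w, D.graph.Adj u v → D.graph.Adj u w → ∃ k < m, (D.nxt u)^[k] v = w)
    (h3 : ∀ v, v = r ∨ D.graph.Adj v r ∨ ∃ w, D.graph.Adj v w ∧ D.graph.Adj w r)
    (h4 : ∀ i : Fin 3, D.graph.Adj (Sum.inl i) (Sum.inl (i + 1)) ∧
      D.nxt (Sum.inl (i + 1)) (Sum.inl i) = Sum.inl (i + 2))
    (h5 : Nat.card D.graph.Dart = 6 + 6 * Nat.card N) : D.IsPlane where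
  adj_nxt h := (h1 _ _ h).1
  nxt_nxt h := (h1 _ _ h).2
  exists_iterate hv hw := (h2 _ _ _ hv hw).imp fun _ h => h.2
  connected := connected_of_center r h3
  adj_corner i := (h4 i).1
  nxt_corner i := (h4 i).2
  card_dart := h5

section Tetrahedron

def tetrahedronNxt : Fin 3 ⊕ Unit → Fin 3 ⊕ Unit → Fin 3 ⊕ Unit
  | .inl i, .inl j => if j = i + 1 then .inr () else .inl (i + 1)
  | .inl i, .inr _ => .inl (i + 2)
  | .inr _, .inl i => .inl (i + 1)
  | .inr _, .inr _ => .inr ()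

/-- A triangle with one inner vertex, which is joined to all corners. -/
def tetrahedron : Disk Unit where
  graph := ⊤
  nxt := tetrahedronNxt

instance : DecidableRel tetrahedron.graph.Adj := fun u v =>
  inferInstanceAs (Decidable ((⊤ : SimpleGraph (Fin 3 ⊕ Unit)).Adj u v))

theorem tetrahedron_isPlane : tetrahedron.IsPlane :=
  .of_finite (Sum.inl 0) 3 (by decide) (by decide) (by decide) (by decide) (by
    rw [Nat.card_eq_fintype_card, dart_card_eq_sum_degrees]; simp; decide)

/-- The only inner vertex is cut off from the corners only if all three are deleted, whence the
excess β in that case and 0 otherwise. -/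
theorem tetrahedron_isTough {α β γ : ℕ} : tetrahedron.IsTough α β β 0 γ := by
  have hall : ∀ X I, tetrahedron.IsClosedOff X I → I.Nonempty → (∀ i, Sum.inl i ∈ X) ∧
      I.card ≤ 1 := by
    intro X I hI hne
    have hsub : I ⊆ {Sum.inr ()} := by
      rintro (i | _) hi
      · exact absurd (.refl _) (hI.not_reach _ hi i (hI.notMem _ hi))
      · simp
    refine ⟨fun i => ?_, (Finset.card_le_card hsub).trans (by simp)⟩
    obtain ⟨u, hu⟩ := hne
    by_contra hi
    refine hI.not_reach u hu i hi (.of_adj ?_ (hI.notMem u hu) hi)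
    rw [Finset.mem_singleton.mp (hsub hu)]
    exact (by decide : ∀ i, tetrahedron.graph.Adj (Sum.inr ()) (Sum.inl i)) i
  have hcor : ∀ X : Finset (Fin 3 ⊕ Unit), corners X ≤ X.card := by
    intro X
    refine Finset.card_le_card_of_injOn Sum.inl (fun i hi => ?_) Sum.inl_injective.injOn
    simpa using hi
  have hcor3 : ∀ X I, tetrahedron.IsClosedOff X I → I.Nonempty → corners X = 3 := by
    intro X I hI hne
    simp [corners, (hall X I hI hne).1]
  have hmul : ∀ X : Finset (Fin 3 ⊕ Unit), α * corners X ≤ α * X.card := fun X =>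
    Nat.mul_le_mul_left _ (hcor X)
  constructor
  · intro X I hI h
    have h1 := hmul X
    have h2 : I.card ≤ 1 := by
      rcases I.eq_empty_or_nonempty with rfl | hne
      · simp
      · exact (hall X I hI hne).2
    have h3 : β * I.card ≤ β * 1 := Nat.mul_le_mul_left _ h2
    rw [h] at h1
    linarith
  · intro X I hI h
    rcases I.eq_empty_or_nonempty with rfl | hne
    · have h1 := hmul X
      rw [h] at h1
      simp; linarith
    · have := hcor3 X I hI hne
      omega
  · intro X I hI h hne
    have := hcor3 X I hI hne
    omega

end Tetrahedron

section Indicator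

variable {N S : Type}

theorem corners_eq_sum (X : Finset (Fin 3 ⊕ N)) (v : Fin 3 ⊕ N → Bool)
    (hv : ∀ u, v u = true ↔ u ∈ X) : corners X = ∑ i, (v (Sum.inl i)).toNat := by
  unfold corners
  rw [Finset.card_filter]
  refine Finset.sum_congr rfl fun i _ => ?_
  by_cases h : Sum.inl i ∈ X
  · rw [if_pos h, (hv _).mpr h]; rfl
  · have : v (Sum.inl i) = false := by rw [← Bool.not_eq_true, hv]; exact h
    rw [if_neg h, this]; rfl

theorem faceCorners_eq_sum (f : S → Fin 3 ↪ Fin 3 ⊕ N) (X : Finset (Fin 3 ⊕ N))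
    (v : Fin 3 ⊕ N → Bool) (hv : ∀ u, v u = true ↔ u ∈ X) (s : S) :
    faceCorners f X s = ∑ i, (v (f s i)).toNat := by
  unfold faceCorners
  rw [Finset.card_filter]
  refine Finset.sum_congr rfl fun i _ => ?_
  by_cases h : f s i ∈ X
  · rw [if_pos h, (hv _).mpr h]; rfl
  · have : v (f s i) = false := by rw [← Bool.not_eq_true, hv]; exact h
    rw [if_neg h, this]; rfl

theorem card_eq_sum_toNat {V : Type*} [Fintype V] (X : Finset V)
    (v : V → Bool) (hv : ∀ u, v u = true ↔ u ∈ X) : X.card = ∑ u, (v u).toNat := by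
  classical
  have : X = Finset.univ.filter fun u => u ∈ X := by ext; simp
  rw [this, Finset.card_filter]
  refine Finset.sum_congr rfl fun u _ => ?_
  by_cases h : u ∈ X
  · rw [if_pos h, (hv _).mpr h]; rfl
  · have : v u = false := by rw [← Bool.not_eq_true, hv]; exact h
    rw [if_neg h, this]; rfl

end Indicator

section Octahedron

def octahedronAdj : Fin 3 ⊕ Fin 3 → Fin 3 ⊕ Fin 3 → Bool
  | .inl i, .inl j => i ≠ j
  | .inr i, .inr j => i ≠ j
  | .inl i, .inr j => i = j ∨ i = j + 1
  | .inr i, .inl j => j = i ∨ j = i + 1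

def octahedronNxt : Fin 3 ⊕ Fin 3 → Fin 3 ⊕ Fin 3 → Fin 3 ⊕ Fin 3
  | .inl i, .inl j => if j = i + 1 then .inr i else .inl (i + 1)
  | .inl i, .inr j => if j = i then .inr (i + 2) else .inl (i + 2)
  | .inr i, .inl j => if j = i then .inl (i + 1) else .inr (i + 1)
  | .inr i, .inr j => if j = i + 1 then .inr (i + 2) else .inl i

/-- The octahedron: the inner vertices form a triangle, and `Sum.inr i` is adjacent to the corners
`Sum.inl i` and `Sum.inl (i + 1)`. -/
def octahedron : Disk (Fin 3) where
  graph :=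
    { Adj := fun u v => octahedronAdj u v = true
      symm := ⟨by decide⟩
      loopless := ⟨by decide⟩ }
  nxt := octahedronNxt

instance : DecidableRel octahedron.graph.Adj := fun u v =>
  inferInstanceAs (Decidable (octahedronAdj u v = true))

theorem octahedron_isPlane : octahedron.IsPlane :=
  .of_finite (Sum.inl 0) 4 (by decide) (by decide) (by decide) (by decide) (by
    rw [Nat.card_eq_fintype_card, dart_card_eq_sum_degrees]; simp; decide)

/-- The face of the octahedron at the side `i` of the outer triangle. -/
def sideFace (i : Fin 3) : Fin 3 ↪ Fin 3 ⊕ Fin 3 where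
  toFun := ![.inl i, .inl (i + 1), .inr i]
  inj' := by revert i; decide

/-- The face of the octahedron at the side `i` of the inner triangle. -/
def innerFace (i : Fin 3) : Fin 3 ↪ Fin 3 ⊕ Fin 3 where
  toFun := ![.inr i, .inl (i + 1), .inr (i + 1)]
  inj' := by revert i; decide

/-- The face of the octahedron that is formed by the inner vertices. -/
def centralFace : Fin 3 ↪ Fin 3 ⊕ Fin 3 where
  toFun := Sum.inr
  inj' := Sum.inr_injective

/-- The central face and the faces next to it. -/
def coreFace : Option (Fin 3) → Fin 3 ↪ Fin 3 ⊕ Fin 3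
  | none => centralFace
  | some i => innerFace i

theorem isFaces_sideFace : octahedron.IsFaces sideFace :=
  ⟨by decide, by decide, by decide, by decide⟩

theorem isFaces_centralFace : octahedron.IsFaces fun _ : Unit => centralFace :=
  ⟨by decide, by decide, by decide, by decide⟩

theorem isFaces_coreFace : octahedron.IsFaces coreFace :=
  ⟨by decide, by decide, by decide, by decide⟩

/-- Some inner vertex remains, and none of those that remain has a remaining corner as neighbour. -/
def innerClosed (v : Fin 3 ⊕ Fin 3 → Bool) : Bool :=
  (∃ i, v (.inr i) = false) ∧ ∀ i, v (.inr i) = false → v (.inl i) = true ∧ v (.inl (i + 1)) = true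

/-- The inner vertices form a triangle, so those that remain lie in a single component. -/
theorem octahedron_card_le {X I : Finset (Fin 3 ⊕ Fin 3)} (hI : octahedron.IsClosedOff X I)
    (v : Fin 3 ⊕ Fin 3 → Bool) (hv : ∀ u, v u = true ↔ u ∈ X) :
    I.card ≤ (innerClosed v).toNat := by
  have hv' : ∀ u, v u = false ↔ u ∉ X := fun u => by rw [← hv, Bool.not_eq_true]
  have hinner : ∀ u ∈ I, ∃ i, u = Sum.inr i := by
    rintro (i | i) hi
    · exact absurd (.refl _) (hI.not_reach _ hi i (hI.notMem _ hi))
    · exact ⟨i, rfl⟩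
  have hreach : ∀ i j, Sum.inr i ∉ X → Sum.inr j ∉ X →
      octahedron.graph.ReachAvoiding X (Sum.inr i) (Sum.inr j) := by
    intro i j hi hj
    by_cases hij : i = j
    · rw [hij]; exact .refl _
    · refine .of_adj ?_ hi hj
      exact (by decide : ∀ i j, i ≠ j → octahedron.graph.Adj (Sum.inr i) (Sum.inr j)) i j hij
  rcases I.eq_empty_or_nonempty with rfl | ⟨u, hu⟩
  · simp
  obtain ⟨i, rfl⟩ := hinner u hu
  have hi := hI.notMem _ hu
  have h1 : innerClosed v = true := by
    simp only [innerClosed, decide_eq_true_eq, hv, hv']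
    refine ⟨⟨i, hi⟩, fun j hj => ⟨?_, ?_⟩⟩ <;> by_contra hjX
    · refine hI.not_reach _ hu _ hjX ((hreach i j hi hj).trans (.of_adj ?_ hj hjX))
      exact (by decide : ∀ j, octahedron.graph.Adj (Sum.inr j) (Sum.inl j)) j
    · refine hI.not_reach _ hu _ hjX ((hreach i j hi hj).trans (.of_adj ?_ hj hjX))
      exact (by decide : ∀ j, octahedron.graph.Adj (Sum.inr j) (Sum.inl (j + 1))) j
  rw [h1]
  refine Finset.card_le_one.mpr fun a ha b hb => ?_
  obtain ⟨j, rfl⟩ := hinner a ha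
  obtain ⟨k, rfl⟩ := hinner b hb
  exact hI.eq_of_reach _ ha _ hb (hreach j k (hI.notMem _ ha) (hI.notMem _ hb))

/-- A criterion for the octahedron to be a tough host, to be checked for all sets of vertices. -/
theorem octahedron_isToughHost {S : Type} [Fintype S] {f : S → Fin 3 ↪ Fin 3 ⊕ Fin 3}
    {α β Ω₃ Ω₂ γ : ℕ} {ω₃ ω₂ : S → ℕ}
    (h : ∀ v : Fin 3 ⊕ Fin 3 → Bool, ∀ t k e, t = ∑ i, (v (Sum.inl i)).toNat →
      k = ∑ u, (v u).toNat → e = ∑ s, excess (ω₃ s) (ω₂ s) (∑ i, (v (f s i)).toNat) →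
      (t = 3 → β * (innerClosed v).toNat + 3 * α + e ≤ α * k + Ω₃) ∧
      (t = 2 → β * (innerClosed v).toNat + 2 * α + e ≤ α * k + Ω₂) ∧
      (t ≤ 1 → β * (innerClosed v).toNat + γ + e ≤ α * k ∨ (k ≤ 1 ∧ innerClosed v = false))) :
    octahedron.IsToughHost f α β ω₃ ω₂ Ω₃ Ω₂ γ := by
  classical
  have key : ∀ X I, octahedron.IsClosedOff X I → _ := fun X I hI =>
    have hv : ∀ u, (fun u => decide (u ∈ X)) u = true ↔ u ∈ X := fun u => by simp
    have h1 := Nat.mul_le_mul_left β (octahedron_card_le hI _ hv)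
    have h2 := h (fun u => decide (u ∈ X)) _ _ _ (corners_eq_sum X _ hv).symm.symm
      (card_eq_sum_toNat X _ hv) rfl
    And.intro (octahedron_card_le hI _ hv) (And.intro h1 h2)
  have he : ∀ X : Finset (Fin 3 ⊕ Fin 3), ∑ s, excess (ω₃ s) (ω₂ s) (faceCorners f X s) =
      ∑ s, excess (ω₃ s) (ω₂ s) (∑ i, (decide (f s i ∈ X)).toNat) := fun X =>
    Finset.sum_congr rfl fun s _ => by
      rw [faceCorners_eq_sum f X (fun u => decide (u ∈ X)) (fun u => by simp)]
  constructor
  · intro X I hI ht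
    obtain ⟨-, h1, h2, -, -⟩ := key X I hI
    have := h2 ht
    rw [he]
    omega
  · intro X I hI ht
    obtain ⟨-, h1, -, h2, -⟩ := key X I hI
    have := h2 ht
    rw [he]
    omega
  · intro X I hI ht
    obtain ⟨h0, h1, -, -, h2⟩ := key X I hI
    rw [he]
    rcases h2 ht with h2 | ⟨h2, h3⟩
    · left; omega
    · right
      rw [h3] at h0
      exact ⟨h2, Finset.card_eq_zero.mp (by simpa using h0)⟩

theorem isToughHost_sideFace_one :
    octahedron.IsToughHost sideFace 1 1 (fun _ => 1) (fun _ => 0) 1 0 2 :=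
  -- The condition is a finite check over the 64 sets of deleted vertices.
  octahedron_isToughHost (by rintro v t k e rfl rfl rfl; revert v; decide)

/-- The value 7 is attained by deleting the corners and two inner vertices: two side disks and the
last inner vertex give 3 · 5 against 2 · 4. -/
theorem isToughHost_sideFace_four_five :
    octahedron.IsToughHost sideFace 4 5 (fun _ => 5) (fun _ => 0) 7 1 5 :=
  octahedron_isToughHost (by rintro v t k e rfl rfl rfl; revert v; decide)

theorem isToughHost_sideFace_seven_eight :
    octahedron.IsToughHost sideFace 7 8 (fun _ => 8) (fun _ => 0) 10 1 8 :=
  octahedron_isToughHost (by rintro v t k e rfl rfl rfl; revert v; decide)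

/-- The belt turns the excesses 7 and 3 back into those of the tetrahedron, so the construction can
be iterated. Equality holds if exactly two or exactly three of the inner vertices are deleted. -/
theorem isToughHost_centralFace_four_five :
    octahedron.IsToughHost (fun _ : Unit => centralFace) 4 5 (fun _ => 7) (fun _ => 3) 5 0 5 :=
  octahedron_isToughHost (by rintro v t k e rfl rfl rfl; revert v; decide)

theorem isToughHost_centralFace_seven_eight :
    octahedron.IsToughHost (fun _ : Unit => centralFace) 7 8 (fun _ => 13) (fun _ => 6) 8 0 8 :=
  octahedron_isToughHost (by rintro v t k e rfl rfl rfl; revert v; decide)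

/-- The bound 13 is attained by deleting all six vertices: the inserted disks have excess 10 + 3 ·
8, and the three inner vertices pay 3 · 7. -/
theorem isToughHost_coreFace :
    octahedron.IsToughHost coreFace 7 8 (fun s => s.elim 10 fun _ => 8)
      (fun s => s.elim 1 fun _ => 0) 13 6 8 :=
  octahedron_isToughHost (by rintro v t k e rfl rfl rfl; revert v; decide)

end Octahedron

end Disk

/-! ### The hub: its rotation and its toughness -/

theorem exists_iterate_of_period {α : Type*} {g : α → α} {s v w : α} {d : ℕ}
    (hs : g^[d] s = s) (hv : ∃ k < d, g^[k] s = v) (hw : ∃ k < d, g^[k] s = w) :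
    ∃ k, g^[k] v = w := by
  obtain ⟨a, ha, rfl⟩ := hv
  obtain ⟨b, -, rfl⟩ := hw
  -- From v, d - a steps complete the turn at s, and b further steps lead to w.
  refine ⟨b + (d - a), ?_⟩
  rw [← Function.iterate_add_apply, show b + (d - a) + a = b + d by omega,
    Function.iterate_add_apply, hs]

namespace Disk

section Hub

/-- The neighbours of the vertices of the hub, in cyclic order. The vertices are `b i = 4 * i`,
`c i = 4 * i + 1`, `g i = 4 * i + 2`, `y i = 4 * i + 3`, `p = 40`, `q = 41`. The vertex `p` is
surrounded by the cycle of all `b i`, `c i`, `g i`; `y i` is joined to `g (i - 1)`, `b i`, `c i`,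
`g i`, `q`; and `y i` to `y (i + 1)` for `i < 9`, while `q` is joined to `g 9`. -/
def hubRotation : List (List ℕ) :=
  [[1, 40, 38, 3], [0, 3, 2, 40], [1, 3, 7, 4, 40], [0, 38, 41, 7, 2, 1], [2, 7, 5, 40], [4, 7, 6,
   40], [5, 7, 11, 8, 40], [2, 3, 41, 11, 6, 5, 4], [6, 11, 9, 40], [8, 11, 10, 40], [9, 11, 15,
   12, 40], [6, 7, 41, 15, 10, 9, 8], [10, 15, 13, 40], [12, 15, 14, 40], [13, 15, 19, 16, 40],
   [10, 11, 41, 19, 14, 13, 12], [14, 19, 17, 40], [16, 19, 18, 40], [17, 19, 23, 20, 40], [14,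
   15, 41, 23, 18, 17, 16], [18, 23, 21, 40], [20, 23, 22, 40], [21, 23, 27, 24, 40], [18, 19, 41,
   27, 22, 21, 20], [22, 27, 25, 40], [24, 27, 26, 40], [25, 27, 31, 28, 40], [22, 23, 41, 31, 26,
   25, 24], [26, 31, 29, 40], [28, 31, 30, 40], [29, 31, 35, 32, 40], [26, 27, 41, 35, 30, 29,
   28], [30, 35, 33, 40], [32, 35, 34, 40], [33, 35, 39, 36, 40], [30, 31, 41, 39, 34, 33, 32],
   [34, 39, 37, 40], [36, 39, 38, 40], [0, 40, 37, 39, 41, 3], [34, 35, 41, 38, 37, 36], [0, 1, 2,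
   4, 5, 6, 8, 9, 10, 12, 13, 14, 16, 17, 18, 20, 21, 22, 24, 25, 26, 28, 29, 30, 32, 33, 34, 36,
   37, 38], [3, 38, 39, 35, 31, 27, 23, 19, 15, 11, 7]]

/-- The successor of `v` in a cyclic list. -/
def cyclicNext (h v : ℕ) : List ℕ → ℕ
  | a :: b :: l => if a = v then b else cyclicNext h v (b :: l)
  | _ => h

/-- The corners q, y 8, y 9 form a face; it is the outer one. -/
def hubCode : Fin 3 ⊕ Fin 39 → ℕ
  | .inl i => if i = 0 then 41 else if i = 1 then 35 else 39
  | .inr k => if k.1 < 35 then k.1 else if k.1 < 38 then k.1 + 1 else 40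

def hubVertex (n : ℕ) : Fin 3 ⊕ Fin 39 :=
  if n = 41 then .inl 0 else if n = 35 then .inl 1 else if n = 39 then .inl 2
  else .inr (Fin.ofNat 39 (if n < 35 then n else if n < 39 then n - 1 else 38))

def hubNeighbors (u : Fin 3 ⊕ Fin 39) : List ℕ := hubRotation.getD (hubCode u) []

/-- The head of the list is the default value of `cyclicNext`, so the last neighbour is followed by
the first. -/
def hubNxt (u v : Fin 3 ⊕ Fin 39) : Fin 3 ⊕ Fin 39 :=
  hubVertex (cyclicNext ((hubNeighbors u).headD 0) (hubCode v) (hubNeighbors u))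

def hubAdj (u v : Fin 3 ⊕ Fin 39) : Bool := (hubNeighbors u).contains (hubCode v)

set_option maxRecDepth 100000 in
/-- A triangulation with 42 vertices, one of which has degree 30. -/
def hub : Disk (Fin 39) where
  graph :=
    { Adj := fun u v => hubAdj u v = true
      symm := ⟨by decide⟩
      loopless := ⟨by decide⟩ }
  nxt := hubNxt

instance : DecidableRel hub.graph.Adj := fun u v =>
  inferInstanceAs (Decidable (hubAdj u v = true))

set_option maxRecDepth 100000 in
theorem hub_card_dart : Nat.card hub.graph.Dart = 6 + 6 * Nat.card (Fin 39) := by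
  rw [Nat.card_eq_fintype_card, dart_card_eq_sum_degrees]
  simp only [Nat.card_eq_fintype_card, Fintype.card_fin]
  decide

set_option maxRecDepth 100000 in
theorem hub_nxt : ∀ u v, hub.graph.Adj u v →
    hub.graph.Adj u (hub.nxt u v) ∧ hub.nxt (hub.nxt v u) v = u := by decide

-- Going once around from the first neighbour is a check for single neighbours instead of pairs;
-- `exists_iterate_of_period` supplies the pairs.
set_option maxRecDepth 100000 in
theorem hub_iterate : ∀ u, (hub.nxt u)^[(hubNeighbors u).length]
      (hubVertex ((hubNeighbors u).headD 0)) = hubVertex ((hubNeighbors u).headD 0) ∧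
    ∀ v, hub.graph.Adj u v → ∃ k < (hubNeighbors u).length,
      (hub.nxt u)^[k] (hubVertex ((hubNeighbors u).headD 0)) = v := by decide

set_option maxRecDepth 100000 in
theorem hub_isPlane : hub.IsPlane where
  adj_nxt h := (hub_nxt _ _ h).1
  nxt_nxt h := (hub_nxt _ _ h).2
  exists_iterate hv hw := exists_iterate_of_period (hub_iterate _).1 ((hub_iterate _).2 _ hv)
    ((hub_iterate _).2 _ hw)
  connected := connected_of_center (hubVertex 40) (by decide)
  adj_corner := by decide
  nxt_corner := by decide
  card_dart := hub_card_dart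

end Hub

section HubCount

/-! In this section `B`, `C`, `G`, `Y` tell which vertices `b i`, `c i`, `g i`, `y i` of the hub are
deleted. A component of the rest is represented by a vertex without remaining neighbours that
precede it. -/

variable (B C G Y : Fin 10 → Bool)

def startY (i : Fin 10) : Bool := !Y i && G (i - 1) && (i == 0 || Y (i - 1))
def startB (i : Fin 10) : Bool := !B i && Y i && G (i - 1)
def startC (i : Fin 10) : Bool := !C i && Y i && B i
def startG (i : Fin 10) : Bool := !G i && Y i && C i && i != 9

/-- The vertex g (i - 1) is charged to block i, since it borders y i and b i. Summation over all
blocks still counts each vertex once. -/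
def deletedNear (i : Fin 10) : ℕ := (G (i - 1)).toNat + (Y i).toNat + (B i).toNat + (C i).toNat

theorem sum_deletedNear : ∑ i, deletedNear B C G Y i =
    ∑ i, ((B i).toNat + (C i).toNat + (G i).toNat + (Y i).toNat) := by
  have : ∑ i, (G (i - 1)).toNat = ∑ i, (G i).toNat :=
    Equiv.sum_comp (Equiv.subRight (1 : Fin 10)) fun i => (G i).toNat
  simp only [deletedNear, Finset.sum_add_distrib, this]
  ring

/-- Discharging between consecutive blocks: a component that starts at y (i + 1) may cost its block
one unit too much. For i ≠ 9 both y i and g i are then deleted, and block i can spare this unit. The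
unit is passed on in the sum; the term for y 9 records a surplus needed when all corners are
deleted. -/
theorem starts_local (i : Fin 10) :
    5 * ((startY G Y i).toNat + (startB B G Y i).toNat + (startC B C Y i).toNat +
      (startG C G Y i).toNat) + excess 7 1 (1 + (B i).toNat + (C i).toNat) +
      (startY G Y (i + 1) && i != 9).toNat + 2 * (Y i && i == 9).toNat ≤
    4 * deletedNear B C G Y i + (startY G Y i).toNat := by
  have h0 : (i + 1 == 0) = (i == 9) := by revert i; decide
  have h9 : (i == 9) = true → (i == 0) = false := by revert i; decide
  have hne : (i != 9) = !(i == 9) := rfl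
  simp only [startY, startB, startC, startG, deletedNear, add_sub_cancel_right, h0, hne]
  clear h0 hne
  generalize G (i - 1) = a, Y (i - 1) = b, Y i = c, B i = d, C i = e, G i = m, Y (i + 1) = n
  revert h9
  generalize (i == 9) = l, (i == 0) = z
  revert l z a b c d e m n
  decide

/-- The 8 on the right pays for p and q. After the transfers cancel, there remain 5 for a component
of g 9 and 1 for a start at y 0. The latter requires that g 9 is deleted, so together they cost at
most 5, which leaves 3. -/
theorem starts_le : 5 * ((!G 9).toNat + ∑ i, ((startY G Y i).toNat + (startB B G Y i).toNat +
      (startC B C Y i).toNat + (startG C G Y i).toNat)) +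
      ∑ i, excess 7 1 (1 + (B i).toNat + (C i).toNat) + 2 * (Y 9).toNat + 3 ≤
    8 + 4 * ∑ i, ((B i).toNat + (C i).toNat + (G i).toNat + (Y i).toNat) := by
  have h := Finset.sum_le_sum fun i (_ : i ∈ Finset.univ) => starts_local B C G Y i
  have h9 : ∑ i : Fin 10, 2 * (Y i && i == 9).toNat = 2 * (Y 9).toNat := by
    rw [Finset.sum_eq_single 9 (by rintro i - hi; simp [hi]) (by simp)]
    simp
  have hs : ∑ i, (startY G Y (i + 1) && i != 9).toNat =
      ∑ i, (startY G Y i && i != 0).toNat := by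
    rw [← Equiv.sum_comp (Equiv.addRight (1 : Fin 10)) fun i => (startY G Y i && i != 0).toNat]
    refine Finset.sum_congr rfl fun i _ => ?_
    have : (i != 9) = (i + 1 != 0) := by revert i; decide
    rw [this]; rfl
  have hs' : ∑ i, (startY G Y i).toNat =
      ∑ i, (startY G Y i && i != 0).toNat + (startY G Y 0).toNat := by
    have : ∑ i : Fin 10, (startY G Y i && i == 0).toNat = (startY G Y 0).toNat := by
      rw [Finset.sum_eq_single 0 (by rintro i - hi; simp [hi]) (by simp)]
      simp
    rw [← this, ← Finset.sum_add_distrib]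
    refine Finset.sum_congr rfl fun i _ => ?_
    have hne : (i != 0) = !(i == 0) := rfl
    rw [hne]
    cases startY G Y i <;> cases (i == 0) <;> rfl
  have h0 : (startY G Y 0).toNat + (!G 9).toNat ≤ 1 := by
    have : (0 : Fin 10) - 1 = 9 := by decide
    simp only [startY, this]
    cases Y 0 <;> cases G 9 <;> simp
  simp only [Finset.sum_add_distrib, ← Finset.mul_sum, sum_deletedNear] at h h9 hs hs' ⊢
  omega

theorem starts_le' (h9 : Y 9 = true) :
    5 * ((!G 9).toNat + ∑ i, ((startY G Y i).toNat + (startB B G Y i).toNat +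
      (startC B C Y i).toNat + (startG C G Y i).toNat)) +
      ∑ i, excess 7 1 (1 + (B i).toNat + (C i).toNat) + 5 ≤
    8 + 4 * ∑ i, ((B i).toNat + (C i).toNat + (G i).toNat + (Y i).toNat) := by
  have := starts_le B C G Y
  rw [h9] at this
  simp only [Bool.toNat_true] at this
  omega

/-- This is for the case that q remains: all remaining y i then belong to the component of q, so g i
starts a component only if y (i + 1) is deleted as well. -/
def startG' (i : Fin 10) : Bool := startG C G Y i && Y (i + 1)

theorem starts_local' (i : Fin 10) :
    5 * ((startB B G Y i).toNat + (startC B C Y i).toNat + (startG' C G Y i).toNat) +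
      excess 7 1 (1 + (B i).toNat + (C i).toNat) ≤ 4 * deletedNear B C G Y i ∧
    (5 * ((startB B G Y i).toNat + (startC B C Y i).toNat + (startG' C G Y i).toNat) +
      excess 7 1 (1 + (B i).toNat + (C i).toNat) = 4 * deletedNear B C G Y i →
      (i = 9 ∨ Y (i + 1) = false) → deletedNear B C G Y i = 0) := by
  have hne : (i != 9) = !(i == 9) := rfl
  have h9 : i = 9 ↔ (i == 9) = true := by simp
  simp only [startB, startC, startG', startG, deletedNear, hne, h9]
  generalize (i == 9) = l
  generalize G (i - 1) = a, Y i = c, B i = d, C i = e, G i = m, Y (i + 1) = n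
  revert l a c d e m n
  decide

/-- One unit has to be saved somewhere. If every block were tight, then block 9 would have no
deleted vertex; hence y 9 remains, so block 8 has none either, and so on down to block 0, although
something is deleted. -/
theorem starts_le_of_remaining (hpos : 0 < ∑ i, deletedNear B C G Y i) :
    5 * (1 + ∑ i, ((startB B G Y i).toNat + (startC B C Y i).toNat +
      (startG' C G Y i).toNat)) + ∑ i, excess 7 1 (1 + (B i).toNat + (C i).toNat) ≤
    4 + 4 * ∑ i, deletedNear B C G Y i := by
  have hle := Finset.sum_le_sum fun i (_ : i ∈ Finset.univ) => (starts_local' B C G Y i).1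
  simp only [Finset.sum_add_distrib, ← Finset.mul_sum] at hle ⊢
  by_contra hlt
  have heq := (Finset.sum_eq_sum_iff_of_le fun i (_ : i ∈ Finset.univ) =>
    (starts_local' B C G Y i).1).mp (by
      simp only [Finset.sum_add_distrib, ← Finset.mul_sum]
      omega)
  have hzero : ∀ n : ℕ, ∀ hn : n < 10, deletedNear B C G Y ⟨9 - n, by omega⟩ = 0 := by
    intro n
    induction n with
    | zero =>
      intro _
      exact (starts_local' B C G Y _).2 (heq _ (Finset.mem_univ _)) (Or.inl rfl)
    | succ n ih =>
      intro hn
      refine (starts_local' B C G Y _).2 (heq _ (Finset.mem_univ _)) (Or.inr ?_)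
      have h1 := ih (by omega)
      have h2 : (⟨9 - (n + 1), by omega⟩ : Fin 10) + 1 = ⟨9 - n, by omega⟩ := by
        ext
        simp only [Fin.val_add]
        change (9 - (n + 1) + 1) % 10 = 9 - n
        omega
      rw [h2]
      unfold deletedNear at h1
      have h3 : (Y ⟨9 - n, by omega⟩).toNat = 0 := by omega
      simpa using h3
  refine hpos.ne' (Finset.sum_eq_zero fun i _ => ?_)
  have := hzero (9 - i.1) (by omega)
  have h2 : (⟨9 - (9 - i.1), by omega⟩ : Fin 10) = i := by ext; simp; omega
  rwa [h2] at this

/-- This is for the case that p remains and q is deleted: the ring around p lies in one component,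
and y i forms or starts another only if all its neighbours in the ring are deleted. -/
def isolatedY (i : Fin 10) : Bool := !Y i && G (i - 1) && B i && C i && G i

theorem isolated_local (i : Fin 10) :
    5 * (isolatedY B C G Y i).toNat + excess 7 1 ((B i).toNat + (C i).toNat) +
      deletedNear B C G Y i + 3 * (Y i).toNat + 2 * (isolatedY B C G Y i).toNat ≤
        4 * deletedNear B C G Y i ∧
    2 * excess 7 1 ((B i).toNat + (C i).toNat) ≤ deletedNear B C G Y i := by
  simp only [isolatedY, deletedNear]
  generalize G (i - 1) = a, Y i = c, B i = d, C i = e, G i = m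
  revert a c d e m
  decide

theorem isolated_le (hpos : 0 < ∑ i, deletedNear B C G Y i) :
    5 * (1 + ∑ i, (isolatedY B C G Y i).toNat) + ∑ i, excess 7 1 ((B i).toNat + (C i).toNat) ≤
    4 + 4 * ∑ i, deletedNear B C G Y i := by
  have h := Finset.sum_le_sum fun i (_ : i ∈ Finset.univ) => (isolated_local B C G Y i).1
  simp only [Finset.sum_add_distrib, ← Finset.mul_sum] at h ⊢
  omega

theorem isolated_le' (h8 : Y 8 = true) (h9 : Y 9 = true) :
    5 * (1 + ∑ i, (isolatedY B C G Y i).toNat) + ∑ i, excess 7 1 ((B i).toNat + (C i).toNat) + 5 ≤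
    4 + 4 * ∑ i, deletedNear B C G Y i := by
  have h := Finset.sum_le_sum fun i (_ : i ∈ Finset.univ) => (isolated_local B C G Y i).1
  have hY : 2 ≤ ∑ i, (Y i).toNat := by
    have := Finset.sum_le_sum_of_subset (f := fun i => (Y i).toNat)
      (Finset.subset_univ ({8, 9} : Finset (Fin 10)))
    rw [Finset.sum_pair (by decide)] at this
    simpa [h8, h9] using this
  simp only [Finset.sum_add_distrib, ← Finset.mul_sum] at h ⊢
  omega

theorem two_excess_le :
    2 * ∑ i, excess 7 1 ((B i).toNat + (C i).toNat) ≤ ∑ i, deletedNear B C G Y i := by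
  rw [Finset.mul_sum]
  exact Finset.sum_le_sum fun i _ => (isolated_local B C G Y i).2

end HubCount

section HubVertices

def hubB (i : Fin 10) : Fin 3 ⊕ Fin 39 := hubVertex (4 * i.1)
def hubC (i : Fin 10) : Fin 3 ⊕ Fin 39 := hubVertex (4 * i.1 + 1)
def hubG (i : Fin 10) : Fin 3 ⊕ Fin 39 := hubVertex (4 * i.1 + 2)
def hubY (i : Fin 10) : Fin 3 ⊕ Fin 39 := hubVertex (4 * i.1 + 3)
def hubP : Fin 3 ⊕ Fin 39 := hubVertex 40
def hubQ : Fin 3 ⊕ Fin 39 := hubVertex 41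

theorem hub_adj_ring : ∀ i : Fin 10, hub.graph.Adj (hubB i) (hubC i) ∧
    hub.graph.Adj (hubC i) (hubG i) ∧ hub.graph.Adj (hubB i) (hubG (i - 1)) ∧
    hub.graph.Adj (hubB i) hubP ∧ hub.graph.Adj (hubC i) hubP ∧ hub.graph.Adj (hubG i) hubP := by
  decide

theorem hub_adj_outer : ∀ i : Fin 10, hub.graph.Adj (hubB i) (hubY i) ∧
    hub.graph.Adj (hubC i) (hubY i) ∧ hub.graph.Adj (hubG i) (hubY i) ∧
    hub.graph.Adj (hubY i) (hubG (i - 1)) ∧ hub.graph.Adj (hubY i) hubQ ∧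
    (i ≠ 0 → hub.graph.Adj (hubY i) (hubY (i - 1))) ∧
    (i ≠ 9 → hub.graph.Adj (hubG i) (hubY (i + 1))) := by
  decide

theorem hub_adj_nine : hub.graph.Adj (hubG 9) hubQ := by decide

theorem hub_cases : ∀ v, v = hubP ∨ v = hubQ ∨
    ∃ i, v = hubB i ∨ v = hubC i ∨ v = hubG i ∨ v = hubY i := by
  decide

def hubFace (i : Fin 10) : Fin 3 ↪ Fin 3 ⊕ Fin 39 where
  toFun := ![hubB i, hubC i, hubP]
  inj' := by revert i; decide

set_option maxRecDepth 100000 in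
theorem isFaces_hubFace : hub.IsFaces hubFace :=
  ⟨by decide, by decide, by decide, by decide⟩

def hubLabel : Fin 10 × Fin 4 ⊕ Fin 2 → Fin 3 ⊕ Fin 39
  | .inl (i, k) => hubVertex (4 * i.1 + k.1)
  | .inr k => hubVertex (40 + k.1)

set_option maxRecDepth 100000 in
theorem hubLabel_bijective : Function.Bijective hubLabel :=
  ⟨by decide, by decide⟩

theorem hub_sum (F : Fin 3 ⊕ Fin 39 → ℕ) : ∑ u, F u =
    F hubP + F hubQ + ∑ i, (F (hubB i) + F (hubC i) + F (hubG i) + F (hubY i)) := by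
  rw [← Equiv.sum_comp (Equiv.ofBijective _ hubLabel_bijective), Fintype.sum_sum_type,
    Fintype.sum_prod_type, Fin.sum_univ_two, add_comm]
  refine congrArg₂ _ rfl (Finset.sum_congr rfl fun i _ => ?_)
  rw [Fin.sum_univ_four]
  rfl

end HubVertices

section HubTough

theorem card_le_of_reach {V : Type*} {G : SimpleGraph V} {X J St : Finset V}
    (hJ : ∀ u ∈ J, u ∉ X) (hsep : ∀ u ∈ J, ∀ v ∈ J, G.ReachAvoiding X u v → u = v)
    (h : ∀ v, v ∉ X → ∃ s ∈ St, G.ReachAvoiding X v s) : J.card ≤ St.card := by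
  classical
  choose! s hs hr using h
  refine Finset.card_le_card_of_injOn s (fun u hu => hs u (hJ u hu)) fun u hu v hv huv => ?_
  exact hsep u hu v hv ((hr u (hJ u hu)).trans (huv ▸ (hr v (hJ v hv)).symm))

theorem card_ite_singleton {V : Type*} (b : Bool) (v : V) :
    (if b then {v} else ∅ : Finset V).card = b.toNat := by
  cases b <;> rfl

variable {X J : Finset (Fin 3 ⊕ Fin 39)} (hJ : ∀ u ∈ J, u ∉ X)
  (hsep : ∀ u ∈ J, ∀ v ∈ J, hub.graph.ReachAvoiding X u v → u = v)
  (B C G Y : Fin 10 → Bool) (hB : ∀ i, B i = true ↔ hubB i ∈ X) (hC : ∀ i, C i = true ↔ hubC i ∈ X)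
  (hG : ∀ i, G i = true ↔ hubG i ∈ X) (hY : ∀ i, Y i = true ↔ hubY i ∈ X)
include hJ hsep hB hC hG hY

/-- The vertices are scanned in the order g 9, then y i, b i, c i, g i for increasing i. A remaining
vertex is a start or has an earlier remaining neighbour, so by induction it is connected to a start.
-/
theorem hub_card_le_starts (hP : hubP ∈ X) (hQ : hubQ ∈ X) :
    J.card ≤ (!G 9).toNat + ∑ i, ((startY G Y i).toNat + (startB B G Y i).toNat +
      (startC B C Y i).toNat + (startG C G Y i).toNat) := by
  classical
  set St : Finset (Fin 3 ⊕ Fin 39) := (if !G 9 then {hubG 9} else ∅) ∪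
    Finset.univ.biUnion fun i => ((if startY G Y i then {hubY i} else ∅) ∪
      (if startB B G Y i then {hubB i} else ∅) ∪ (if startC B C Y i then {hubC i} else ∅) ∪
      (if startG C G Y i then {hubG i} else ∅)) with hSt
  have hcard : St.card ≤ (!G 9).toNat + ∑ i, ((startY G Y i).toNat + (startB B G Y i).toNat +
      (startC B C Y i).toNat + (startG C G Y i).toNat) := by
    refine (Finset.card_union_le _ _).trans (Nat.add_le_add (card_ite_singleton _ _).le
      (Finset.card_biUnion_le.trans (Finset.sum_le_sum fun i _ => ?_)))
    refine (Finset.card_union_le _ _).trans (Nat.add_le_add ((Finset.card_union_le _ _).trans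
      (Nat.add_le_add ((Finset.card_union_le _ _).trans (Nat.add_le_add ?_ ?_)) ?_)) ?_) <;>
    exact (card_ite_singleton _ _).le
  refine (card_le_of_reach hJ hsep ?_).trans hcard
  have mem : ∀ i v, (startY G Y i = true ∧ v = hubY i) ∨ (startB B G Y i = true ∧ v = hubB i) ∨
      (startC B C Y i = true ∧ v = hubC i) ∨ (startG C G Y i = true ∧ v = hubG i) →
      ∃ s ∈ St, hub.graph.ReachAvoiding X v s := by
    intro i v hv
    refine ⟨v, Finset.mem_union_right _ (Finset.mem_biUnion.mpr ⟨i, Finset.mem_univ _, ?_⟩),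
      .refl _⟩
    rcases hv with ⟨h, rfl⟩ | ⟨h, rfl⟩ | ⟨h, rfl⟩ | ⟨h, rfl⟩ <;> simp [h]
  have step : ∀ {u v}, hub.graph.Adj u v → u ∉ X → v ∉ X →
      (∃ s ∈ St, hub.graph.ReachAvoiding X v s) → ∃ s ∈ St, hub.graph.ReachAvoiding X u s :=
    fun ha hu hv ⟨s, hs, hr⟩ => ⟨s, hs, (ReachAvoiding.of_adj ha hu hv).trans hr⟩
  have h9 : hubG 9 ∉ X → ∃ s ∈ St, hub.graph.ReachAvoiding X (hubG 9) s := by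
    intro h
    refine ⟨_, Finset.mem_union_left _ ?_, .refl _⟩
    rw [← hG, Bool.not_eq_true] at h
    simp [h]
  have block : ∀ i : Fin 10,
      (hubG (i - 1) ∉ X → ∃ s ∈ St, hub.graph.ReachAvoiding X (hubG (i - 1)) s) →
      (i ≠ 0 → hubY (i - 1) ∉ X → ∃ s ∈ St, hub.graph.ReachAvoiding X (hubY (i - 1)) s) →
      (hubY i ∉ X → ∃ s ∈ St, hub.graph.ReachAvoiding X (hubY i) s) ∧
      (hubB i ∉ X → ∃ s ∈ St, hub.graph.ReachAvoiding X (hubB i) s) ∧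
      (hubC i ∉ X → ∃ s ∈ St, hub.graph.ReachAvoiding X (hubC i) s) ∧
      (hubG i ∉ X → ∃ s ∈ St, hub.graph.ReachAvoiding X (hubG i) s) := by
    intro i hgp hyp
    obtain ⟨r1, r2, r3, r4, r5, r6⟩ := hub_adj_ring i
    obtain ⟨o1, o2, o3, o4, o5, o6, o7⟩ := hub_adj_outer i
    have y1 : hubY i ∉ X → ∃ s ∈ St, hub.graph.ReachAvoiding X (hubY i) s := by
      intro h
      by_cases hg : hubG (i - 1) ∈ X
      · by_cases hi : i = 0
        · refine mem i _ (Or.inl ⟨?_, rfl⟩)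
          rw [← hY, Bool.not_eq_true] at h
          rw [← hG] at hg
          rw [hi] at h hg
          simpa [startY, hi] using ⟨h, hg⟩
        · by_cases hy : hubY (i - 1) ∈ X
          · refine mem i _ (Or.inl ⟨?_, rfl⟩)
            rw [← hY, Bool.not_eq_true] at h
            rw [← hG] at hg
            rw [← hY] at hy
            simp [startY, h, hg, hy]
          · exact step (o6 hi) h hy (hyp hi hy)
      · exact step o4 h hg (hgp hg)
    have b1 : hubB i ∉ X → ∃ s ∈ St, hub.graph.ReachAvoiding X (hubB i) s := by
      intro h
      by_cases hy : hubY i ∈ X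
      · by_cases hg : hubG (i - 1) ∈ X
        · refine mem i _ (Or.inr (Or.inl ⟨?_, rfl⟩))
          rw [← hB, Bool.not_eq_true] at h
          rw [← hG] at hg
          rw [← hY] at hy
          simp [startB, h, hg, hy]
        · exact step r3 h hg (hgp hg)
      · exact step o1 h hy (y1 hy)
    have c1 : hubC i ∉ X → ∃ s ∈ St, hub.graph.ReachAvoiding X (hubC i) s := by
      intro h
      by_cases hy : hubY i ∈ X
      · by_cases hb : hubB i ∈ X
        · refine mem i _ (Or.inr (Or.inr (Or.inl ⟨?_, rfl⟩)))
          rw [← hC, Bool.not_eq_true] at h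
          rw [← hB] at hb
          rw [← hY] at hy
          simp [startC, h, hb, hy]
        · exact step r1.symm h hb (b1 hb)
      · exact step o2 h hy (y1 hy)
    refine ⟨y1, b1, c1, fun h => ?_⟩
    by_cases hi : i = 9
    · rw [hi] at h ⊢
      exact h9 h
    by_cases hy : hubY i ∈ X
    · by_cases hc : hubC i ∈ X
      · refine mem i _ (Or.inr (Or.inr (Or.inr ⟨?_, rfl⟩)))
        rw [← hG, Bool.not_eq_true] at h
        rw [← hC] at hc
        rw [← hY] at hy
        simp [startG, h, hc, hy, hi]
      · exact step r2.symm h hc (c1 hc)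
    · exact step o3 h hy (y1 hy)
  have all : ∀ n : ℕ, ∀ hn : n < 10,
      (hubY ⟨n, hn⟩ ∉ X → ∃ s ∈ St, hub.graph.ReachAvoiding X (hubY ⟨n, hn⟩) s) ∧
      (hubB ⟨n, hn⟩ ∉ X → ∃ s ∈ St, hub.graph.ReachAvoiding X (hubB ⟨n, hn⟩) s) ∧
      (hubC ⟨n, hn⟩ ∉ X → ∃ s ∈ St, hub.graph.ReachAvoiding X (hubC ⟨n, hn⟩) s) ∧
      (hubG ⟨n, hn⟩ ∉ X → ∃ s ∈ St, hub.graph.ReachAvoiding X (hubG ⟨n, hn⟩) s) := by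
    intro n
    induction n with
    | zero =>
      intro hn
      exact block 0 h9 fun h => absurd rfl h
    | succ n ih =>
      intro hn
      have he : (⟨n + 1, hn⟩ : Fin 10) - 1 = ⟨n, by omega⟩ := by
        rw [sub_eq_iff_eq_add]
        ext
        rw [Fin.val_add]
        change n + 1 = (n + 1) % 10
        omega
      refine block _ ?_ ?_ <;> rw [he]
      · exact (ih (by omega)).2.2.2
      · exact fun _ => (ih (by omega)).1
  intro v hv
  rcases hub_cases v with rfl | rfl | ⟨i, rfl | rfl | rfl | rfl⟩
  · exact absurd hP hv
  · exact absurd hQ hv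
  · exact (all i.1 i.2).2.1 hv
  · exact (all i.1 i.2).2.2.1 hv
  · exact (all i.1 i.2).2.2.2 hv
  · exact (all i.1 i.2).1 hv

theorem hub_card_le_starts' (hP : hubP ∈ X) (hQ : hubQ ∉ X) :
    J.card ≤ 1 + ∑ i, ((startB B G Y i).toNat + (startC B C Y i).toNat +
      (startG' C G Y i).toNat) := by
  classical
  set St : Finset (Fin 3 ⊕ Fin 39) := {hubQ} ∪
    Finset.univ.biUnion fun i => ((if startB B G Y i then {hubB i} else ∅) ∪
      (if startC B C Y i then {hubC i} else ∅) ∪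
      (if startG' C G Y i then {hubG i} else ∅)) with hSt
  have hcard : St.card ≤ 1 + ∑ i, ((startB B G Y i).toNat +
      (startC B C Y i).toNat + (startG' C G Y i).toNat) := by
    refine (Finset.card_union_le _ _).trans (Nat.add_le_add (Finset.card_singleton _).le
      (Finset.card_biUnion_le.trans (Finset.sum_le_sum fun i _ => ?_)))
    refine (Finset.card_union_le _ _).trans (Nat.add_le_add ((Finset.card_union_le _ _).trans
      (Nat.add_le_add ?_ ?_)) ?_) <;>
    exact (card_ite_singleton _ _).le
  refine (card_le_of_reach hJ hsep ?_).trans hcard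
  have mem : ∀ i v, (startB B G Y i = true ∧ v = hubB i) ∨
      (startC B C Y i = true ∧ v = hubC i) ∨ (startG' C G Y i = true ∧ v = hubG i) →
      ∃ s ∈ St, hub.graph.ReachAvoiding X v s := by
    intro i v hv
    refine ⟨v, Finset.mem_union_right _ (Finset.mem_biUnion.mpr ⟨i, Finset.mem_univ _, ?_⟩),
      .refl _⟩
    rcases hv with ⟨h, rfl⟩ | ⟨h, rfl⟩ | ⟨h, rfl⟩ <;> simp [h]
  have step : ∀ {u v}, hub.graph.Adj u v → u ∉ X → v ∉ X →
      (∃ s ∈ St, hub.graph.ReachAvoiding X v s) → ∃ s ∈ St, hub.graph.ReachAvoiding X u s :=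
    fun ha hu hv ⟨s, hs, hr⟩ => ⟨s, hs, (ReachAvoiding.of_adj ha hu hv).trans hr⟩
  have hq : ∃ s ∈ St, hub.graph.ReachAvoiding X hubQ s :=
    ⟨hubQ, Finset.mem_union_left _ (Finset.mem_singleton_self _), .refl _⟩
  have y1 : ∀ i, hubY i ∉ X → ∃ s ∈ St, hub.graph.ReachAvoiding X (hubY i) s := fun i h =>
    step (hub_adj_outer i).2.2.2.2.1 h hQ hq
  have h9 : hubG 9 ∉ X → ∃ s ∈ St, hub.graph.ReachAvoiding X (hubG 9) s := fun h =>
    step hub_adj_nine h hQ hq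
  have block : ∀ i : Fin 10,
      (hubG (i - 1) ∉ X → ∃ s ∈ St, hub.graph.ReachAvoiding X (hubG (i - 1)) s) →
      (hubB i ∉ X → ∃ s ∈ St, hub.graph.ReachAvoiding X (hubB i) s) ∧
      (hubC i ∉ X → ∃ s ∈ St, hub.graph.ReachAvoiding X (hubC i) s) ∧
      (hubG i ∉ X → ∃ s ∈ St, hub.graph.ReachAvoiding X (hubG i) s) := by
    intro i hgp
    obtain ⟨r1, r2, r3, r4, r5, r6⟩ := hub_adj_ring i
    obtain ⟨o1, o2, o3, o4, o5, o6, o7⟩ := hub_adj_outer i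
    have b1 : hubB i ∉ X → ∃ s ∈ St, hub.graph.ReachAvoiding X (hubB i) s := by
      intro h
      by_cases hy : hubY i ∈ X
      · by_cases hg : hubG (i - 1) ∈ X
        · refine mem i _ (Or.inl ⟨?_, rfl⟩)
          rw [← hB, Bool.not_eq_true] at h
          rw [← hG] at hg
          rw [← hY] at hy
          simp [startB, h, hg, hy]
        · exact step r3 h hg (hgp hg)
      · exact step o1 h hy (y1 i hy)
    have c1 : hubC i ∉ X → ∃ s ∈ St, hub.graph.ReachAvoiding X (hubC i) s := by
      intro h
      by_cases hy : hubY i ∈ X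
      · by_cases hb : hubB i ∈ X
        · refine mem i _ (Or.inr (Or.inl ⟨?_, rfl⟩))
          rw [← hC, Bool.not_eq_true] at h
          rw [← hB] at hb
          rw [← hY] at hy
          simp [startC, h, hb, hy]
        · exact step r1.symm h hb (b1 hb)
      · exact step o2 h hy (y1 i hy)
    refine ⟨b1, c1, fun h => ?_⟩
    by_cases hi : i = 9
    · rw [hi] at h ⊢
      exact h9 h
    by_cases hy : hubY i ∈ X
    · by_cases hc : hubC i ∈ X
      · by_cases hy' : hubY (i + 1) ∈ X
        · refine mem i _ (Or.inr (Or.inr ⟨?_, rfl⟩))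
          rw [← hG, Bool.not_eq_true] at h
          rw [← hC] at hc
          rw [← hY] at hy hy'
          simp [startG', startG, h, hc, hy, hy', hi]
        · exact step (o7 hi) h hy' (y1 _ hy')
      · exact step r2.symm h hc (c1 hc)
    · exact step o3 h hy (y1 i hy)
  have all : ∀ n : ℕ, ∀ hn : n < 10,
      (hubB ⟨n, hn⟩ ∉ X → ∃ s ∈ St, hub.graph.ReachAvoiding X (hubB ⟨n, hn⟩) s) ∧
      (hubC ⟨n, hn⟩ ∉ X → ∃ s ∈ St, hub.graph.ReachAvoiding X (hubC ⟨n, hn⟩) s) ∧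
      (hubG ⟨n, hn⟩ ∉ X → ∃ s ∈ St, hub.graph.ReachAvoiding X (hubG ⟨n, hn⟩) s) := by
    intro n
    induction n with
    | zero =>
      intro hn
      exact block 0 h9
    | succ n ih =>
      intro hn
      have he : (⟨n + 1, hn⟩ : Fin 10) - 1 = ⟨n, by omega⟩ := by
        rw [sub_eq_iff_eq_add]
        ext
        rw [Fin.val_add]
        change n + 1 = (n + 1) % 10
        omega
      refine block _ ?_
      rw [he]
      exact (ih (by omega)).2.2
  intro v hv
  rcases hub_cases v with rfl | rfl | ⟨i, rfl | rfl | rfl | rfl⟩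
  · exact absurd hP hv
  · exact hq
  · exact (all i.1 i.2).1 hv
  · exact (all i.1 i.2).2.1 hv
  · exact (all i.1 i.2).2.2 hv
  · exact y1 i hv

theorem hub_card_le_isolated (hP : hubP ∉ X) (hQ : hubQ ∈ X) :
    J.card ≤ 1 + ∑ i, (isolatedY B C G Y i).toNat := by
  classical
  set St : Finset (Fin 3 ⊕ Fin 39) := {hubP} ∪
    Finset.univ.biUnion fun i => (if isolatedY B C G Y i then {hubY i} else ∅) with hSt
  have hcard : St.card ≤ 1 + ∑ i, (isolatedY B C G Y i).toNat :=
    (Finset.card_union_le _ _).trans (Nat.add_le_add (Finset.card_singleton _).le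
      (Finset.card_biUnion_le.trans (Finset.sum_le_sum fun i _ => (card_ite_singleton _ _).le)))
  refine (card_le_of_reach hJ hsep ?_).trans hcard
  have hp : ∀ {v}, hub.graph.Adj v hubP → v ∉ X → ∃ s ∈ St, hub.graph.ReachAvoiding X v s :=
    fun ha hv => ⟨hubP, Finset.mem_union_left _ (Finset.mem_singleton_self _), .of_adj ha hv hP⟩
  have step : ∀ {u v}, hub.graph.Adj u v → hub.graph.Adj v hubP → u ∉ X → v ∉ X →
      ∃ s ∈ St, hub.graph.ReachAvoiding X u s := fun ha ha' hu hv => by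
    obtain ⟨s, hs, hr⟩ := hp ha' hv
    exact ⟨s, hs, (ReachAvoiding.of_adj ha hu hv).trans hr⟩
  intro v hv
  rcases hub_cases v with rfl | rfl | ⟨i, hi⟩
  · exact ⟨hubP, Finset.mem_union_left _ (Finset.mem_singleton_self _), .refl _⟩
  · exact absurd hQ hv
  obtain ⟨r1, r2, r3, r4, r5, r6⟩ := hub_adj_ring i
  obtain ⟨o1, o2, o3, o4, o5, o6, o7⟩ := hub_adj_outer i
  rcases hi with rfl | rfl | rfl | rfl
  · exact hp r4 hv
  · exact hp r5 hv
  · exact hp r6 hv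
  · by_cases hg : hubG (i - 1) ∈ X
    · by_cases hb : hubB i ∈ X
      · by_cases hc : hubC i ∈ X
        · by_cases hg' : hubG i ∈ X
          · refine ⟨hubY i, Finset.mem_union_right _
              (Finset.mem_biUnion.mpr ⟨i, Finset.mem_univ _, ?_⟩), .refl _⟩
            rw [← hY, Bool.not_eq_true] at hv
            rw [← hG] at hg hg'
            rw [← hB] at hb
            rw [← hC] at hc
            simp [isolatedY, hv, hg, hg', hb, hc]
          · exact step o3.symm r6 hv hg'
        · exact step o2.symm r5 hv hc
      · exact step o1.symm r4 hv hb
    · exact step o4 (hub_adj_ring _).2.2.2.2.2 hv hg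

omit hC hG in
/-- If both poles remain, then they are in the same component, or many vertices are deleted. -/
theorem hub_card_le_poles (hP : hubP ∉ X) (hQ : hubQ ∉ X) :
    J.card ≤ 1 ∨ (J.card ≤ 2 ∧ 10 ≤ ∑ i, deletedNear B C G Y i) := by
  classical
  have hp : ∀ i, (hubB i ∉ X → hub.graph.ReachAvoiding X (hubB i) hubP) ∧
      (hubC i ∉ X → hub.graph.ReachAvoiding X (hubC i) hubP) ∧
      (hubG i ∉ X → hub.graph.ReachAvoiding X (hubG i) hubP) := fun i => by
    obtain ⟨r1, r2, r3, r4, r5, r6⟩ := hub_adj_ring i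
    exact ⟨fun h => .of_adj r4 h hP, fun h => .of_adj r5 h hP, fun h => .of_adj r6 h hP⟩
  have hq : ∀ i, hubY i ∉ X → hub.graph.ReachAvoiding X (hubY i) hubQ := fun i h =>
    .of_adj (hub_adj_outer i).2.2.2.2.1 h hQ
  have hall : ∀ v, v ∉ X → ∃ s ∈ ({hubP, hubQ} : Finset _), hub.graph.ReachAvoiding X v s := by
    intro v hv
    rcases hub_cases v with rfl | rfl | ⟨i, rfl | rfl | rfl | rfl⟩
    · exact ⟨hubP, by simp, .refl _⟩
    · exact ⟨hubQ, by simp, .refl _⟩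
    · exact ⟨hubP, by simp, (hp i).1 hv⟩
    · exact ⟨hubP, by simp, (hp i).2.1 hv⟩
    · exact ⟨hubP, by simp, (hp i).2.2 hv⟩
    · exact ⟨hubQ, by simp, hq i hv⟩
  by_cases hpq : hub.graph.ReachAvoiding X hubP hubQ
  · left
    have := card_le_of_reach (St := {hubQ}) hJ hsep fun v hv => by
      obtain ⟨s, hs, hr⟩ := hall v hv
      refine ⟨hubQ, by simp, ?_⟩
      rw [Finset.mem_insert, Finset.mem_singleton] at hs
      rcases hs with rfl | rfl
      · exact hr.trans hpq
      · exact hr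
    simpa using this
  · right
    refine ⟨(card_le_of_reach hJ hsep hall).trans Finset.card_le_two, ?_⟩
    have h1 : ∀ i ∈ (Finset.univ : Finset (Fin 10)), 1 ≤ deletedNear B C G Y i := by
      intro i _
      by_cases hy : hubY i ∈ X
      · rw [← hY] at hy
        simp only [deletedNear, hy, Bool.toNat_true]
        omega
      · have hb : hubB i ∈ X := by
          by_contra hb
          exact hpq (((hp i).1 hb).symm.trans
            ((ReachAvoiding.of_adj (hub_adj_outer i).1 hb hy).trans (hq i hy)))
        rw [← hB] at hb
        simp only [deletedNear, hb, Bool.toNat_true]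
        omega
    have := Finset.card_nsmul_le_sum _ _ _ h1
    simpa using this

end HubTough

open Classical in
-- The four cases say which of the poles p and q are deleted. The margin 5 in the second claim comes
-- from the deleted corners q, y 8, y 9.
theorem hub_count {X J : Finset (Fin 3 ⊕ Fin 39)} (hJ : ∀ u ∈ J, u ∉ X)
    (hsep : ∀ u ∈ J, ∀ v ∈ J, hub.graph.ReachAvoiding X u v → u = v) (hX : 2 ≤ X.card) :
    5 * J.card + ∑ s, excess 7 1 (faceCorners hubFace X s) ≤ 4 * X.card ∧
    ((∀ i, Sum.inl i ∈ X) →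
      5 * J.card + 5 + ∑ s, excess 7 1 (faceCorners hubFace X s) ≤ 4 * X.card) := by
  set v : Fin 3 ⊕ Fin 39 → Bool := fun u => decide (u ∈ X) with hv
  have hv' : ∀ u, v u = true ↔ u ∈ X := fun u => by simp [hv]
  set B := fun i => v (hubB i)
  set C := fun i => v (hubC i)
  set G := fun i => v (hubG i)
  set Y := fun i => v (hubY i)
  have hcard : X.card = (v hubP).toNat + (v hubQ).toNat + ∑ i, deletedNear B C G Y i := by
    rw [card_eq_sum_toNat X v hv', hub_sum, sum_deletedNear]
  have hface : ∀ s, faceCorners hubFace X s = (v hubP).toNat + (B s).toNat + (C s).toNat := by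
    intro s
    rw [faceCorners_eq_sum hubFace X v hv', Fin.sum_univ_three]
    change (v (hubB s)).toNat + (v (hubC s)).toNat + (v hubP).toNat = _
    ring
  simp only [hface]
  have hcor : (∀ i, Sum.inl i ∈ X) → hubQ ∈ X ∧ Y 8 = true ∧ Y 9 = true := by
    intro h
    have e0 : hubQ = Sum.inl 0 := by decide
    have e1 : hubY 8 = Sum.inl 1 := by decide
    have e2 : hubY 9 = Sum.inl 2 := by decide
    refine ⟨e0 ▸ h 0, (hv' _).mpr (e1 ▸ h 1), (hv' _).mpr (e2 ▸ h 2)⟩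
  by_cases hP : hubP ∈ X <;> by_cases hQ : hubQ ∈ X
  · have h1 := hub_card_le_starts hJ hsep B C G Y (fun i => hv' _) (fun i => hv' _)
      (fun i => hv' _) (fun i => hv' _) hP hQ
    rw [hcard, (hv' _).mpr hP, (hv' _).mpr hQ, Bool.toNat_true]
    refine ⟨?_, fun h => ?_⟩
    · have h2 := starts_le B C G Y
      rw [← sum_deletedNear B C G Y] at h2
      omega
    · have h2 := starts_le' B C G Y (hcor h).2.2
      rw [← sum_deletedNear B C G Y] at h2
      omega
  · have h1 := hub_card_le_starts' hJ hsep B C G Y (fun i => hv' _) (fun i => hv' _)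
      (fun i => hv' _) (fun i => hv' _) hP hQ
    have hQ' : v hubQ = false := by rw [← Bool.not_eq_true, hv']; exact hQ
    rw [hcard, (hv' _).mpr hP, hQ', Bool.toNat_true, Bool.toNat_false] at hX ⊢
    have h2 := starts_le_of_remaining B C G Y (by omega)
    exact ⟨by omega, fun h => absurd (hcor h).1 hQ⟩
  · have h1 := hub_card_le_isolated hJ hsep B C G Y (fun i => hv' _) (fun i => hv' _)
      (fun i => hv' _) (fun i => hv' _) hP hQ
    have hP' : v hubP = false := by rw [← Bool.not_eq_true, hv']; exact hP
    rw [hcard, (hv' _).mpr hQ, hP', Bool.toNat_true, Bool.toNat_false] at hX ⊢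
    simp only [zero_add]
    refine ⟨?_, fun h => ?_⟩
    · have h2 := isolated_le B C G Y (by omega)
      omega
    · have h2 := isolated_le' B C G Y (hcor h).2.1 (hcor h).2.2
      omega
  · have h1 := hub_card_le_poles hJ hsep B C G Y (fun i => hv' _) (fun i => hv' _) hP hQ
    have hP' : v hubP = false := by rw [← Bool.not_eq_true, hv']; exact hP
    have hQ' : v hubQ = false := by rw [← Bool.not_eq_true, hv']; exact hQ
    rw [hcard, hQ', hP', Bool.toNat_false] at hX ⊢
    simp only [zero_add] at hX ⊢
    have h2 := two_excess_le B C G Y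
    exact ⟨by omega, fun h => absurd (hcor h).1 hQ⟩

theorem hub_card_le_one {X J : Finset (Fin 3 ⊕ Fin 39)} (hJ : ∀ u ∈ J, u ∉ X)
    (hsep : ∀ u ∈ J, ∀ v ∈ J, hub.graph.ReachAvoiding X u v → u = v) (hX : X.card ≤ 1) :
    J.card ≤ 1 := by
  classical
  set v : Fin 3 ⊕ Fin 39 → Bool := fun u => decide (u ∈ X) with hv
  have hv' : ∀ u, v u = true ↔ u ∈ X := fun u => by simp [hv]
  set B := fun i => v (hubB i)
  set C := fun i => v (hubC i)
  set G := fun i => v (hubG i)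
  set Y := fun i => v (hubY i)
  have hcard : X.card = (v hubP).toNat + (v hubQ).toNat + ∑ i, deletedNear B C G Y i := by
    rw [card_eq_sum_toNat X v hv', hub_sum, sum_deletedNear]
  by_cases hP : hubP ∈ X <;> by_cases hQ : hubQ ∈ X
  · rw [hcard, (hv' _).mpr hP, (hv' _).mpr hQ, Bool.toNat_true] at hX
    omega
  · have h1 := hub_card_le_starts' hJ hsep B C G Y (fun i => hv' _) (fun i => hv' _)
      (fun i => hv' _) (fun i => hv' _) hP hQ
    rw [hcard, (hv' _).mpr hP, Bool.toNat_true] at hX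
    have h2 := Finset.sum_le_sum fun i (_ : i ∈ Finset.univ) => (starts_local' B C G Y i).1
    rw [← Finset.mul_sum, Finset.sum_add_distrib, ← Finset.mul_sum] at h2
    omega
  · have h1 := hub_card_le_isolated hJ hsep B C G Y (fun i => hv' _) (fun i => hv' _)
      (fun i => hv' _) (fun i => hv' _) hP hQ
    rw [hcard, (hv' _).mpr hQ, Bool.toNat_true] at hX
    have h2 := Finset.sum_le_sum fun i (_ : i ∈ Finset.univ) => (isolated_local B C G Y i).1
    simp only [Finset.sum_add_distrib, ← Finset.mul_sum] at h2
    omega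
  · have h1 := hub_card_le_poles hJ hsep B C G Y (fun i => hv' _) (fun i => hv' _) hP hQ
    omega

theorem isToughHost_hubFace :
    hub.IsToughHost hubFace 4 5 (fun _ => 7) (fun _ => 1) 7 3 5 := by
  classical
  have hcorle : ∀ X : Finset (Fin 3 ⊕ Fin 39), corners X ≤ X.card := by
    intro X
    refine Finset.card_le_card_of_injOn Sum.inl (fun i hi => ?_) Sum.inl_injective.injOn
    simpa using hi
  -- A remaining corner represents a component that is not counted in `I`. Adding it yields the
  -- extra 5 that the cases with at most two deleted corners require.
  have insert_corner : ∀ X I, hub.IsClosedOff X I → corners X ≠ 3 →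
      (2 ≤ X.card →
        5 * (I.card + 1) + ∑ s, excess 7 1 (faceCorners hubFace X s) ≤ 4 * X.card) ∧
      (X.card ≤ 1 → I.card + 1 ≤ 1) := by
    intro X I hI h3
    obtain ⟨i, hi⟩ : ∃ i : Fin 3, Sum.inl i ∉ X := by
      by_contra hall
      push Not at hall
      exact h3 (by simp [corners, hall])
    have hiI : Sum.inl i ∉ I := fun h => hI.not_reach _ h i hi (.refl _)
    rw [← Finset.card_insert_of_notMem hiI]
    have hnot : ∀ u ∈ insert (Sum.inl i) I, u ∉ X := by
      intro u hu
      rcases Finset.mem_insert.mp hu with rfl | hu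
      · exact hi
      · exact hI.notMem u hu
    have hsep : ∀ u ∈ insert (Sum.inl i) I, ∀ w ∈ insert (Sum.inl i) I,
        hub.graph.ReachAvoiding X u w → u = w := by
      intro u hu w hw h
      rcases Finset.mem_insert.mp hu with rfl | hu <;> rcases Finset.mem_insert.mp hw with rfl | hw
      · rfl
      · exact absurd h.symm (hI.not_reach _ hw i hi)
      · exact absurd h (hI.not_reach _ hu i hi)
      · exact hI.eq_of_reach _ hu _ hw h
    exact ⟨fun h => (hub_count hnot hsep h).1, hub_card_le_one hnot hsep⟩
  constructor
  · intro X I hI h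
    have hall : ∀ i, Sum.inl i ∈ X := by
      intro i
      have : (Finset.univ.filter fun i : Fin 3 => Sum.inl i ∈ X) = Finset.univ :=
        Finset.eq_univ_of_card _ (by
        rw [Fintype.card_fin]
        refine Eq.trans ?_ h
        unfold corners
        congr)
      simpa using Finset.ext_iff.mp this i
    have := (hub_count hI.notMem hI.eq_of_reach (by have := hcorle X; omega)).2 hall
    omega
  · intro X I hI h
    have := (insert_corner X I hI (by omega)).1 (by have := hcorle X; omega)
    omega
  · intro X I hI h
    by_cases h2 : 2 ≤ X.card
    · left
      have := (insert_corner X I hI (by omega)).1 h2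
      omega
    · have := (insert_corner X I hI (by omega)).2 (by omega)
      exact Or.inr ⟨by omega, Finset.card_eq_zero.mp (by omega)⟩

end Disk

/-! ### Upper bounds for cycles: entries and exits -/

section Tours

/-! A cycle of a graph is described by the cyclic permutation `σ` that moves its vertices. -/

variable {V : Type*} {σ : Equiv.Perm V} {P P' Z Z' : Finset V}

/-- The set `Z` can be left and entered only through `P`. -/
structure IsEnclosed (σ : Equiv.Perm V) (P Z : Finset V) : Prop where
  disjoint : Disjoint P Z
  apply_mem : ∀ v ∈ Z, σ v ∉ Z → σ v ∈ P
  inv_apply_mem : ∀ v ∈ Z, σ⁻¹ v ∉ Z → σ⁻¹ v ∈ P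

theorem IsEnclosed.inv (h : IsEnclosed σ P Z) : IsEnclosed σ⁻¹ P Z :=
  ⟨h.disjoint, h.inv_apply_mem, by rw [inv_inv]; exact h.apply_mem⟩

variable [DecidableEq V]

/-- The number of vertices of `P` that are mapped to `Z`. -/
def entries (σ : Equiv.Perm V) (P Z : Finset V) : ℕ := (P.filter fun v => σ v ∈ Z).card

/-- A set is entered as often as it is left: Z and its image under σ have equal size, hence equally
many elements outside each other. -/
theorem IsEnclosed.entries_inv (h : IsEnclosed σ P Z) : entries σ⁻¹ P Z = entries σ P Z := by
  have h1 : P.filter (fun v => σ⁻¹ v ∈ Z) = Z.map σ.toEmbedding \ Z := by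
    ext v
    simp only [Finset.mem_filter, Finset.mem_sdiff, Finset.mem_map_equiv]
    refine ⟨fun ⟨hv, hz⟩ => ⟨hz, Finset.disjoint_left.mp h.disjoint hv⟩, fun ⟨hz, hv⟩ => ⟨?_, hz⟩⟩
    have := h.apply_mem _ hz
    rw [Equiv.apply_symm_apply] at this
    exact this hv
  have h2 : (P.filter fun v => σ v ∈ Z).map σ.toEmbedding = Z \ Z.map σ.toEmbedding := by
    ext v
    simp only [Finset.mem_filter, Finset.mem_sdiff, Finset.mem_map_equiv, Equiv.apply_symm_apply]
    exact ⟨fun ⟨hv, hz⟩ => ⟨hz, Finset.disjoint_left.mp h.disjoint hv⟩,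
      fun ⟨hz, hv⟩ => ⟨h.inv_apply_mem v hz hv, hz⟩⟩
  rw [entries, entries, h1, ← Finset.card_map (s := P.filter _) σ.toEmbedding, h2]
  exact Finset.card_sdiff_comm (Finset.card_map _)

theorem entries_mono (hP : P ⊆ P') (hZ : Z ⊆ Z') : entries σ P Z ≤ entries σ P' Z' :=
  Finset.card_le_card fun v hv => by
    rw [Finset.mem_filter] at hv ⊢
    exact ⟨hP hv.1, hZ hv.2⟩

theorem entries_le_card : entries σ P Z ≤ P.card := Finset.card_filter_le _ _

theorem entries_union_le : entries σ (P ∪ P') Z ≤ entries σ P Z + entries σ P' Z := by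
  rw [entries, Finset.filter_union]
  exact Finset.card_union_le _ _

theorem sum_entries_le {ι : Type*} {s : Finset ι} {Z : ι → Finset V}
    (hd : (s : Set ι).PairwiseDisjoint Z) {T : Finset V} (hT : ∀ i ∈ s, Z i ⊆ T) :
    ∑ i ∈ s, entries σ P (Z i) ≤ entries σ P T := by
  classical
  unfold entries
  rw [← Finset.card_biUnion]
  · refine Finset.card_le_card fun v hv => ?_
    simp only [Finset.mem_biUnion, Finset.mem_filter] at hv ⊢
    obtain ⟨i, hi, hp, hz⟩ := hv
    exact ⟨hp, hT i hi hz⟩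
  · intro i hi j hj hij
    refine Finset.disjoint_left.mpr fun v hv hv' => ?_
    rw [Finset.mem_filter] at hv hv'
    exact Finset.disjoint_left.mp (hd hi hj hij) hv.2 hv'.2

theorem entries_add_entries_le (h : Disjoint Z Z') :
    entries σ P Z + entries σ P Z' ≤ P.card := by
  rw [entries, entries, ← Finset.card_union_of_disjoint]
  · exact Finset.card_le_card (Finset.union_subset (Finset.filter_subset _ _)
      (Finset.filter_subset _ _))
  · refine Finset.disjoint_left.mpr fun v hv hv' => ?_
    rw [Finset.mem_filter] at hv hv'
    exact Finset.disjoint_left.mp h hv.2 hv'.2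

variable [Fintype V]

/-- The number of vertices of `Z` that are moved. -/
def visits (σ : Equiv.Perm V) (Z : Finset V) : ℕ := (Z ∩ σ.support).card

theorem exists_exit (hσ : σ.IsCycle) {u v : V} (hu : u ∈ Z) (hv : v ∉ Z) (hu' : σ u ≠ u)
    (hv' : σ v ≠ v) : ∃ z ∈ Z, σ z ∉ Z := by
  by_contra! h
  obtain ⟨k, rfl⟩ := hσ.exists_pow_eq hu' hv'
  refine hv ?_
  clear hv hv'
  induction k with
  | zero => exact hu
  | succ k ih =>
    rw [pow_succ', Equiv.Perm.mul_apply]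
    exact h _ ih

theorem visits_pos : 0 < visits σ Z ↔ ∃ v ∈ Z, σ v ≠ v := by
  simp [visits, Finset.card_pos, Finset.Nonempty]

theorem visits_mono (h : Z ⊆ Z') : visits σ Z ≤ visits σ Z' :=
  Finset.card_le_card (Finset.inter_subset_inter_right h)

theorem visits_le_card : visits σ Z ≤ Z.card := Finset.card_le_card Finset.inter_subset_left

theorem visits_union_le : visits σ (Z ∪ Z') ≤ visits σ Z + visits σ Z' := by
  rw [visits, Finset.union_inter_distrib_right]
  exact Finset.card_union_le _ _

theorem visits_biUnion_le {ι : Type*} {s : Finset ι} {Z : ι → Finset V} :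
    visits σ (s.biUnion Z) ≤ ∑ i ∈ s, visits σ (Z i) := by
  rw [visits, Finset.biUnion_inter]
  exact Finset.card_biUnion_le

/-- A visited set, not all of the cycle up to one vertex `a`, is entered or left through a vertex
other than `a`. -/
theorem IsEnclosed.one_le_entries (hσ : σ.IsCycle) {a : V} (h : IsEnclosed σ (insert a P) Z)
    (hZ : 0 < visits σ Z) {u : V} (hu : u ∉ Z) (hua : u ≠ a) (hu' : σ u ≠ u) :
    1 ≤ entries σ P Z + entries σ⁻¹ P Z := by
  obtain ⟨v, hv, hv'⟩ := visits_pos.mp hZ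
  by_contra hlt
  have h1 : ∀ p ∈ P, σ p ∉ Z := by
    have : entries σ P Z = 0 := by omega
    rw [entries, Finset.card_eq_zero, Finset.filter_eq_empty_iff] at this
    exact this
  have h2 : ∀ p ∈ P, σ⁻¹ p ∉ Z := by
    have : entries σ⁻¹ P Z = 0 := by omega
    rw [entries, Finset.card_eq_zero, Finset.filter_eq_empty_iff] at this
    exact this
  obtain ⟨z, hz, hz'⟩ := exists_exit hσ hv hu hv' hu'
  have hza : σ z = a := by
    refine (Finset.mem_insert.mp (h.apply_mem z hz hz')).resolve_right fun hp => h2 _ hp ?_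
    simpa using hz
  -- The cycle leaves Z towards a. Coming back from u it meets Z ∪ {a} again; it cannot do so at a,
  -- whose predecessor lies in Z, so it enters Z through P.
  obtain ⟨y, hy, hy'⟩ := exists_exit (Z := (insert a Z)ᶜ) hσ (u := u) (v := v)
    (by simp [hu, hua]) (by simp [hv]) hu' hv'
  rw [Finset.mem_compl, Finset.mem_insert, not_or] at hy
  rw [Finset.mem_compl, not_not, Finset.mem_insert] at hy'
  rcases hy' with hy' | hy'
  · rw [← hza] at hy'
    exact hy.2 (σ.injective hy' ▸ hz)
  · have := h.inv_apply_mem _ hy'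
    rw [Equiv.Perm.coe_inv, Equiv.symm_apply_apply] at this
    exact h1 _ ((Finset.mem_insert.mp (this hy.2)).resolve_left hy.1) hy'

theorem IsEnclosed.visits_eq_zero (hσ : σ.IsCycle) (h : IsEnclosed σ P Z)
    (h0 : entries σ P Z = 0) {u : V} (hu : u ∉ Z) (hu' : σ u ≠ u) : visits σ Z = 0 := by
  by_contra hZ
  obtain ⟨v, hv, hv'⟩ := visits_pos.mp (Nat.pos_of_ne_zero hZ)
  obtain ⟨y, hy, hy'⟩ := exists_exit (Z := Zᶜ) hσ (Finset.mem_compl.mpr hu) (by simpa using hv)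
    hu' hv'
  rw [Finset.mem_compl] at hy
  rw [Finset.mem_compl, not_not] at hy'
  have := h.inv_apply_mem _ hy'
  rw [Equiv.Perm.coe_inv, Equiv.symm_apply_apply] at this
  rw [entries, Finset.card_eq_zero, Finset.filter_eq_empty_iff] at h0
  exact h0 (this hy) hy'

end Tours

namespace Disk

variable {N S : Type} {W : S → Type} {M : Disk N} {f : S → Fin 3 ↪ Fin 3 ⊕ N}
  {D : ∀ s, Disk (W s)}

theorem exists_of_glue_adj {s : S} {w : W s} {y : Fin 3 ⊕ (N ⊕ Σ s, W s)}
    (h : (glue M f D).graph.Adj (emb f s (Sum.inr w)) y) :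
    ∃ x, (D s).graph.Adj (Sum.inr w) x ∧ y = emb f s x := by
  have key : ∀ v, GlueAdj M f D v y → v = emb f s (Sum.inr w) →
      ∃ x, (D s).graph.Adj (Sum.inr w) x ∧ y = emb f s x := by
    intro v h hv
    cases h with
    | base h => exact absurd hv (incl_ne _ _)
    | disk h =>
      obtain ⟨rfl, rfl⟩ := emb_eq_inr f hv
      exact ⟨_, h, rfl⟩
  exact key _ h rfl

section

variable {U : Type} {V : Type}

/-- A cycle `σ` of a larger graph, in which the disk `E` is drawn by `e`. -/
structure IsTour (E : Disk U) (σ : Equiv.Perm V) (e : Fin 3 ⊕ U → V) : Prop where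
  isCycle : σ.IsCycle
  injective : Function.Injective e
  apply_eq : ∀ w, σ (e (Sum.inr w)) ≠ e (Sum.inr w) →
    ∃ x, E.graph.Adj (Sum.inr w) x ∧ σ (e (Sum.inr w)) = e x
  inv_apply_eq : ∀ w, σ (e (Sum.inr w)) ≠ e (Sum.inr w) →
    ∃ x, E.graph.Adj (Sum.inr w) x ∧ σ⁻¹ (e (Sum.inr w)) = e x

variable {σ : Equiv.Perm V}

theorem IsTour.glue {e : Fin 3 ⊕ (N ⊕ Σ s, W s) → V}
    (h : (glue M f D).IsTour σ e) (s : S) : (D s).IsTour σ (e ∘ emb f s) where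
  isCycle := h.isCycle
  injective := h.injective.comp (emb_injective f s)
  apply_eq w hw := by
    obtain ⟨y, hy, h1⟩ := h.apply_eq (Sum.inr ⟨s, w⟩) hw
    obtain ⟨x, hx, rfl⟩ := exists_of_glue_adj (s := s) (w := w) hy
    exact ⟨x, hx, h1⟩
  inv_apply_eq w hw := by
    obtain ⟨y, hy, h1⟩ := h.inv_apply_eq (Sum.inr ⟨s, w⟩) hw
    obtain ⟨x, hx, rfl⟩ := exists_of_glue_adj (s := s) (w := w) hy
    exact ⟨x, hx, h1⟩

variable [DecidableEq V]

/-- The vertices that are drawn inside of the triangle. -/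
def inner [Fintype U] (e : Fin 3 ⊕ U → V) : Finset V := Finset.univ.image fun w => e (Sum.inr w)

/-- The corners of the drawn triangle. -/
def ports (e : Fin 3 ⊕ U → V) : Finset V := Finset.univ.image fun i => e (Sum.inl i)

theorem mem_inner [Fintype U] {e : Fin 3 ⊕ U → V} {v : V} :
    v ∈ inner e ↔ ∃ w, e (Sum.inr w) = v := by simp [inner]

theorem mem_ports {e : Fin 3 ⊕ U → V} {v : V} : v ∈ ports e ↔ ∃ i, e (Sum.inl i) = v := by
  simp [ports]

theorem card_ports_le {e : Fin 3 ⊕ U → V} : (ports e).card ≤ 3 :=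
  Finset.card_image_le.trans (by simp)

theorem IsTour.isEnclosed [Fintype U] {E : Disk U} {e : Fin 3 ⊕ U → V} (h : E.IsTour σ e) :
    IsEnclosed σ (ports e) (inner e) := by
  have hmem : ∀ x, e x ∉ inner e → e x ∈ ports e := by
    rintro (i | w) hx
    · exact mem_ports.mpr ⟨i, rfl⟩
    · exact absurd (mem_inner.mpr ⟨w, rfl⟩) hx
  refine ⟨Finset.disjoint_left.mpr fun v hv hv' => ?_, fun v hv hn => ?_, fun v hv hn => ?_⟩
  · obtain ⟨i, rfl⟩ := mem_ports.mp hv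
    obtain ⟨w, hw⟩ := mem_inner.mp hv'
    exact Sum.inr_ne_inl (h.injective hw)
  · obtain ⟨w, rfl⟩ := mem_inner.mp hv
    obtain ⟨x, -, hx⟩ := h.apply_eq w fun h' => hn (h'.symm ▸ hv)
    rw [hx] at hn ⊢
    exact hmem x hn
  · obtain ⟨w, rfl⟩ := mem_inner.mp hv
    obtain ⟨x, -, hx⟩ := h.inv_apply_eq w fun h' => hn (by
      rw [Equiv.Perm.inv_eq_iff_eq.mpr h'.symm]; exact hv)
    rw [hx] at hn ⊢
    exact hmem x hn

variable [Fintype V]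

/-- No cycle of a larger graph visits more than `c` vertices inside of the disk. -/
def IsInnerBound [Fintype U] (E : Disk U) (c : ℕ) : Prop :=
  ∀ {V : Type} [Fintype V] [DecidableEq V] (σ : Equiv.Perm V) (e : Fin 3 ⊕ U → V),
    E.IsTour σ e → visits σ (inner e) ≤ c

/-- No cycle of a larger graph visits more than `c` vertices of the disk. -/
def IsTotalBound [Fintype U] (E : Disk U) (c : ℕ) : Prop :=
  ∀ {V : Type} [Fintype V] [DecidableEq V] (σ : Equiv.Perm V) (e : Fin 3 ⊕ U → V),
    E.IsTour σ e → visits σ (Finset.univ.image e) ≤ c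

theorem tetrahedron_isInnerBound : tetrahedron.IsInnerBound 1 := fun _ _ _ =>
  visits_le_card.trans (Finset.card_image_le.trans (by simp))

section Glue

variable [Fintype N] [Fintype S] [∀ s, Fintype (W s)] {e : Fin 3 ⊕ (N ⊕ Σ s, W s) → V}

omit [Fintype V] in
theorem inner_glue_subset (s : S) : inner (e ∘ emb f s) ⊆ inner e := fun v hv => by
  obtain ⟨w, rfl⟩ := mem_inner.mp hv
  exact mem_inner.mpr ⟨Sum.inr ⟨s, w⟩, rfl⟩

omit [Fintype V] [Fintype N] [Fintype S] in
theorem disjoint_inner_glue (he : Function.Injective e) {s s' : S} (h : s ≠ s') :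
    Disjoint (inner (e ∘ emb f s)) (inner (e ∘ emb f s')) :=
  Finset.disjoint_left.mpr fun v hv hv' => by
    obtain ⟨w, rfl⟩ := mem_inner.mp hv
    obtain ⟨w', h'⟩ := mem_inner.mp hv'
    have := he h'
    simp only [emb_inr, Sum.inr.injEq, Sigma.mk.injEq] at this
    exact h this.1.symm

omit [Fintype V] [Fintype N] [Fintype S] in
theorem notMem_inner_glue (he : Function.Injective e) (s : S) (x : Fin 3 ⊕ N) :
    e (incl _ x) ∉ inner (e ∘ emb f s) := fun h => by
  obtain ⟨w, h⟩ := mem_inner.mp h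
  exact incl_ne _ _ (he h).symm

theorem visits_inner_glue_le :
    visits σ (inner e) ≤ Fintype.card N + ∑ s, visits σ (inner (e ∘ emb f s)) := by
  have : inner e ⊆ (Finset.univ.image fun n : N => e (Sum.inr (Sum.inl n))) ∪
      Finset.univ.biUnion fun s => inner (e ∘ emb f s) := fun v hv => by
    rw [Finset.mem_union, Finset.mem_biUnion]
    obtain ⟨n | ⟨s, w⟩, rfl⟩ := mem_inner.mp hv
    · exact Or.inl (Finset.mem_image_of_mem _ (Finset.mem_univ n))
    · exact Or.inr ⟨s, Finset.mem_univ _, mem_inner.mpr ⟨w, rfl⟩⟩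
  exact (visits_mono this).trans (visits_union_le.trans (Nat.add_le_add
    (visits_le_card.trans Finset.card_image_le) visits_biUnion_le))

end Glue

theorem visits_image_le [Fintype U] {e : Fin 3 ⊕ U → V} :
    visits σ (Finset.univ.image e) ≤ 3 + visits σ (inner e) := by
  have : Finset.univ.image e ⊆ ports e ∪ inner e := fun v hv => by
    obtain ⟨i | w, -, rfl⟩ := Finset.mem_image.mp hv
    · exact Finset.mem_union_left _ (mem_ports.mpr ⟨i, rfl⟩)
    · exact Finset.mem_union_right _ (mem_inner.mpr ⟨w, rfl⟩)
  exact (visits_mono this).trans (visits_union_le.trans (Nat.add_le_add_right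
    (visits_le_card.trans card_ports_le) _))

end

section

variable {U V : Type} [DecidableEq V] [Fintype U]

omit [Fintype U] in
theorem ports_eq (e : Fin 3 ⊕ U → V) (i : Fin 3) :
    ports e = insert (e (Sum.inl i)) {e (Sum.inl (i + 1)), e (Sum.inl (i + 2))} := by
  have key : ∀ j : Fin 3, j = i ∨ j = i + 1 ∨ j = i + 2 := by revert i; decide
  ext v
  simp only [mem_ports, Finset.mem_insert, Finset.mem_singleton]
  constructor
  · rintro ⟨j, rfl⟩
    rcases key j with rfl | rfl | rfl <;> simp
  · rintro (rfl | rfl | rfl) <;> exact ⟨_, rfl⟩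

variable [Fintype V] {σ : Equiv.Perm V} {E : Disk U}

/-- A visited disk contains all of the cycle except for one corner, or it is entered or left
through one of the other two corners. -/
theorem IsTour.one_le_entries {e : Fin 3 ⊕ U → V} (h : E.IsTour σ e) (i : Fin 3)
    (hZ : 0 < visits σ (inner e)) {u : V} (hu : u ∉ inner e) (hui : u ≠ e (Sum.inl i))
    (hu' : σ u ≠ u) : 1 ≤
      entries σ {e (Sum.inl (i + 1)), e (Sum.inl (i + 2))} (inner e) +
      entries σ⁻¹ {e (Sum.inl (i + 1)), e (Sum.inl (i + 2))} (inner e) :=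
  IsEnclosed.one_le_entries h.isCycle (ports_eq e i ▸ h.isEnclosed) hZ hu hui hu'

omit [Fintype V] in
-- Entries and exits are equally many, and a single corner accounts for at most one of each.
theorem IsTour.two_mul_entries_le {e : Fin 3 ⊕ U → V} (h : E.IsTour σ e) (i : Fin 3) :
    2 * entries σ (ports e) (inner e) ≤
      entries σ {e (Sum.inl (i + 1)), e (Sum.inl (i + 2))} (inner e) +
      entries σ⁻¹ {e (Sum.inl (i + 1)), e (Sum.inl (i + 2))} (inner e) + 2 := by
  have h1 := h.isEnclosed.entries_inv
  rw [ports_eq e i, Finset.insert_eq] at h1 ⊢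
  have h2 := entries_union_le (σ := σ) (P := {e (Sum.inl i)})
    (P' := {e (Sum.inl (i + 1)), e (Sum.inl (i + 2))}) (Z := inner e)
  have h3 := entries_union_le (σ := σ⁻¹) (P := {e (Sum.inl i)})
    (P' := {e (Sum.inl (i + 1)), e (Sum.inl (i + 2))}) (Z := inner e)
  have h4 := entries_le_card (σ := σ) (P := {e (Sum.inl i)}) (Z := inner e)
  have h5 := entries_le_card (σ := σ⁻¹) (P := {e (Sum.inl i)}) (Z := inner e)
  rw [Finset.card_singleton] at h4 h5
  omega

end

section Side

variable {U V : Type} [DecidableEq V] [Fintype V] [Fintype U] {σ : Equiv.Perm V} {D : Disk U}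
  {e : Fin 3 ⊕ (Fin 3 ⊕ Σ _ : Fin 3, U) → V}

omit [Fintype V] in
theorem pairwiseDisjoint_inner_glue {N S : Type} {W : S → Type} {f : S → Fin 3 ↪ Fin 3 ⊕ N}
    [∀ s, Fintype (W s)] {e : Fin 3 ⊕ (N ⊕ Σ s, W s) → V} (he : Function.Injective e)
    (T : Set S) : T.PairwiseDisjoint fun s => inner (e ∘ emb f s) :=
  fun _ _ _ _ h => disjoint_inner_glue he h

omit [Fintype V] in
-- The interiors of the side disks are disjoint, so passages from the outer corners into them are
-- different passages into the octahedron.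
theorem sum_entries_sideFace_le (he : Function.Injective e) :
    ∑ i, (entries σ {e (Sum.inl i), e (Sum.inl (i + 1))} (inner (e ∘ emb sideFace i)) +
      entries σ⁻¹ {e (Sum.inl i), e (Sum.inl (i + 1))} (inner (e ∘ emb sideFace i))) ≤
    entries σ (ports e) (inner e) + entries σ⁻¹ (ports e) (inner e) := by
  have hP : ∀ i, {e (Sum.inl i), e (Sum.inl (i + 1))} ⊆ ports e := fun i v hv => by
    rw [Finset.mem_insert, Finset.mem_singleton] at hv
    rcases hv with rfl | rfl <;> exact mem_ports.mpr ⟨_, rfl⟩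
  have hall : ∀ τ : Equiv.Perm V,
      ∑ i, entries τ {e (Sum.inl i), e (Sum.inl (i + 1))} (inner (e ∘ emb sideFace i)) ≤
        entries τ (ports e) (inner e) := fun τ =>
    (Finset.sum_le_sum fun i _ => entries_mono (hP i) subset_rfl).trans
      (sum_entries_le (pairwiseDisjoint_inner_glue he _) fun i _ => inner_glue_subset i)
  rw [Finset.sum_add_distrib]
  exact Nat.add_le_add (hall σ) (hall σ⁻¹)

/-- In the disk, a cycle of a larger graph visits at most `r` inner vertices, at most `p` if it
enters the disk once, and at most `q` if it enters the disk twice. -/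
structure IsPassBound (E : Disk U) (p q r : ℕ) : Prop where
  bound : E.IsInnerBound r
  bound_one : ∀ {V : Type} [Fintype V] [DecidableEq V] (σ : Equiv.Perm V) (e : Fin 3 ⊕ U → V),
    E.IsTour σ e → entries σ (ports e) (inner e) = 1 → visits σ (inner e) ≤ p
  bound_two : ∀ {V : Type} [Fintype V] [DecidableEq V] (σ : Equiv.Perm V) (e : Fin 3 ⊕ U → V),
    E.IsTour σ e → entries σ (ports e) (inner e) = 2 → visits σ (inner e) ≤ q

theorem tetrahedron_isPassBound : tetrahedron.IsPassBound 1 1 1 where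
  bound := tetrahedron_isInnerBound
  bound_one σ e h _ := tetrahedron_isInnerBound σ e h
  bound_two σ e h _ := tetrahedron_isInnerBound σ e h

/-- Let t be the number of passages between a side disk and its two outer corners. A disk visited by
a cycle that also goes elsewhere has t ≥ 1; two entries need t ≥ 2 and three need t ≥ 4. The sum of
t over the three disks is at most twice the number of entries into the octahedron. The best
distributions are (1,1,0), (2,1,1) and (2,2,2) for one, two and three entries; the inequalities
between p, q, r exclude better ones. -/
theorem IsTour.visits_sideFace_le {p q r : ℕ} (h1 : 1 ≤ p) (hqp : q ≤ 2 * p)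
    (hqr : q ≤ r)
    (hrq : r ≤ q + 2 * p) (hrpq : r + 2 * p ≤ 3 * q) (hD : D.IsPassBound p q r)
    (h : (Disk.glue octahedron sideFace fun _ => D).IsTour σ e) :
    visits σ (inner e) ≤ 3 * q + 3 ∧
    (entries σ (ports e) (inner e) = 1 → visits σ (inner e) ≤ 2 * p + 3) ∧
    (entries σ (ports e) (inner e) = 2 → visits σ (inner e) ≤ q + 2 * p + 3) := by
  have hv := visits_inner_glue_le (f := sideFace) (σ := σ) (e := e)
  rw [Fintype.card_fin] at hv
  -- A cycle confined to one side disk and the adjoining inner vertex escapes the count of passages,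
  -- but it visits at most r + 1 vertices and never enters from a corner.
  by_cases hex : ∃ i, ∀ u, σ u ≠ u → u ∈ inner (e ∘ emb sideFace i) ∨ u = e (Sum.inr (Sum.inl i))
  · obtain ⟨i, hi⟩ := hex
    have hsub : inner e ∩ σ.support ⊆
        insert (e (Sum.inr (Sum.inl i))) (inner (e ∘ emb sideFace i) ∩ σ.support) := by
      intro u hu
      rw [Finset.mem_inter, Equiv.Perm.mem_support] at hu
      rw [Finset.mem_insert, Finset.mem_inter, Equiv.Perm.mem_support]
      rcases hi u hu.2 with h' | h'
      · exact Or.inr ⟨h', hu.2⟩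
      · exact Or.inl h'
    have hle : visits σ (inner e) ≤ r + 1 := (Finset.card_le_card hsub).trans
      ((Finset.card_insert_le _ _).trans (Nat.add_le_add_right (hD.bound σ _ (h.glue i)) 1))
    have h0 : entries σ (ports e) (inner e) = 0 := by
      rw [entries, Finset.card_eq_zero, Finset.filter_eq_empty_iff]
      intro v hv hv'
      obtain ⟨j, rfl⟩ := mem_ports.mp hv
      have hj : σ (e (Sum.inl j)) ≠ e (Sum.inl j) := fun h' => by
        rw [h'] at hv'
        exact Finset.disjoint_left.mp h.isEnclosed.disjoint hv hv'
      rcases hi _ hj with h' | h'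
      · exact notMem_inner_glue h.injective i (Sum.inl j) h'
      · exact Sum.inl_ne_inr (h.injective h')
    omega
  · push Not at hex
    have hi : ∀ i, 2 * entries σ (ports (e ∘ emb sideFace i)) (inner (e ∘ emb sideFace i)) ≤
        entries σ {e (Sum.inl i), e (Sum.inl (i + 1))} (inner (e ∘ emb sideFace i)) +
        entries σ⁻¹ {e (Sum.inl i), e (Sum.inl (i + 1))} (inner (e ∘ emb sideFace i)) + 2 :=
      fun i => (h.glue i).two_mul_entries_le 2
    have hle3 : ∀ i, entries σ (ports (e ∘ emb sideFace i)) (inner (e ∘ emb sideFace i)) ≤ 3 :=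
      fun i => entries_le_card.trans card_ports_le
    have hpos : ∀ i, 0 < visits σ (inner (e ∘ emb sideFace i)) → 1 ≤
        entries σ {e (Sum.inl i), e (Sum.inl (i + 1))} (inner (e ∘ emb sideFace i)) +
        entries σ⁻¹ {e (Sum.inl i), e (Sum.inl (i + 1))} (inner (e ∘ emb sideFace i)) := by
      intro i hZ
      obtain ⟨u, hu, hu', hu''⟩ := hex i
      exact (h.glue i).one_le_entries 2 hZ hu' hu'' hu
    have hzero : ∀ i, entries σ (ports (e ∘ emb sideFace i)) (inner (e ∘ emb sideFace i)) = 0 →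
        visits σ (inner (e ∘ emb sideFace i)) = 0 := by
      intro i hZ
      obtain ⟨u, hu, hu', hu''⟩ := hex i
      exact (h.glue i).isEnclosed.visits_eq_zero h.isCycle hZ hu' hu
    have hone := fun i => hD.bound_one σ _ (h.glue i)
    have htwo := fun i => hD.bound_two σ _ (h.glue i)
    have hr := fun i => hD.bound σ _ (h.glue i)
    have hsum := sum_entries_sideFace_le (σ := σ) h.injective
    rw [h.isEnclosed.entries_inv] at hsum
    have hout : entries σ (ports e) (inner e) ≤ 3 := entries_le_card.trans card_ports_le
    have hcase : ∀ i : Fin 3, ∃ n v t : ℕ, n ≤ 3 ∧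
        entries σ {e (Sum.inl i), e (Sum.inl (i + 1))} (inner (e ∘ emb sideFace i)) +
        entries σ⁻¹ {e (Sum.inl i), e (Sum.inl (i + 1))} (inner (e ∘ emb sideFace i)) = t ∧
        visits σ (inner (e ∘ emb sideFace i)) = v ∧ 2 * n ≤ t + 2 ∧ (0 < v → 1 ≤ t) ∧
        (n = 0 → v = 0) ∧ (n = 1 → v ≤ p) ∧ (n = 2 → v ≤ q) ∧ v ≤ r :=
      fun i => ⟨_, _, _, hle3 i, rfl, rfl, hi i, hpos i, hzero i, hone i, htwo i, hr i⟩
    rw [Fin.sum_univ_three] at hsum hv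
    obtain ⟨n0, v0, t0, h01, h02, h03, h04, h05, h06, h07, h08, h09⟩ := hcase 0
    obtain ⟨n1, v1, t1, h11, h12, h13, h14, h15, h16, h17, h18, h19⟩ := hcase 1
    obtain ⟨n2, v2, t2, h21, h22, h23, h24, h25, h26, h27, h28, h29⟩ := hcase 2
    rw [h02, h12, h22] at hsum
    rw [h03, h13, h23] at hv
    generalize entries σ (ports e) (inner e) = m at *
    generalize visits σ (inner e) = v at *
    clear hi hle3 hpos hzero hone htwo hr hcase h02 h03 h12 h13 h22 h23 hex h
    have hkey : ∀ n v t : ℕ, n ≤ 3 → 2 * n ≤ t + 2 → (0 < v → 1 ≤ t) → (n = 0 → v = 0) →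
        (n = 1 → v ≤ p) → (n = 2 → v ≤ q) → v ≤ r → v = 0 ∨ (1 ≤ t ∧ v ≤ p) ∨ (2 ≤ t ∧ v ≤ q) ∨
          (4 ≤ t ∧ v ≤ r) := by
      intro n v t _ _ _ _ _ _ _
      omega
    have k0 := hkey _ _ _ h01 h04 h05 h06 h07 h08 h09
    have k1 := hkey _ _ _ h11 h14 h15 h16 h17 h18 h19
    have k2 := hkey _ _ _ h21 h24 h25 h26 h27 h28 h29
    clear hkey h01 h04 h05 h06 h07 h08 h09 h11 h14 h15 h16 h17 h18 h19 h21 h24 h25 h26 h27 h28 h29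
    rcases k0 with k0 | k0 | k0 | k0 <;> rcases k1 with k1 | k1 | k1 | k1 <;>
      rcases k2 with k2 | k2 | k2 | k2 <;> omega

theorem IsPassBound.glue {p q r : ℕ} (h1 : 1 ≤ p) (hqp : q ≤ 2 * p) (hqr : q ≤ r)
    (hrq : r ≤ q + 2 * p) (hrpq : r + 2 * p ≤ 3 * q) (hD : D.IsPassBound p q r) :
    (Disk.glue octahedron sideFace fun _ => D).IsPassBound (2 * p + 3) (q + 2 * p + 3)
      (3 * q + 3) where
  bound _ _ h := (h.visits_sideFace_le h1 hqp hqr hrq hrpq hD).1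
  bound_one _ _ h := (h.visits_sideFace_le h1 hqp hqr hrq hrpq hD).2.1
  bound_two _ _ h := (h.visits_sideFace_le h1 hqp hqr hrq hrpq hD).2.2

end Side

end Disk

section

variable {V : Type*} {σ : Equiv.Perm V} {P Z : Finset V} [DecidableEq V] [Fintype V]

theorem IsEnclosed.compl (h : IsEnclosed σ P Z) : IsEnclosed σ P (Z ∪ P)ᶜ := by
  have key : ∀ τ : Equiv.Perm V, (∀ v ∈ Z, τ⁻¹ v ∉ Z → τ⁻¹ v ∈ P) →
      ∀ v ∈ (Z ∪ P)ᶜ, τ v ∉ (Z ∪ P)ᶜ → τ v ∈ P := by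
    intro τ hτ v hv hn
    rw [Finset.mem_compl, Finset.mem_union, not_or] at hv
    rw [Finset.mem_compl, not_not, Finset.mem_union] at hn
    refine hn.resolve_left fun hz => ?_
    have := hτ _ hz
    rw [Equiv.Perm.coe_inv, Equiv.symm_apply_apply] at this
    exact hv.2 (this hv.1)
  refine ⟨Finset.disjoint_left.mpr fun v hv hv' => ?_, key σ h.inv_apply_mem,
    key σ⁻¹ (by rw [inv_inv]; exact h.apply_mem)⟩
  exact Finset.mem_compl.mp hv' (Finset.mem_union_right _ hv)

/-- As the cycle never goes from Z to a, it reaches u from Z only by leaving Z ∪ P at a vertex of P.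
That vertex does not enter Z, so at most one of the two vertices of P does. -/
theorem IsEnclosed.entries_le_one (hσ : σ.IsCycle) {a : V} (h : IsEnclosed σ (insert a P) Z)
    (hP : P.card ≤ 2) (h0 : entries σ⁻¹ {a} Z = 0) (hZ : 0 < visits σ Z) {u : V} (hu : u ∉ Z)
    (huP : u ∉ P) (hu' : σ u ≠ u) : entries σ P Z ≤ 1 := by
  obtain ⟨v, hv, hv'⟩ := visits_pos.mp hZ
  obtain ⟨z, hz, hz'⟩ := exists_exit (Z := Z ∪ P) hσ (Finset.mem_union_left _ hv)
    (by simp [hu, huP]) hv' hu'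
  rw [Finset.mem_union, not_or] at hz'
  have hzP : z ∈ P := by
    refine (Finset.mem_union.mp hz).resolve_left fun hzZ => ?_
    have ha := (Finset.mem_insert.mp (h.apply_mem z hzZ hz'.1)).resolve_right hz'.2
    rw [entries, Finset.card_eq_zero, Finset.filter_eq_empty_iff] at h0
    exact h0 (Finset.mem_singleton_self a) (by rw [← ha]; simpa using hzZ)
  have hsub : P.filter (fun v => σ v ∈ Z) ⊆ P.erase z := fun v hv => by
    rw [Finset.mem_filter] at hv
    refine Finset.mem_erase.mpr ⟨fun h => hz'.1 (h ▸ hv.2), hv.1⟩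
  have := Finset.card_le_card hsub
  rw [Finset.card_erase_of_mem hzP] at this
  rw [entries]
  omega

end

namespace Disk

section

variable {U V : Type} [DecidableEq V] [Fintype V] [Fintype U] {σ : Equiv.Perm V} {D : Disk U}

theorem visits_inv (Z : Finset V) : visits σ⁻¹ Z = visits σ Z := by
  rw [visits, visits, Equiv.Perm.support_inv]

theorem visits_sideFace_le_of_isInnerBound {c : ℕ} {e : Fin 3 ⊕ (Fin 3 ⊕ Σ _ : Fin 3, U) → V}
    (hD : D.IsInnerBound c) (h : (glue octahedron sideFace fun _ => D).IsTour σ e) :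
    visits σ (inner e) ≤ 3 + 3 * c := by
  have hv := visits_inner_glue_le (f := sideFace) (σ := σ) (e := e)
  have := Finset.sum_le_sum fun i (_ : i ∈ Finset.univ) => hD σ _ (h.glue i)
  simp only [Finset.sum_const, Finset.card_univ, Fintype.card_fin, smul_eq_mul] at this hv
  omega

/-- If the three disks at the sides of an octahedron are visited, then the octahedron is entered or
left at least three times. -/
theorem three_le_entries_sideFace {e : Fin 3 ⊕ (Fin 3 ⊕ Σ _ : Fin 3, U) → V}
    (h : (glue octahedron sideFace fun _ => D).IsTour σ e)
    (hall : ∀ i, 0 < visits σ (inner (e ∘ emb sideFace i))) {u : V} (hu : u ∉ inner e)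
    (hu' : σ u ≠ u) : 3 ≤ entries σ (ports e) (inner e) + entries σ⁻¹ (ports e) (inner e) := by
  refine le_trans ?_ (sum_entries_sideFace_le h.injective)
  have : ∀ i ∈ (Finset.univ : Finset (Fin 3)), 1 ≤
      entries σ {e (Sum.inl i), e (Sum.inl (i + 1))} (inner (e ∘ emb sideFace i)) +
      entries σ⁻¹ {e (Sum.inl i), e (Sum.inl (i + 1))} (inner (e ∘ emb sideFace i)) :=
    fun i _ => (h.glue i).one_le_entries 2 (hall i) (fun hz => hu (inner_glue_subset i hz))
      (fun hz => hu (hz ▸ mem_inner.mpr ⟨Sum.inl i, rfl⟩)) hu'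
  simpa using Finset.card_nsmul_le_sum _ _ _ this

/-- If one corner is not used, the other two allow one entry and one exit. This is less than the
three passages that visiting all three side disks needs, so one disk is missed. -/
theorem visits_sideFace_le_of_entries_eq_zero {c : ℕ}
    {e : Fin 3 ⊕ (Fin 3 ⊕ Σ _ : Fin 3, U) → V} (hD : D.IsInnerBound c)
    (h : (glue octahedron sideFace fun _ => D).IsTour σ e) (i : Fin 3)
    (h0 : entries σ {e (Sum.inl i)} (inner e) = 0)
    (h0' : entries σ⁻¹ {e (Sum.inl i)} (inner e) = 0) {u : V} (hu : u ∉ inner e)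
    (huP : u ∉ ports e) (hu' : σ u ≠ u) : visits σ (inner e) ≤ 3 + 2 * c := by
  by_cases hall : ∀ i, 0 < visits σ (inner (e ∘ emb sideFace i))
  · exfalso
    have h3 := three_le_entries_sideFace h hall hu hu'
    have hE := h.isEnclosed
    have hpos : 0 < visits σ (inner e) := (hall 0).trans_le (visits_mono (inner_glue_subset 0))
    rw [ports_eq e i] at huP hE h3
    rw [Finset.mem_insert, not_or] at huP
    have h1 := hE.entries_le_one h.isCycle Finset.card_le_two h0' hpos hu huP.2 hu'
    have h2 := hE.inv.entries_le_one h.isCycle.inv Finset.card_le_two (by rwa [inv_inv])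
      (by rwa [visits_inv]) hu huP.2 (fun h' => hu' (Equiv.Perm.inv_eq_iff_eq.mp h').symm)
    rw [Finset.insert_eq] at h3
    have h4 := entries_union_le (σ := σ) (P := {e (Sum.inl i)})
      (P' := {e (Sum.inl (i + 1)), e (Sum.inl (i + 2))}) (Z := inner e)
    have h5 := entries_union_le (σ := σ⁻¹) (P := {e (Sum.inl i)})
      (P' := {e (Sum.inl (i + 1)), e (Sum.inl (i + 2))}) (Z := inner e)
    omega
  · push Not at hall
    obtain ⟨j, hj⟩ := hall
    have hv := visits_inner_glue_le (f := sideFace) (σ := σ) (e := e)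
    have hb := fun i => hD σ _ (h.glue i)
    rw [Fin.sum_univ_three, Fintype.card_fin] at hv
    have hb0 := hb 0
    have hb1 := hb 1
    have hb2 := hb 2
    fin_cases j <;> simp at hj <;> omega

/-- The hub with an octahedron in each of its ten faces, and a disk at each side of each of these
octahedra. -/
noncomputable def hubWith (D : Disk U) :=
  glue hub hubFace fun _ => glue octahedron sideFace fun _ => D

theorem hubWith_isTotalBound {c : ℕ} (hD : D.IsInnerBound c) :
    (hubWith D).IsTotalBound (72 + 22 * c) := by
  intro V _ _ σ e h
  have hin : ∀ i, visits σ (inner (e ∘ emb hubFace i)) ≤ 3 + 3 * c := fun i =>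
    visits_sideFace_le_of_isInnerBound hD (IsTour.glue h i)
  by_cases hex : ∃ i, ∀ u, σ u ≠ u →
      u ∈ inner (e ∘ emb hubFace i) ∨ u ∈ ports (e ∘ emb hubFace i)
  · obtain ⟨i, hi⟩ := hex
    have hsub : Finset.univ.image e ∩ σ.support ⊆
        ports (e ∘ emb hubFace i) ∪ (inner (e ∘ emb hubFace i) ∩ σ.support) := fun u hu => by
      rw [Finset.mem_inter, Equiv.Perm.mem_support] at hu
      rw [Finset.mem_union, Finset.mem_inter, Equiv.Perm.mem_support]
      exact (hi u hu.2).elim (fun h' => Or.inr ⟨h', hu.2⟩) Or.inl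
    have h1 := (Finset.card_le_card hsub).trans (Finset.card_union_le _ _)
    have h2 := hin i
    have h3 := card_ports_le (e := e ∘ emb hubFace i)
    rw [visits] at h2 ⊢
    omega
  · push Not at hex
    -- The vertex p has one successor and one predecessor, so at most two octahedra use it as a
    -- port.
    have hp : ∀ τ : Equiv.Perm V,
        ∑ i, entries τ {e (incl _ hubP)} (inner (e ∘ emb hubFace i)) ≤ 1 := fun τ =>
      (sum_entries_le (pairwiseDisjoint_inner_glue h.injective _)
        fun i _ => Finset.subset_univ _).trans (entries_le_card.trans (by simp))
    -- An octahedron may visit its third disk only at the expense of a passage at p. In total this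
    -- gives 42 + 10 (3 + 2c) + 2c.
    have hle : ∀ i ∈ (Finset.univ : Finset (Fin 10)), visits σ (inner (e ∘ emb hubFace i)) ≤
        3 + 2 * c + c * (entries σ {e (incl _ hubP)} (inner (e ∘ emb hubFace i)) +
          entries σ⁻¹ {e (incl _ hubP)} (inner (e ∘ emb hubFace i))) := by
      intro i _
      by_cases h0 : entries σ {e (incl _ hubP)} (inner (e ∘ emb hubFace i)) +
          entries σ⁻¹ {e (incl _ hubP)} (inner (e ∘ emb hubFace i)) = 0
      · obtain ⟨u, hu, hu1, hu2⟩ := hex i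
        have := visits_sideFace_le_of_entries_eq_zero hD (IsTour.glue h i) 2
          (Nat.eq_zero_of_add_eq_zero_right h0) (Nat.eq_zero_of_add_eq_zero_left h0) hu1 hu2 hu
        omega
      · have h1 := Nat.le_mul_of_pos_right c (Nat.pos_of_ne_zero h0)
        have := hin i
        omega
    have h1 := Finset.sum_le_sum hle
    rw [Finset.sum_add_distrib, ← Finset.mul_sum] at h1
    have h2 := Nat.mul_le_mul_left c (Nat.add_le_add (hp σ) (hp σ⁻¹))
    rw [← Finset.sum_add_distrib] at h2
    have h3 := visits_inner_glue_le (f := hubFace) (σ := σ) (e := e)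
    have h4 := visits_image_le (σ := σ) (e := e)
    simp only [Finset.sum_const, Finset.card_univ, Fintype.card_fin, smul_eq_mul] at h1 h3
    omega

/-- The types of inner vertices of the disks in `coreDisk`. -/
def CoreType (U : Type) : Option (Fin 3) → Type
  | none => Fin 3 ⊕ Σ _ : Fin 3, U
  | some _ => U

instance : ∀ s, Fintype (CoreType U s)
  | none => inferInstanceAs (Fintype (Fin 3 ⊕ Σ _ : Fin 3, U))
  | some _ => inferInstanceAs (Fintype U)

/-- An octahedron with a disk at each side, and three more copies of this disk. -/
noncomputable def coreDisk (D : Disk U) : ∀ s, Disk (CoreType U s)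
  | none => glue octahedron sideFace fun _ => D
  | some _ => D

/-- The octahedron with `coreDisk D` drawn in its core. -/
noncomputable def coreWith (D : Disk U) := glue octahedron coreFace (coreDisk D)

theorem coreWith_isTotalBound {c : ℕ} (hD : D.IsInnerBound c) :
    (coreWith D).IsTotalBound (9 + 5 * c) := by
  intro V _ _ σ e h
  set e' : Fin 3 ⊕ (Fin 3 ⊕ Σ _ : Fin 3, U) → V := e ∘ emb (W := CoreType U) coreFace none with he'
  have h' : (glue octahedron sideFace fun _ => D).IsTour σ e' := IsTour.glue h none
  set d : Fin 3 → Fin 3 ⊕ U → V := fun i => e ∘ emb (W := CoreType U) coreFace (some i) with hd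
  have hi : ∀ i, D.IsTour σ (d i) := fun i => IsTour.glue h (some i)
  have h1 := visits_image_le (σ := σ) (e := e)
  have h2 := visits_inner_glue_le (f := coreFace) (σ := σ) (e := e)
  have h3 := visits_inner_glue_le (f := sideFace) (σ := σ) (e := e')
  have h4 := fun i => hD σ _ (h'.glue i)
  have h5 := fun i => hD σ _ (hi i)
  rw [Fintype.sum_option] at h2
  change visits σ (inner e) ≤ _ + (visits σ (inner e') + ∑ i, visits σ (inner (d i))) at h2
  rw [Fin.sum_univ_three, Fintype.card_fin] at h2 h3
  -- If all six disks were visited, at least three passages would join the central face to the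
  -- octahedron inside it, and three more would join it to the three disks around it. As entries and
  -- exits balance, there would be two entries on each side, but the three vertices of the face have
  -- only three successors.
  by_cases hall : (∀ i, 0 < visits σ (inner (e' ∘ emb sideFace i))) ∧
      ∀ i, 0 < visits σ (inner (d i))
  · exfalso
    obtain ⟨ha, hb⟩ := hall
    have hdis : ∀ i, Disjoint (inner e') (inner (d i)) := fun i =>
      disjoint_inner_glue (f := coreFace) (e := e) h.injective (s := none) (s' := some i) (by simp)
    have hE := h'.isEnclosed
    have h6 : 3 ≤ entries σ (ports e') (inner e') + entries σ⁻¹ (ports e') (inner e') := by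
      obtain ⟨u, hu, hu'⟩ := visits_pos.mp (hb 0)
      exact three_le_entries_sideFace h' ha (Finset.disjoint_right.mp (hdis 0) hu) hu'
    have hsub : ∀ i ∈ (Finset.univ : Finset (Fin 3)), inner (d i) ⊆ (inner e' ∪ ports e')ᶜ := by
      intro i _ v hv
      rw [Finset.mem_compl, Finset.mem_union, not_or]
      refine ⟨Finset.disjoint_right.mp (hdis i) hv, fun hp => ?_⟩
      obtain ⟨k, rfl⟩ := mem_ports.mp hp
      exact notMem_inner_glue (f := coreFace) h.injective (some i) (Sum.inr k) hv
    have hpd : ((Finset.univ : Finset (Fin 3)) : Set (Fin 3)).PairwiseDisjoint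
        fun i => inner (d i) := fun i _ j _ hij =>
      disjoint_inner_glue (f := coreFace) (e := e) h.injective (by simpa using hij)
    have h7 : ∀ τ : Equiv.Perm V,
        ∑ i, entries τ {d i (Sum.inl 2), d i (Sum.inl 0)} (inner (d i)) ≤
          entries τ (ports e') (inner e' ∪ ports e')ᶜ := fun τ =>
      (Finset.sum_le_sum fun i _ => entries_mono (fun v hv => by
        rw [Finset.mem_insert, Finset.mem_singleton] at hv
        rcases hv with rfl | rfl
        · exact mem_ports.mpr ⟨i + 1, rfl⟩
        · exact mem_ports.mpr ⟨i, rfl⟩) subset_rfl).trans (sum_entries_le hpd hsub)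
    have h8 : ∀ i ∈ (Finset.univ : Finset (Fin 3)), 1 ≤
        entries σ {d i (Sum.inl 2), d i (Sum.inl 0)} (inner (d i)) +
        entries σ⁻¹ {d i (Sum.inl 2), d i (Sum.inl 0)} (inner (d i)) := by
      intro i _
      obtain ⟨u, hu, hu'⟩ := visits_pos.mp (ha 0)
      have hu1 := inner_glue_subset 0 hu
      refine (hi i).one_le_entries 1 (hb i) (Finset.disjoint_left.mp (hdis i) hu1) ?_ hu'
      rintro rfl
      exact notMem_inner_glue (f := coreFace) h.injective none (Sum.inl (i + 1)) hu1
    have h9 := Finset.card_nsmul_le_sum _ _ _ h8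
    rw [Finset.sum_add_distrib] at h9
    have h10 := Nat.add_le_add (h7 σ) (h7 σ⁻¹)
    rw [hE.compl.entries_inv] at h10
    rw [hE.entries_inv] at h6
    have h11 := entries_add_entries_le (σ := σ) (P := ports e') (Z := inner e')
      (Z' := (inner e' ∪ ports e')ᶜ) (Finset.disjoint_left.mpr fun v hv hv' =>
        Finset.mem_compl.mp hv' (Finset.mem_union_left _ hv))
    have h12 := card_ports_le (e := e')
    simp only [Finset.card_univ, Fintype.card_fin, smul_eq_mul] at h9
    omega
  · have h40 := h4 0
    have h41 := h4 1
    have h42 := h4 2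
    have h50 := h5 0
    have h51 := h5 1
    have h52 := h5 2
    rw [not_and_or] at hall
    push Not at hall
    rcases hall with ⟨j, hj⟩ | ⟨j, hj⟩ <;> fin_cases j <;> simp at hj <;> omega

/-- The octahedron with a disk drawn in its central face. -/
noncomputable def beltWith (D : Disk U) := glue octahedron (fun _ : Unit => centralFace) fun _ => D

/-- The corners of the inserted disk are the inner vertices of the octahedron, so a bound for all
its vertices becomes a bound for inner vertices only. -/
theorem beltWith_isInnerBound {c : ℕ} (hD : D.IsTotalBound c) : (beltWith D).IsInnerBound c := by
  intro V _ _ σ e h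
  refine (visits_mono ?_).trans (hD σ _ (IsTour.glue h ()))
  intro v hv
  obtain ⟨i | ⟨_, w⟩, rfl⟩ := mem_inner.mp hv
  · exact Finset.mem_image.mpr ⟨Sum.inl i, Finset.mem_univ _, rfl⟩
  · exact Finset.mem_image.mpr ⟨Sum.inr w, Finset.mem_univ _, rfl⟩

end

end Disk

/-! ### Lower bounds: paths through disks -/

section Walks

variable {V : Type*} {G : SimpleGraph V}

open Classical in
/-- The vertices of a cycle of a graph are moved by a cyclic permutation. -/
theorem Walk.IsCycle.exists_perm [Fintype V] {v : V} {p : G.Walk v v} (hp : p.IsCycle) :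
    ∃ σ : Equiv.Perm V, σ.IsCycle ∧ (∀ u, σ u ≠ u → G.Adj u (σ u)) ∧
      σ.support.card = p.length := by
  have hlen : p.support.tail.length = p.length := by simp
  have h3 := hp.three_le_length
  have hnd := hp.support_nodup
  refine ⟨p.support.tail.formPerm, List.isCycle_formPerm hnd (by omega), fun u hu => ?_, ?_⟩
  · obtain ⟨i, hi, rfl⟩ := List.getElem_of_mem (List.mem_of_formPerm_apply_ne hu)
    rw [List.formPerm_apply_getElem _ hnd]
    simp only [List.getElem_tail, Walk.support_getElem_eq_getVert]
    rw [hlen] at hi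
    by_cases h : i + 1 = p.length
    · have : (i + 1) % p.support.tail.length = 0 := by rw [hlen, h, Nat.mod_self]
      rw [this, h, Walk.getVert_length, zero_add]
      simpa using p.adj_getVert_succ (i := 0) (by omega)
    · have : (i + 1) % p.support.tail.length = i + 1 := by
        rw [hlen]
        exact Nat.mod_eq_of_lt (by omega)
      rw [this]
      exact p.adj_getVert_succ (by omega)
  · rw [List.support_formPerm_of_nodup _ hnd (fun x hx => by rw [hx] at hlen; simp at hlen; omega),
      List.toFinset_card_of_nodup hnd, hlen]

/-- There is a path from `u` to `v` with `k` inner vertices, all of them in `T`. -/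
def Route (G : SimpleGraph V) (T : Set V) (k : ℕ) (u v : V) : Prop :=
  ∃ l : List V, List.IsChain G.Adj (u :: (l ++ [v])) ∧ l.Nodup ∧ l.length = k ∧ ∀ x ∈ l, x ∈ T

variable {T T' : Set V} {k k' : ℕ} {u v w : V}

theorem Route.mono (h : G.Route T k u v) (hT : T ⊆ T') : G.Route T' k u v := by
  obtain ⟨l, h1, h2, h3, h4⟩ := h
  exact ⟨l, h1, h2, h3, fun x hx => hT (h4 x hx)⟩

theorem Route.of_adj (h : G.Adj u v) : G.Route ∅ 0 u v := ⟨[], by simp [h], by simp, rfl, by simp⟩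

theorem Route.trans (h : G.Route T k u v) (h' : G.Route T' k' v w) (hd : Disjoint T T')
    (hv : v ∉ T) (hv' : v ∉ T') : G.Route (insert v (T ∪ T')) (k + k' + 1) u w := by
  obtain ⟨l, h1, h2, h3, h4⟩ := h
  obtain ⟨l', h1', h2', h3', h4'⟩ := h'
  refine ⟨l ++ v :: l', ?_, ?_, by simp [h3, h3']; omega, ?_⟩
  · have := List.isChain_cons_split (R := G.Adj) (a := u) (c := v) (l₁ := l) (l₂ := l' ++ [w])
    simp only [List.append_assoc, List.cons_append]
    exact this.mpr ⟨h1, h1'⟩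
  · rw [List.nodup_append]
    refine ⟨h2, List.nodup_cons.mpr ⟨fun h => hv' (h4' v h), h2'⟩, fun x hx y hy hxy => ?_⟩
    subst hxy
    rcases List.mem_cons.mp hy with rfl | hy
    · exact hv (h4 _ hx)
    · exact Set.disjoint_left.mp hd (h4 x hx) (h4' x hy)
  · intro x hx
    rw [List.mem_append, List.mem_cons] at hx
    rcases hx with hx | rfl | hx
    · exact Or.inr (Or.inl (h4 x hx))
    · exact Or.inl rfl
    · exact Or.inr (Or.inr (h4' x hx))

theorem Route.symm (h : G.Route T k u v) : G.Route T k v u := by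
  obtain ⟨l, h1, h2, h3, h4⟩ := h
  refine ⟨l.reverse, ?_, List.nodup_reverse.mpr h2, by simpa using h3, by simpa using h4⟩
  have : v :: (l.reverse ++ [u]) = (u :: (l ++ [v])).reverse := by simp
  rw [this, List.isChain_reverse]
  exact h1.imp fun _ _ h => h.symm

theorem Route.map {V' : Type*} {G' : SimpleGraph V'} (φ : V → V') (hφ : Function.Injective φ)
    (hadj : ∀ x y, G.Adj x y → G'.Adj (φ x) (φ y)) (h : G.Route T k u v) :
    G'.Route (φ '' T) k (φ u) (φ v) := by
  obtain ⟨l, h1, h2, h3, h4⟩ := h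
  refine ⟨l.map φ, ?_, h2.map hφ, by simpa using h3, ?_⟩
  · have : φ u :: (l.map φ ++ [φ v]) = (u :: (l ++ [v])).map φ := by simp
    rw [this]
    exact List.isChain_map_of_isChain φ hadj h1
  · intro x hx
    obtain ⟨y, hy, rfl⟩ := List.mem_map.mp hx
    exact ⟨y, h4 y hy, rfl⟩

theorem Route.exists_isCycle (h : G.Route T k u v) (hk : 0 < k) (huv : G.Adj v u) (hu : u ∉ T)
    (hv : v ∉ T) : ∃ (x : V) (p : G.Walk x x), p.IsCycle ∧ p.length = k + 2 := by
  obtain ⟨l, h1, h2, h3, h4⟩ := h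
  have hnd : (u :: (l ++ [v])).Nodup := by
    rw [List.nodup_cons, List.nodup_append, List.mem_append, List.mem_singleton, not_or]
    refine ⟨⟨fun h => hu (h4 u h), huv.ne'⟩, h2, List.nodup_singleton v, fun x hx y hy => ?_⟩
    rw [List.mem_singleton] at hy
    rintro rfl
    exact hv (hy ▸ h4 x hx)
  set p := Walk.ofSupport _ (List.cons_ne_nil u (l ++ [v])) h1 with hp
  have hsupp : p.support = u :: (l ++ [v]) := Walk.support_ofSupport _ _
  have hlen : p.length = k + 1 := by rw [Walk.length_ofSupport]; simp [h3]
  have hpath : p.IsPath := .mk' (by rw [hsupp]; exact hnd)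
  have hlast : (u :: (l ++ [v])).getLast (List.cons_ne_nil u (l ++ [v])) = v := by simp
  have hadj : G.Adj ((u :: (l ++ [v])).getLast (List.cons_ne_nil u (l ++ [v])))
      ((u :: (l ++ [v])).head (List.cons_ne_nil u (l ++ [v]))) := by rwa [hlast]
  refine ⟨_, Walk.cons hadj p, (Walk.cons_isCycle_iff p hadj).mpr ⟨hpath, fun he => ?_⟩, ?_⟩
  · have := hpath.length_eq_one_of_mem_edges (Sym2.eq_swap ▸ he)
    omega
  · rw [Walk.length_cons, hlen]

theorem Route.exists_isCycle_of_closed (h : G.Route T k u u) (hk : 2 ≤ k) (hu : u ∉ T) :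
    ∃ (x : V) (p : G.Walk x x), p.IsCycle ∧ p.length = k + 1 := by
  obtain ⟨_ | ⟨x, l⟩, h1, h2, h3, h4⟩ := h
  · simp only [List.length_nil] at h3
    omega
  · rw [List.cons_append, List.isChain_cons_cons] at h1
    rw [List.nodup_cons] at h2
    rw [List.length_cons] at h3
    obtain ⟨y, p, hp, hl⟩ := Route.exists_isCycle (T := {y | y ∈ l})
      ⟨l, h1.2, h2.2, rfl, fun _ h => h⟩ (by omega) h1.1 h2.1 fun h => hu (h4 u (List.mem_cons_of_mem x h))
    exact ⟨y, p, hp, by omega⟩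

end Walks

namespace Disk

section Routes

variable {U : Type}

/-- There is a path from corner `i` to corner `j` with `k` inner vertices of the disk. -/
def HasPass (E : Disk U) (i j : Fin 3) (k : ℕ) : Prop :=
  E.graph.Route (Set.range Sum.inr) k (Sum.inl i) (Sum.inl j)

/-- There is a path from corner `i` to corner `j` through the third corner `m`, with `k` inner
vertices of the disk. -/
def HasDoublePass (E : Disk U) (i m j : Fin 3) (k : ℕ) : Prop :=
  E.graph.Route (insert (Sum.inl m) (Set.range Sum.inr)) (k + 1) (Sum.inl i) (Sum.inl j)

theorem HasPass.symm {E : Disk U} {i j : Fin 3} {k : ℕ} (h : E.HasPass i j k) : E.HasPass j i k :=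
  Route.symm h

theorem HasDoublePass.symm {E : Disk U} {i m j : Fin 3} {k : ℕ} (h : E.HasDoublePass i m j k) :
    E.HasDoublePass j m i k := Route.symm h

/-- There is a path from the corner `2` to the corner `0` that visits `k` vertices altogether. -/
def HasSpan (E : Disk U) (k : ℕ) : Prop :=
  2 ≤ k ∧ E.graph.Route {Sum.inl 2, Sum.inl 0}ᶜ (k - 2) (Sum.inl 2) (Sum.inl 0)

theorem HasSpan.exists_isCycle {E : Disk U} {k : ℕ} (h : E.HasSpan k) (hk : 3 ≤ k)
    (hE : E.IsPlane) : ∃ (x : Fin 3 ⊕ U) (p : E.graph.Walk x x), p.IsCycle ∧ p.length = k := by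
  obtain ⟨x, p, hp, hl⟩ := Route.exists_isCycle h.2 (by omega) (hE.adj_corner 2).symm (by simp)
    (by simp)
  exact ⟨x, p, hp, by omega⟩

end Routes

section Itinerary

variable {N S : Type} {W : S → Type} {M : Disk N} {f : S → Fin 3 ↪ Fin 3 ⊕ N}
  {D : ∀ s, Disk (W s)}

/-- The position of a vertex: a vertex of the host, or the interior of an inserted disk. -/
def position : Fin 3 ⊕ (N ⊕ Σ s, W s) → (Fin 3 ⊕ N) ⊕ S
  | .inl i => .inl (.inl i)
  | .inr (.inl n) => .inl (.inr n)
  | .inr (.inr p) => .inr p.1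

theorem position_incl (x : Fin 3 ⊕ N) : position (incl (Σ s, W s) x) = Sum.inl x := by
  rcases x with i | n <;> rfl

/-- In the glued graph there is a path from `x` to `y` with `k` inner vertices, which have the
positions listed in `L`, if this list is free of repetitions. -/
def Itinerary (M : Disk N) (f : S → Fin 3 ↪ Fin 3 ⊕ N) (D : ∀ s, Disk (W s)) (x : Fin 3 ⊕ N)
    (L : List ((Fin 3 ⊕ N) ⊕ S)) (k : ℕ) (y : Fin 3 ⊕ N) : Prop :=
  L.Nodup → (glue M f D).graph.Route {v | position v ∈ L} k (incl _ x) (incl _ y)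

namespace Itinerary

theorem of_adj {x y : Fin 3 ⊕ N} (h : M.graph.Adj x y) : Itinerary M f D x [] 0 y := fun _ =>
  (Route.of_adj (glue_adj_base h)).mono (Set.empty_subset _)

theorem of_hasPass {s : S} {i j : Fin 3} {k : ℕ} (h : (D s).HasPass i j k) :
    Itinerary M f D (f s i) [Sum.inr s] k (f s j) := fun _ => by
  refine (Route.map (emb f s) (emb_injective f s) (fun _ _ => glue_adj_disk) h).mono ?_
  rintro _ ⟨_, ⟨w, rfl⟩, rfl⟩
  exact List.mem_singleton_self _

theorem of_hasDoublePass {s : S} {i m j : Fin 3} {k : ℕ} (h : (D s).HasDoublePass i m j k) :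
    Itinerary M f D (f s i) [Sum.inl (f s m), Sum.inr s] (k + 1) (f s j) := fun _ => by
  refine (Route.map (emb f s) (emb_injective f s) (fun _ _ => glue_adj_disk) h).mono ?_
  rintro _ ⟨_, rfl | ⟨w, rfl⟩, rfl⟩
  · exact List.mem_cons.mpr (Or.inl (position_incl _))
  · exact List.mem_cons_of_mem _ (List.mem_singleton_self _)

theorem trans {x y z : Fin 3 ⊕ N} {L L' : List ((Fin 3 ⊕ N) ⊕ S)} {k k' : ℕ}
    (h : Itinerary M f D x L k y) (h' : Itinerary M f D y L' k' z) :
    Itinerary M f D x (L ++ Sum.inl y :: L') (k + k' + 1) z := fun hL => by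
  rw [List.nodup_append, List.nodup_cons] at hL
  obtain ⟨h1, ⟨h2, h3⟩, h4⟩ := hL
  refine ((h h1).trans (h' h3) (Set.disjoint_left.mpr fun v hv hv' => ?_) ?_ ?_).mono ?_
  · exact h4 _ hv _ (List.mem_cons_of_mem _ hv') rfl
  · intro hy
    rw [Set.mem_ofPred_eq, position_incl] at hy
    exact h4 _ hy _ List.mem_cons_self rfl
  · intro hy
    rw [Set.mem_ofPred_eq, position_incl] at hy
    exact h2 hy
  · rintro v (rfl | hv | hv)
    · exact List.mem_append_right _ (List.mem_cons.mpr (Or.inl (position_incl _)))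
    · exact List.mem_append_left _ hv
    · exact List.mem_append_right _ (List.mem_cons_of_mem _ hv)

theorem hasPass {i j : Fin 3} {L : List ((Fin 3 ⊕ N) ⊕ S)} {k k' : ℕ}
    (h : Itinerary M f D (Sum.inl i) L k' (Sum.inl j)) (hk : k' = k) (hL : L.Nodup)
    (hi : ∀ i, Sum.inl (Sum.inl i) ∉ L) : (glue M f D).HasPass i j k :=
  hk ▸ (h hL).mono fun v hv => by
    rcases v with i | w
    · exact absurd hv (hi i)
    · exact ⟨w, rfl⟩

theorem hasDoublePass {i m j : Fin 3} {L : List ((Fin 3 ⊕ N) ⊕ S)} {k k' : ℕ}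
    (h : Itinerary M f D (Sum.inl i) L k' (Sum.inl j)) (hk : k' = k + 1) (hL : L.Nodup)
    (hi : ∀ i, Sum.inl (Sum.inl i) ∈ L → i = m) : (glue M f D).HasDoublePass i m j k := by
  subst hk
  refine (h hL).mono fun v hv => by
    rcases v with i | w
    · exact Or.inl (congrArg _ (hi i hv))
    · exact Or.inr ⟨w, rfl⟩

theorem hasSpan {L : List ((Fin 3 ⊕ N) ⊕ S)} {k k' : ℕ}
    (h : Itinerary M f D (Sum.inl 2) L k' (Sum.inl 0)) (hk : k = k' + 2)
    (hL : (Sum.inl (Sum.inl 2) :: Sum.inl (Sum.inl 0) :: L).Nodup) :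
    (glue M f D).HasSpan k := by
  subst hk
  rw [List.nodup_cons, List.nodup_cons] at hL
  refine ⟨by omega, (h hL.2.2).mono fun v hv => ?_⟩
  rintro (rfl | rfl)
  · exact hL.1 (List.mem_cons_of_mem _ hv)
  · exact hL.2.1 hv

end Itinerary

end Itinerary

section Patterns

variable {U : Type} {D : Disk U} {p q : ℕ}

theorem tetrahedron_hasPass (i : Fin 3) : tetrahedron.HasPass i (i + 1) 1 :=
  ⟨[Sum.inr ()], by decide +revert, by simp, rfl, by simp⟩

theorem tetrahedron_hasDoublePass (i : Fin 3) : tetrahedron.HasDoublePass (i + 2) i (i + 1) 1 :=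
  ⟨[Sum.inr (), Sum.inl i], by decide +revert, by simp, rfl, by simp⟩

/-- The path uses all three inner vertices and the two side disks that meet corner i or i + 1 but
not both. -/
theorem sideFace_hasPass (h : ∀ i, D.HasPass i (i + 1) p) (i : Fin 3) :
    (glue octahedron sideFace fun _ => D).HasPass i (i + 1) (2 * p + 3) := by
  have h1 : Itinerary octahedron sideFace (fun _ => D) (Sum.inl i) [Sum.inr (i + 2)] p
      (Sum.inr (i + 2)) := by
    have := Itinerary.of_hasPass (M := octahedron) (f := sideFace) (D := fun _ => D) (s := i + 2)
      (h 1)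
    have e : sideFace (i + 2) 1 = Sum.inl i := by clear * - i; revert i; decide
    rwa [e] at this
  have h2 : Itinerary octahedron sideFace (fun _ => D) (Sum.inr (i + 1)) [Sum.inr (i + 1)] p
      (Sum.inl (i + 1)) :=
    Itinerary.of_hasPass (M := octahedron) (f := sideFace) (D := fun _ => D) (s := i + 1) (h 2)
  have a1 : octahedron.graph.Adj (Sum.inr (i + 2)) (Sum.inr i) := by clear * - i; revert i; decide
  have a2 : octahedron.graph.Adj (Sum.inr i) (Sum.inr (i + 1)) := by clear * - i; revert i; decide
  exact (h1.trans ((Itinerary.of_adj a1).trans ((Itinerary.of_adj a2).trans h2))).hasPass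
    (by omega) (by clear * - i; revert i; decide) (by simp)

/-- The first side disk is passed twice, by way of its third corner `Sum.inr (i + 2)`; the other two
are passed once. -/
theorem sideFace_hasDoublePass (h : ∀ i, D.HasPass i (i + 1) p)
    (h' : ∀ i, D.HasDoublePass (i + 2) i (i + 1) q) (i : Fin 3) :
    (glue octahedron sideFace fun _ => D).HasDoublePass (i + 2) i (i + 1) (q + 2 * p + 3) := by
  have h1 : Itinerary octahedron sideFace (fun _ => D) (Sum.inl (i + 2))
      [Sum.inl (Sum.inr (i + 2)), Sum.inr (i + 2)] (q + 1) (Sum.inl i) := by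
    have := Itinerary.of_hasDoublePass (M := octahedron) (f := sideFace) (D := fun _ => D)
      (s := i + 2) (h' 2).symm
    have e : sideFace (i + 2) (2 + 2) = Sum.inl i := by clear * - i; revert i; decide
    rwa [e] at this
  have h2 : Itinerary octahedron sideFace (fun _ => D) (Sum.inl i) [Sum.inr i] p (Sum.inr i) :=
    Itinerary.of_hasPass (M := octahedron) (f := sideFace) (D := fun _ => D) (s := i) (h 2).symm
  have h3 : Itinerary octahedron sideFace (fun _ => D) (Sum.inr (i + 1)) [Sum.inr (i + 1)] p
      (Sum.inl (i + 1)) :=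
    Itinerary.of_hasPass (M := octahedron) (f := sideFace) (D := fun _ => D) (s := i + 1) (h 2)
  have a : octahedron.graph.Adj (Sum.inr i) (Sum.inr (i + 1)) := by clear * - i; revert i; decide
  exact (h1.trans (h2.trans ((Itinerary.of_adj a).trans h3))).hasDoublePass (by omega)
    (by clear * - i; revert i; decide) (by simp)

/-- A double pass that visits every inserted disk in a single pass. -/
theorem sideFace_hasDoublePass_of_hasPass (h : ∀ i, D.HasPass i (i + 1) p) (i : Fin 3) :
    (glue octahedron sideFace fun _ => D).HasDoublePass (i + 2) i (i + 1) (3 * p + 3) := by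
  have h1 : Itinerary octahedron sideFace (fun _ => D) (Sum.inr (i + 2)) [Sum.inr (i + 2)] p
      (Sum.inl i) := by
    have := Itinerary.of_hasPass (M := octahedron) (f := sideFace) (D := fun _ => D)
      (s := i + 2) (h 1).symm
    have e : sideFace (i + 2) 1 = Sum.inl i := by clear * - i; revert i; decide
    rwa [e] at this
  have h2 : Itinerary octahedron sideFace (fun _ => D) (Sum.inl i) [Sum.inr i] p (Sum.inr i) :=
    Itinerary.of_hasPass (M := octahedron) (f := sideFace) (D := fun _ => D) (s := i) (h 2).symm
  have h3 : Itinerary octahedron sideFace (fun _ => D) (Sum.inr (i + 1)) [Sum.inr (i + 1)] p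
      (Sum.inl (i + 1)) :=
    Itinerary.of_hasPass (M := octahedron) (f := sideFace) (D := fun _ => D) (s := i + 1) (h 2)
  have a : octahedron.graph.Adj (Sum.inr i) (Sum.inr (i + 1)) := by clear * - i; revert i; decide
  have a' : octahedron.graph.Adj (Sum.inl (i + 2)) (Sum.inr (i + 2)) := by clear * - i; revert i; decide
  exact ((Itinerary.of_adj a').trans (h1.trans (h2.trans ((Itinerary.of_adj a).trans
    h3)))).hasDoublePass (by omega) (by clear * - i; revert i; decide) (by simp)

/-- A cycle that passes twice through each of the inserted disks. -/
theorem sideFace_exists_isCycle (h : ∀ i, D.HasDoublePass (i + 2) i (i + 1) q) :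
    ∃ (x : _) (p : (glue octahedron sideFace fun _ => D).graph.Walk x x),
      p.IsCycle ∧ p.length = 3 * q + 6 := by
  have h1 : ∀ i, Itinerary octahedron sideFace (fun _ => D) (Sum.inl (i + 1))
      [Sum.inl (Sum.inr i), Sum.inr i] (q + 1) (Sum.inl i) := fun i =>
    Itinerary.of_hasDoublePass (M := octahedron) (f := sideFace) (D := fun _ => D) (s := i) (h 2)
  have h2 : Itinerary octahedron sideFace (fun _ => D) (Sum.inl 0)
      [Sum.inl (Sum.inr 2), Sum.inr 2] (q + 1) (Sum.inl 2) := h1 2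
  obtain ⟨x, p, hp, hl⟩ := Route.exists_isCycle_of_closed ((h2.trans ((h1 1).trans (h1 0)))
    (by decide)) (by omega) (by
      rw [Set.mem_ofPred_eq, position_incl]
      simp)
  exact ⟨x, p, hp, by omega⟩

/-- A span of a disk that is drawn in the central face of an octahedron. -/
theorem beltWith_hasPass (h : D.HasSpan p) (i : Fin 3) : (beltWith D).HasPass i (i + 1) p := by
  have key : ∀ x y : Fin 3, octahedron.graph.Adj (Sum.inl x) (Sum.inr 2) →
      octahedron.graph.Adj (Sum.inr 0) (Sum.inl y) → (beltWith D).HasPass x y p := by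
    intro x y hx hy
    have hR := Route.map (G' := (beltWith D).graph) (emb (fun _ : Unit => centralFace) ())
      (emb_injective _ _) (fun _ _ => glue_adj_disk (D := fun _ : Unit => D)) h.2
    have hx' : (beltWith D).graph.Route ∅ 0 (Sum.inl x) (Sum.inr (Sum.inl 2)) :=
      .of_adj (glue_adj_base hx)
    have hy' : (beltWith D).graph.Route ∅ 0 (Sum.inr (Sum.inl 0)) (Sum.inl y) :=
      .of_adj (glue_adj_base hy)
    have h1 := hR.trans (v := Sum.inr (Sum.inl 0)) hy' (by simp) ?_ (by simp)
    · have h2 := hx'.trans h1 (by simp) (by simp) ?_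
      · have hp : 0 + (p - 2 + 0 + 1) + 1 = p := by have := h.1; omega
        rw [hp] at h2
        refine h2.mono ?_
        rintro v (rfl | hv | rfl | ⟨i | w, -, rfl⟩ | hv)
        · exact ⟨_, rfl⟩
        · exact absurd hv (Set.notMem_empty _)
        · exact ⟨_, rfl⟩
        · exact ⟨_, rfl⟩
        · exact ⟨_, rfl⟩
        · exact absurd hv (Set.notMem_empty _)
      · rintro (h' | ⟨x, hx, h'⟩ | h')
        · simp at h'
        · exact hx (Or.inl (emb_injective (fun _ : Unit => centralFace) () (a₂ := Sum.inl 2) h'))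
        · exact h'
    · rintro ⟨x, hx, h'⟩
      exact hx (Or.inr (emb_injective (fun _ : Unit => centralFace) () (a₂ := Sum.inl 0) h'))
  -- One end of the span is adjacent to the corners 2 and 0, the other to 0 and 1; up to reversal
  -- this serves all three pairs.
  fin_cases i
  · exact key 0 1 (by decide) (by decide)
  · exact (key 2 1 (by decide) (by decide)).symm
  · exact key 2 0 (by decide) (by decide)

/-- A span of `coreWith D` that misses only one of the copies of `D`. -/
theorem coreWith_hasSpan (h : ∀ i, D.HasPass i (i + 1) p) : (coreWith D).HasSpan (9 + 5 * p) := by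
  have h1 : Itinerary octahedron coreFace (coreDisk D) (Sum.inl 1) [Sum.inr (some 0)] p
      (Sum.inr 0) :=
    Itinerary.of_hasPass (M := octahedron) (f := coreFace) (D := coreDisk D) (s := some 0)
      (i := 1) (j := 0) (HasPass.symm (h 0))
  have h2 : Itinerary octahedron coreFace (coreDisk D) (Sum.inr 0)
      [Sum.inl (Sum.inr 1), Sum.inr none] (3 * p + 3 + 1) (Sum.inr 2) :=
    Itinerary.of_hasDoublePass (M := octahedron) (f := coreFace) (D := coreDisk D) (s := none)
      (i := 0) (m := 1) (j := 2) (sideFace_hasDoublePass_of_hasPass h 1)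
  have h3 : Itinerary octahedron coreFace (coreDisk D) (Sum.inr 2) [Sum.inr (some 2)] p
      (Sum.inl 0) :=
    Itinerary.of_hasPass (M := octahedron) (f := coreFace) (D := coreDisk D) (s := some 2)
      (i := 0) (j := 1) (h 0)
  have a : octahedron.graph.Adj (Sum.inl 2) (Sum.inl 1) := by decide
  exact ((Itinerary.of_adj a).trans (h1.trans (h2.trans h3))).hasSpan (by omega) (by decide)

set_option maxRecDepth 100000 in
/-- A span of `hubWith D` that visits all of the inserted disks, except for one in each of eight of
the octahedra. -/
theorem hubWith_hasSpan (h : ∀ i, D.HasPass i (i + 1) p) : (hubWith D).HasSpan (72 + 22 * p) := by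
  have hs : ∀ s, Itinerary hub hubFace (fun _ => glue octahedron sideFace fun _ => D) (hubB s)
      [Sum.inr s] (2 * p + 3) (hubC s) := fun s =>
    Itinerary.of_hasPass (M := hub) (f := hubFace)
      (D := fun _ => glue octahedron sideFace fun _ => D) (i := 0) (j := 1) (sideFace_hasPass h 0)
  -- The octahedra 7 and 8 are passed in succession through p. They are the two in which all three
  -- disks are visited.
  have h7 : Itinerary hub hubFace (fun _ => glue octahedron sideFace fun _ => D) (hubB 7)
      [Sum.inl (hubC 7), Sum.inr 7] (3 * p + 3 + 1) hubP :=
    Itinerary.of_hasDoublePass (M := hub) (f := hubFace)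
      (D := fun _ => glue octahedron sideFace fun _ => D) (s := 7) (i := 0) (m := 1) (j := 2)
      (sideFace_hasDoublePass_of_hasPass h 1)
  have h8 : Itinerary hub hubFace (fun _ => glue octahedron sideFace fun _ => D) hubP
      [Sum.inl (hubB 8), Sum.inr 8] (3 * p + 3 + 1) (hubC 8) :=
    Itinerary.of_hasDoublePass (M := hub) (f := hubFace)
      (D := fun _ => glue octahedron sideFace fun _ => D) (s := 8) (i := 2) (m := 0) (j := 1)
      (sideFace_hasDoublePass_of_hasPass h 0)
  have block : ∀ s, Itinerary hub hubFace (fun _ => glue octahedron sideFace fun _ => D) (hubB s)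
      ([Sum.inr s, Sum.inl (hubC s), Sum.inl (hubY s), Sum.inl (hubG s)]) (2 * p + 6)
      (hubB (s + 1)) := by
    intro s
    have a1 : hub.graph.Adj (hubC s) (hubY s) := (hub_adj_outer s).2.1
    have a2 : hub.graph.Adj (hubY s) (hubG s) := (hub_adj_outer s).2.2.1.symm
    have a3 : hub.graph.Adj (hubG s) (hubB (s + 1)) := by revert s; decide
    have := (hs s).trans ((Itinerary.of_adj a1).trans ((Itinerary.of_adj a2).trans
      (Itinerary.of_adj a3)))
    have e : 2 * p + 3 + (0 + (0 + 0 + 1) + 1) + 1 = 2 * p + 6 := by omega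
    rwa [e] at this
  have e9 : hubY 9 = Sum.inl 2 := by decide
  have eq : hubQ = Sum.inl 0 := by decide
  have a1 : hub.graph.Adj (Sum.inl 2) (hubB 9) := e9 ▸ (hub_adj_outer 9).1.symm
  have a2 : hub.graph.Adj (hubC 9) (hubG 9) := (hub_adj_ring 9).2.1
  have a3 : hub.graph.Adj (hubG 9) (hubB 0) := (hub_adj_ring 0).2.2.1.symm
  have a4 : hub.graph.Adj (hubC 8) (hubG 8) := (hub_adj_ring 8).2.1
  have a5 : hub.graph.Adj (hubG 8) (hubY 8) := (hub_adj_outer 8).2.2.1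
  have a6 : hub.graph.Adj (hubY 8) (hubG 7) := (hub_adj_outer 8).2.2.2.1
  have a7 : hub.graph.Adj (hubG 7) (hubY 7) := (hub_adj_outer 7).2.2.1
  have a8 : hub.graph.Adj (hubY 7) (Sum.inl 0) := eq ▸ (hub_adj_outer 7).2.2.2.2.1
  exact ((Itinerary.of_adj a1).trans <| (hs 9).trans <| (Itinerary.of_adj a2).trans <|
    (Itinerary.of_adj a3).trans <| (block 0).trans <| (block 1).trans <| (block 2).trans <|
    (block 3).trans <| (block 4).trans <| (block 5).trans <| (block 6).trans <| h7.trans <|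
    h8.trans <| (Itinerary.of_adj a4).trans <| (Itinerary.of_adj a5).trans <|
    (Itinerary.of_adj a6).trans <| (Itinerary.of_adj a7).trans <|
    Itinerary.of_adj a8).hasSpan (by omega) (by decide)

end Patterns

/-! ### Iteration and the three families -/

section Longest

variable {U : Type} [Fintype U] {D : Disk U} {c : ℕ}

theorem IsTotalBound.longestCycleHasCard (hD : D.IsTotalBound c)
    (h : ∃ (x : Fin 3 ⊕ U) (p : D.graph.Walk x x), p.IsCycle ∧ p.length = c) :
    D.graph.LongestCycleHasCard c := by
  classical
  refine ⟨h, ?_⟩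
  rintro _ ⟨v, p, hp, rfl⟩
  obtain ⟨σ, h1, h2, h3⟩ := hp.exists_perm
  -- The bound for cycles of larger graphs is applied to the disk itself.
  have hT : D.IsTour σ id :=
    { isCycle := h1
      injective := Function.injective_id
      apply_eq := fun w hw => ⟨_, h2 _ hw, rfl⟩
      inv_apply_eq := fun w hw => by
        refine ⟨_, ?_, rfl⟩
        have := h2 (σ⁻¹ (Sum.inr w)) fun h' => hw (by
          rw [Equiv.Perm.coe_inv, Equiv.apply_symm_apply] at h'
          exact (Equiv.eq_symm_apply σ).mp h')
        rw [Equiv.Perm.coe_inv, Equiv.apply_symm_apply] at this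
        exact this.symm }
  have := hD σ id hT
  rw [visits, Finset.image_id, Finset.univ_inter] at this
  rw [← h3]
  convert this

end Longest

/-- A disk that can be inserted into faces: a lower bound for the sizes of separating sets, and the
maximum number of its inner vertices on a cycle of a larger graph. -/
structure IsPatch {U : Type} [Fintype U] (D : Disk U) (α β c : ℕ) : Prop where
  isPlane : D.IsPlane
  isTough : D.IsTough α β β 0 β
  isInnerBound : D.IsInnerBound c
  hasPass : ∀ i, D.HasPass i (i + 1) c

theorem tetrahedron_isPatch (α β : ℕ) : tetrahedron.IsPatch α β 1 :=
  ⟨tetrahedron_isPlane, tetrahedron_isTough, tetrahedron_isInnerBound, tetrahedron_hasPass⟩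

section Fintype

variable {U : Type} [Fintype U]

theorem card_glue {N S : Type} {W : S → Type} [Fintype N] [Fintype S] [∀ s, Fintype (W s)] :
    Fintype.card (N ⊕ Σ s, W s) = Fintype.card N + ∑ s, Fintype.card (W s) := by
  rw [Fintype.card_sum, Fintype.card_sigma]

theorem card_side : Fintype.card (Fin 3 ⊕ Σ _ : Fin 3, U) = 3 + 3 * Fintype.card U := by
  rw [card_glue]
  simp

variable {D : Disk U} {c : ℕ}

theorem hubWith_isPlane (hD : D.IsPlane) : (hubWith D).IsPlane :=
  hub_isPlane.glue isFaces_hubFace fun _ => octahedron_isPlane.glue isFaces_sideFace fun _ => hD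

omit [Fintype U] in
theorem hubWith_isTough (hD : D.IsTough 4 5 5 0 5) : (hubWith D).IsTough 4 5 7 3 5 :=
  isToughHost_hubFace.glue (by omega) fun _ =>
    isToughHost_sideFace_four_five.glue (by omega) fun _ => hD

theorem coreWith_isPlane (hD : D.IsPlane) : (coreWith D).IsPlane := by
  have : ∀ s, Finite (CoreType U s) := fun s => Finite.of_fintype _
  refine octahedron_isPlane.glue isFaces_coreFace ?_
  rintro (_ | i)
  · exact octahedron_isPlane.glue isFaces_sideFace fun _ => hD
  · exact hD

omit [Fintype U] in
theorem coreWith_isTough (hD : D.IsTough 7 8 8 0 8) : (coreWith D).IsTough 7 8 13 6 8 := by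
  refine isToughHost_coreFace.glue (by omega) ?_
  rintro (_ | i)
  · exact isToughHost_sideFace_seven_eight.glue (by omega) fun _ => hD
  · exact hD

theorem beltWith_isPlane (hD : D.IsPlane) : (beltWith D).IsPlane :=
  octahedron_isPlane.glue isFaces_centralFace fun _ => hD

end Fintype

theorem hub_cycle_succ (n : ℕ) : 1 + 93 * ∑ k ∈ Finset.range (n + 1), 22 ^ k =
    72 + 22 * (1 + 93 * ∑ k ∈ Finset.range n, 22 ^ k) := by
  rw [geom_sum_succ]
  ring

theorem core_cycle_succ (n : ℕ) : 1 + 13 * ∑ k ∈ Finset.range (n + 1), 5 ^ k =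
    9 + 5 * (1 + 13 * ∑ k ∈ Finset.range n, 5 ^ k) := by
  rw [geom_sum_succ]
  ring

/-- Iterating the construction with the hub. -/
theorem exists_isPatch_four_five (n : ℕ) : ∃ (U : Type) (_ : Fintype U) (D : Disk U),
    D.IsPatch 4 5 (1 + 93 * ∑ k ∈ Finset.range n, 22 ^ k) ∧
      Fintype.card U = 1 + 101 * ∑ k ∈ Finset.range n, 30 ^ k := by
  induction n with
  | zero => exact ⟨Unit, inferInstance, tetrahedron, tetrahedron_isPatch 4 5, by simp⟩
  | succ n ih =>
    obtain ⟨U, _, D, hD, hU⟩ := ih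
    refine ⟨_, inferInstance, beltWith (hubWith D), ⟨beltWith_isPlane (hubWith_isPlane hD.isPlane),
      isToughHost_centralFace_four_five.glue (by omega) fun _ => hubWith_isTough hD.isTough,
      ?_, ?_⟩, ?_⟩
    · rw [hub_cycle_succ]
      exact beltWith_isInnerBound (hubWith_isTotalBound hD.isInnerBound)
    · rw [hub_cycle_succ]
      exact beltWith_hasPass (hubWith_hasSpan hD.hasPass)
    · simp only [card_glue, hU, geom_sum_succ, Finset.sum_const, Finset.card_univ,
        Fintype.card_fin, Fintype.card_unit, smul_eq_mul]
      ring

theorem card_core {U : Type} [Fintype U] :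
    Fintype.card (Fin 3 ⊕ Σ s, CoreType U s) = 6 + 6 * Fintype.card U := by
  have h : Fintype.card (CoreType U none) = 3 + 3 * Fintype.card U := card_side
  have h' : ∀ i, Fintype.card (CoreType U (some i)) = Fintype.card U := fun _ => rfl
  rw [card_glue, Fintype.sum_option, h]
  simp only [h', Finset.sum_const, Finset.card_univ, Fintype.card_fin, smul_eq_mul]
  ring

/-- Iterating the construction with the octahedron. -/
theorem exists_isPatch_seven_eight (n : ℕ) : ∃ (U : Type) (_ : Fintype U) (D : Disk U),
    D.IsPatch 7 8 (1 + 13 * ∑ k ∈ Finset.range n, 5 ^ k) ∧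
      Fintype.card U = 1 + 14 * ∑ k ∈ Finset.range n, 6 ^ k := by
  induction n with
  | zero => exact ⟨Unit, inferInstance, tetrahedron, tetrahedron_isPatch 7 8, by simp⟩
  | succ n ih =>
    obtain ⟨U, _, D, hD, hU⟩ := ih
    refine ⟨_, inferInstance, beltWith (coreWith D), ⟨beltWith_isPlane (coreWith_isPlane
      hD.isPlane), isToughHost_centralFace_seven_eight.glue (by omega) fun _ =>
      coreWith_isTough hD.isTough, ?_, ?_⟩, ?_⟩
    · rw [core_cycle_succ]
      exact beltWith_isInnerBound (coreWith_isTotalBound hD.isInnerBound)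
    · rw [core_cycle_succ]
      exact beltWith_hasPass (coreWith_hasSpan hD.hasPass)
    · rw [card_glue]
      simp only [card_core, hU, geom_sum_succ, Finset.sum_const, Finset.card_univ,
        Fintype.card_fin, Fintype.card_unit, smul_eq_mul]
      ring

/-- Iterating the octahedron with disks at its sides. -/
theorem exists_isPassBound (n : ℕ) : ∃ (U : Type) (_ : Fintype U) (D : Disk U) (p q r : ℕ),
    D.IsPlane ∧ D.IsTough 1 1 1 0 2 ∧ D.IsPassBound p q r ∧ (∀ i, D.HasPass i (i + 1) p) ∧
      (∀ i, D.HasDoublePass (i + 2) i (i + 1) q) ∧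
      Fintype.card U = 1 + 5 * ∑ k ∈ Finset.range n, 3 ^ k ∧ p + 3 = 2 ^ (n + 2) ∧
      q + 3 * n + 7 = 2 ^ (n + 3) ∧ 1 ≤ p ∧ p ≤ q ∧ q ≤ 2 * p ∧ q ≤ r ∧ r ≤ q + 2 * p ∧
      r + 2 * p ≤ 3 * q := by
  induction n with
  | zero => exact ⟨Unit, inferInstance, tetrahedron, 1, 1, 1, tetrahedron_isPlane,
      tetrahedron_isTough, tetrahedron_isPassBound, tetrahedron_hasPass,
      tetrahedron_hasDoublePass, by simp⟩
  | succ n ih =>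
    obtain ⟨U, _, D, p, q, r, h1, h2, h3, h4, h5, h6, h7, h8, h9, h10, h11, h12, h13, h14⟩ := ih
    refine ⟨_, inferInstance, glue octahedron sideFace fun _ => D, 2 * p + 3, q + 2 * p + 3,
      3 * q + 3, octahedron_isPlane.glue isFaces_sideFace fun _ => h1,
      isToughHost_sideFace_one.glue (by omega) fun _ => h2, h3.glue h9 h11 h12 h13 h14,
      sideFace_hasPass h4, sideFace_hasDoublePass h4 h5, ?_, ?_, ?_, by omega, by omega, by omega,
      by omega, by omega, by omega⟩
    · rw [card_side, h6, geom_sum_succ]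
      ring
    · have : 2 ^ (n + 1 + 2) = 2 * 2 ^ (n + 2) := by ring
      omega
    · have h : 2 ^ (n + 1 + 3) = 2 * 2 ^ (n + 3) := by ring
      have h' : 2 ^ (n + 3) = 2 * 2 ^ (n + 2) := by ring
      omega

theorem hubWith_toughness {U : Type} [Fintype U] {D : Disk U} (hD : D.IsPlane)
    (h : D.IsTough 4 5 5 0 5) : (hubWith D).graph.IsTough (5 / 4) := by
  have := le_toughness (p := 5) (q := 4) (by omega) fun X hX =>
    (hubWith_isTough h).le_of_isSeparatingSet (hubWith_isPlane hD) (δ := 0) (by omega) (by omega)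
      (by omega) hX
  exact_mod_cast this

theorem coreWith_toughness {U : Type} [Fintype U] {D : Disk U} (hD : D.IsPlane)
    (h : D.IsTough 7 8 8 0 8) : (coreWith D).graph.IsTough (8 / 7) := by
  have : ∀ s, Finite (CoreType U s) := fun s => Finite.of_fintype _
  have := le_toughness (p := 8) (q := 7) (by omega) fun X hX =>
    (coreWith_isTough h).le_of_isSeparatingSet (coreWith_isPlane hD) (δ := 0) (by omega)
      (by omega) (by omega) hX
  exact_mod_cast this

/-- The slack 1 gives c + 1 ≤ |X| for every separating set. Since c is at most the number N of
vertices, |X|/c ≥ (N + 1)/N, a bound above 1 that does not depend on X. -/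
theorem IsTough.one_lt_toughness {U : Type} [Finite U] {D : Disk U} (hD : D.IsPlane)
    (h : D.IsTough 1 1 1 0 2) : 1 < D.graph.toughness := by
  have hpos : 0 < Nat.card (Fin 3 ⊕ U) := Nat.card_pos
  refine lt_of_lt_of_le ?_ (le_toughness (p := Nat.card (Fin 3 ⊕ U) + 1)
    (q := Nat.card (Fin 3 ⊕ U)) hpos fun X hX => ?_)
  · rw [ENNReal.lt_div_iff_mul_lt (Or.inl (by exact_mod_cast hpos.ne')) (Or.inl (by simp)), one_mul]
    exact_mod_cast Nat.lt_succ_self _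
  · have h1 := h.le_of_isSeparatingSet hD (δ := 1) (by omega) (by omega) (by omega) hX
    have h2 : Nat.card (D.graph.deleteVerts X).ConnectedComponent ≤ Nat.card (Fin 3 ⊕ U) := by
      refine (Nat.card_le_card_of_surjective (D.graph.deleteVerts X).connectedComponentMk
        Quot.mk_surjective).trans (Nat.card_le_card_of_injective _ Subtype.val_injective)
    have h3 := Nat.mul_le_mul_left (Nat.card (Fin 3 ⊕ U)) h1
    rw [one_mul, one_mul, mul_add, mul_one] at h3
    rw [add_mul, one_mul]
    omega

end Disk

end SimpleGraph

theorem proposition2 (n : ℕ) :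
    (∃ (V : Type) (_ : Fintype V) (F : SimpleGraph V),
      F.IsMaximalPlanar ∧
      Fintype.card V = 1 + 101 * ∑ k ∈ Finset.range (n + 1), 30 ^ k ∧
      F.LongestCycleHasCard (1 + 93 * ∑ k ∈ Finset.range (n + 1), 22 ^ k) ∧
      F.IsTough (5 / 4)) ∧
    (∃ (V : Type) (_ : Fintype V) (F : SimpleGraph V),
      F.IsMaximalPlanar ∧
      Fintype.card V = 1 + 14 * ∑ k ∈ Finset.range (n + 1), 6 ^ k ∧
      F.LongestCycleHasCard (1 + 13 * ∑ k ∈ Finset.range (n + 1), 5 ^ k) ∧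
      F.IsTough (8 / 7)) ∧
    (∃ (V : Type) (_ : Fintype V) (F : SimpleGraph V),
      F.IsMaximalPlanar ∧
      Fintype.card V = 4 + 5 * ∑ k ∈ Finset.range (n + 1), 3 ^ k ∧
      (∃ c : ℕ, (c : ℤ) = 3 * 2 ^ (n + 3) - 9 * n - 15 ∧ F.LongestCycleHasCard c) ∧
      1 < F.toughness) := by
  refine ⟨?_, ?_, ?_⟩
  -- The patch accounts for n terms of the geometric sums. The last layer adds one term and needs no
  -- belt, because the corners now count as vertices of the graph.
  · obtain ⟨U, _, D, hD, hU⟩ := SimpleGraph.Disk.exists_isPatch_four_five n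
    refine ⟨_, inferInstance, (SimpleGraph.Disk.hubWith D).graph,
      (SimpleGraph.Disk.hubWith_isPlane hD.isPlane).isMaximalPlanar, ?_, ?_,
      SimpleGraph.Disk.hubWith_toughness hD.isPlane hD.isTough⟩
    · rw [Fintype.card_sum, SimpleGraph.Disk.card_glue]
      simp only [SimpleGraph.Disk.card_side, hU, geom_sum_succ, Finset.sum_const, Finset.card_univ,
        Fintype.card_fin, smul_eq_mul]
      ring
    · rw [SimpleGraph.Disk.hub_cycle_succ]
      exact SimpleGraph.Disk.IsTotalBound.longestCycleHasCard
        (SimpleGraph.Disk.hubWith_isTotalBound hD.isInnerBound)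
        ((SimpleGraph.Disk.hubWith_hasSpan hD.hasPass).exists_isCycle (by omega)
          (SimpleGraph.Disk.hubWith_isPlane hD.isPlane))
  · obtain ⟨U, _, D, hD, hU⟩ := SimpleGraph.Disk.exists_isPatch_seven_eight n
    refine ⟨_, inferInstance, (SimpleGraph.Disk.coreWith D).graph,
      (SimpleGraph.Disk.coreWith_isPlane hD.isPlane).isMaximalPlanar, ?_, ?_,
      SimpleGraph.Disk.coreWith_toughness hD.isPlane hD.isTough⟩
    · rw [Fintype.card_sum, SimpleGraph.Disk.card_core, hU, geom_sum_succ, Fintype.card_fin]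
      ring
    · rw [SimpleGraph.Disk.core_cycle_succ]
      exact SimpleGraph.Disk.IsTotalBound.longestCycleHasCard
        (SimpleGraph.Disk.coreWith_isTotalBound hD.isInnerBound)
        ((SimpleGraph.Disk.coreWith_hasSpan hD.hasPass).exists_isCycle (by omega)
          (SimpleGraph.Disk.coreWith_isPlane hD.isPlane))
  · obtain ⟨U, _, D, p, q, r, h1, h2, h3, h4, h5, h6, h7, h8, h9, h10, h11, h12, h13, h14⟩ :=
      SimpleGraph.Disk.exists_isPassBound n
    have hP : (SimpleGraph.Disk.glue SimpleGraph.Disk.octahedron SimpleGraph.Disk.sideFace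
        fun _ => D).IsPlane :=
      SimpleGraph.Disk.octahedron_isPlane.glue SimpleGraph.Disk.isFaces_sideFace fun _ => h1
    refine ⟨_, inferInstance, _, hP.isMaximalPlanar, ?_, ⟨3 * q + 6, ?_, ?_⟩,
      (SimpleGraph.Disk.isToughHost_sideFace_one.glue (by omega) fun _ => h2).one_lt_toughness hP⟩
    · rw [Fintype.card_sum, SimpleGraph.Disk.card_side, h6, geom_sum_succ, Fintype.card_fin]
      ring
    · have : ((q : ℤ) + 3 * n + 7) = 2 ^ (n + 3) := by exact_mod_cast h8
      push_cast
      linarith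
    -- The bound is 3q + 3 for the inner vertices and 3 for the corners.
    · have hb : (SimpleGraph.Disk.glue SimpleGraph.Disk.octahedron SimpleGraph.Disk.sideFace
          fun _ => D).IsTotalBound (3 * q + 6) := by
        intro V _ _ σ e h
        have hi := (SimpleGraph.Disk.IsPassBound.glue h9 h11 h12 h13 h14 h3).bound σ e h
        have ht := SimpleGraph.Disk.visits_image_le (σ := σ) (e := e)
        omega
      exact hb.longestCycleHasCard (SimpleGraph.Disk.sideFace_exists_isCycle h5)
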